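/- Let $\mathbb G$ be a Carnot group: a connected, simply connected Lie group with stratified Lie algebra $\mathfrak g=\mathfrak g_1\oplus\dots\oplus\mathfrak g_s$, $[\mathfrak g_1,\mathfrak g_k]=\mathfrak g_{k+1}$ for $1\le k\le s$, $\mathfrak g_{s+1}=\{0\}$, identified with $\mathfrak g$ by the exponential map. Put $N=\dim\mathfrak g$ and $Q=\sum_k k\dim\mathfrak g_k$, and let $\delta_\lambda$, $\lambda>0$, be the dilations ($\delta_\lambda=\lambda^k$ on $\mathfrak g_k$). Let $\|\cdot\|$ be a homogeneous norm on $\mathbb G$, i.e. a continuous function $\mathbb G\to[0,\infty)$ with $\|x\|=0\iff x=e$, $\|x^{-1}\|=\|x\|$, $\|\delta_\lambda x\|=\lambda\|x\|$ and $\|xy\|\le\|x\|+\|y\|$; let $d(x,y)=\|y^{-1}x\|$ and let $\mathbf g$ be a Haar measure of $\mathbb G$. For $m\ge 0$, let $\mathcal S^m$ be the spherical Hausdorff measure of $(\mathbb G,d)$, obtained from countable coverings by closed balls $B_i$ of diameter at most $\delta\to0$ with weight $\sum_i\operatorname{diam}(B_i)^m$. A homogeneous subgroup is a closed subgroup invariant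 under all $\delta_\lambda$; it is a $(d_t,d_m)$-subgroup if its Lie algebra has dimension $d_t$ and its Hausdorff dimension with respect to $d$ is $d_m$. A decomposition $\mathbb G=\mathbb M\cdot\mathbb H$ is a pair of homogeneous subgroups such that each $p\in\mathbb G$ is uniquely $p=P_{\mathbb M}p\cdot P_{\mathbb H}p$ with $P_{\mathbb M}p\in\mathbb M$, $P_{\mathbb H}p\in\mathbb H$. For $\beta>0$ let $C_{\mathbb M,\mathbb H}(q,\beta)=q\cdot\{p:\|P_{\mathbb M}p\|\le\beta\|P_{\mathbb H}p\|\}$. A map $f\colon\Omega\to\mathbb H$ on an open set $\Omega\subset\mathbb M$, with graph $\{m\cdot f(m):m\in\Omega\}$, is intrinsic Lipschitz if for some $L>0$ one has $C_{\mathbb M,\mathbb H}(p,1/L)\cap\operatorname{graph}f=\{p\}$ for all $p\in\operatorname{graph}f$. Let $1\le d_t\le N-1$ and $1\le d_m\le Q-1$. Given a set $\mathcal D$ of decompositions, a non-empty set $S\subset\mathbb G$ is called an intrinsic $(d_t,d_m)$-Lipschitz surface over $\mathcal D$ if every $x\in S$ has an open neighbourhood $V$ for which there are a decomposition $\mathbb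 G=\mathbb M\cdot\mathbb H$ in $\mathcal D$ with $\mathbb M$ a $(d_t,d_m)$-subgroup, an open set $\Omega\subset\mathbb M$ and an intrinsic Lipschitz map $f\colon\Omega\to\mathbb H$ with $S\cap V=\operatorname{graph}f\cap V$. Let $\operatorname{Iso}(\mathbb G)$ be the group of all group automorphisms of $\mathbb G$ that preserve every layer $\mathfrak g_k$ and the norm $\|\cdot\|$. For $0<p<\infty$ the $p$-module of a family $\mathbf E$ of Borel measures on $\mathbb G$ is $$M_p(\mathbf E)=\inf\Big\{\int_{\mathbb G}f^p\,d\mathbf g:\ f\colon\mathbb G\to[0,\infty)\ \text{Borel},\ \int_{\mathbb G}f\,d\mu\ge1\ \text{for all}\ \mu\in\mathbf E\Big\},\qquad \inf\emptyset=+\infty .$$ **Theorem.** Let $\mathbb G=\mathbb M_\alpha\cdot\mathbb H_\alpha$, $\alpha=1,\dots,l$, be finitely many decompositions, let $K_\alpha$ be a subgroup of $\operatorname{Iso}(\mathbb G)$ for each $\alpha$, and let $$\mathcal D=\bigcup_{\alpha=1}^{l}\big\{(k(\mathbb M_\alpha),k(\mathbb H_\alpha)):\ k\in K_\alpha\big\}$$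 be the union of the orbits of these decompositions. Let $\Sigma$ be any family of intrinsic $(d_t,d_m)$-Lipschitz surfaces over $\mathcal D$, let $\mathcal U\subset\mathbb G$ be an open set, and let $$\mathbf E_{\mathcal U}=\{\mathcal S^{d_m}\llcorner(S\cap\mathcal U):\ S\in\Sigma,\ S\cap\mathcal U\ne\emptyset\}.$$ Then $M_p(\mathbf E_{\mathcal U})=0$ for every $p\in(0,1)$. -/

import Mathlib

open MeasureTheory Set Filter Topology
open scoped NNReal ENNReal Manifold ContDiff

/-! ### Carnot groups in exponential coordinates -/

/-- The dilation `δ_t` of a graded vector space `E = ⨁ₖ Vₖ`: the linear map equal to `t ^ k` on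
`Vₖ`. -/
noncomputable def gradedDilation {E : Type*} [AddCommGroup E] [Module ℝ E]
    (V : ℕ → Submodule ℝ E) (hV : DirectSum.IsInternal V) (t : ℝ) : E →ₗ[ℝ] E :=
  (DirectSum.toModule ℝ ℕ E fun k => t ^ k • (V k).subtype) ∘ₗ
    (LinearEquiv.ofBijective (DirectSum.coeLinearMap V) hV).symm.toLinearMap

/-- The Lie bracket of left-invariant vector fields, for a Lie group whose underlying manifold is a
vector space `G`; the tangent space at the identity is identified with `G`. -/
noncomputable def coordLieBracket (G : Type*) [NormedAddCommGroup G] [NormedSpace ℝ G] [Group G]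
    (x y : G) : G :=
  let v : GroupLieAlgebra 𝓘(ℝ, G) G := x
  let w : GroupLieAlgebra 𝓘(ℝ, G) G := y
  (⁅v, w⁆ : GroupLieAlgebra 𝓘(ℝ, G) G)

/-- A Carnot group, written in exponential coordinates of the first kind: the vector space `G`
is the Lie algebra of the Lie group `G`, and the exponential map is the identity. The vector space
operations are those of the Lie algebra; `*` is the group operation. The norm of `G` only serves to
fix the topology and the smooth structure of the finite-dimensional vector space. -/
class CarnotGroup (G : Type*) [NormedAddCommGroup G] [NormedSpace ℝ G] [FiniteDimensional ℝ G]
    [Group G] extends LieGroup 𝓘(ℝ, G) ∞ G where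
  /-- The layers `𝔤ₖ`, `k ≥ 1`, of the stratification. -/
  layer : ℕ → Submodule ℝ G
  layer_zero : layer 0 = ⊥
  isInternal : DirectSum.IsInternal layer
  exists_step : ∃ l : ℕ, ∀ k, l < k → layer k = ⊥
  bracket_layer : ∀ k, 1 ≤ k →
    Submodule.span ℝ {z | ∃ x ∈ layer 1, ∃ y ∈ layer k, z = coordLieBracket G x y} = layer (k + 1)
  /-- `s ↦ s • x` is the one-parameter subgroup with velocity `x`, i.e. `exp = id`. -/
  smul_mul_smul : ∀ (s t : ℝ) (x : G), (s • x) * (t • x) = (s + t) • x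
  /-- The dilations of the Lie algebra are automorphisms of the group. -/
  dilation_mul : ∀ t : ℝ, 0 < t → ∀ x y : G,
    gradedDilation layer isInternal t (x * y) =
      gradedDilation layer isInternal t x * gradedDilation layer isInternal t y

namespace CarnotGroup

variable {G : Type*} [NormedAddCommGroup G] [NormedSpace ℝ G] [FiniteDimensional ℝ G] [Group G]
  [CarnotGroup G]

/-- The intrinsic dilation `δ_t`. -/
noncomputable def dilation (t : ℝ) : G →ₗ[ℝ] G :=
  gradedDilation (layer (G := G)) isInternal t

variable (G) in
/-- The homogeneous dimension `Q = ∑ₖ k dim 𝔤ₖ`. -/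
noncomputable def homogeneousDim : ℕ :=
  ∑ᶠ k : ℕ, k * Module.finrank ℝ (layer (G := G) k)

theorem one_eq_zero : (1 : G) = 0 := by
  have h := smul_mul_smul (G := G) 0 0 0
  simp only [smul_zero] at h
  exact (mul_eq_left.mp h).symm

theorem exists_dilation_eq_sum (x : G) : ∃ (s : Finset ℕ) (y : ℕ → G),
    (∀ k, y k ∈ layer (G := G) k) ∧ ∀ t : ℝ, dilation t x = ∑ k ∈ s, t ^ k • y k := by
  classical
  set y := (LinearEquiv.ofBijective (DirectSum.coeLinearMap (layer (G := G))) isInternal).symm x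
  refine ⟨y.support, fun k => y k, fun k => (y k).2, fun t => ?_⟩
  change DirectSum.toModule ℝ ℕ G (fun k => t ^ k • (layer (G := G) k).subtype) y = _
  rw [DirectSum.toModule, DFinsupp.lsum_apply_apply, DFinsupp.sumAddHom_apply]
  rfl

theorem dilation_one (x : G) : dilation (1 : ℝ) x = x := by
  have : (DirectSum.toModule ℝ ℕ G fun k => (1 : ℝ) ^ k • (layer (G := G) k).subtype) =
      DirectSum.coeLinearMap (layer (G := G)) := by
    simp only [one_pow, one_smul]
    rfl
  rw [dilation, gradedDilation, this]
  exact LinearEquiv.apply_symm_apply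
    (LinearEquiv.ofBijective (DirectSum.coeLinearMap (layer (G := G))) isInternal) x

theorem dilation_zero (x : G) : dilation (0 : ℝ) x = 0 := by
  obtain ⟨s, y, hy, h⟩ := exists_dilation_eq_sum x
  rw [h]
  refine Finset.sum_eq_zero fun k _ => ?_
  rcases Nat.eq_zero_or_pos k with rfl | hk
  · have := hy 0
    rw [layer_zero, Submodule.mem_bot] at this
    simp [this]
  · simp [hk.ne']

theorem continuous_dilation (x : G) : Continuous fun t : ℝ => dilation t x := by
  obtain ⟨s, y, -, h⟩ := exists_dilation_eq_sum x
  simp only [h]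
  fun_prop

/-! ### Homogeneous norms and distances -/

variable (G) in
/-- A homogeneous norm on a Carnot group. -/
structure HomogeneousNorm where
  toFun : G → ℝ
  continuous' : Continuous toFun
  nonneg' : ∀ p, 0 ≤ toFun p
  eq_zero_iff' : ∀ p, toFun p = 0 ↔ p = 1
  inv' : ∀ p, toFun p⁻¹ = toFun p
  dilation' : ∀ t : ℝ, 0 < t → ∀ p, toFun (dilation t p) = t * toFun p
  mul_le' : ∀ p q, toFun (p * q) ≤ toFun p + toFun q

namespace HomogeneousNorm

instance : CoeFun (HomogeneousNorm G) fun _ => G → ℝ := ⟨HomogeneousNorm.toFun⟩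

variable (ν : HomogeneousNorm G)

theorem comap_le_nhds : comap ν (𝓝 0) ≤ 𝓝 (1 : G) := by
  rw [one_eq_zero]
  intro W hW
  obtain ⟨r, hr, hrW⟩ := Metric.mem_nhds_iff.mp hW
  by_cases hS : (Metric.sphere (0 : G) (r / 2)).Nonempty
  · obtain ⟨x₀, hx₀, hmin⟩ :=
      (isCompact_sphere (0 : G) (r / 2)).exists_isMinOn hS ν.continuous'.continuousOn
    have hpos : 0 < ν x₀ := by
      refine lt_of_le_of_ne (ν.nonneg' _) fun h => ?_
      have := (ν.eq_zero_iff' x₀).mp h.symm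
      rw [this, one_eq_zero] at hx₀
      simp at hx₀
      linarith
    refine mem_comap.mpr ⟨Iio (ν x₀), Iio_mem_nhds hpos, fun x hx => hrW ?_⟩
    by_contra hxr
    have hxr' : r ≤ ‖x‖ := by simpa using hxr
    have hc : ContinuousOn (fun t : ℝ => ‖dilation t x‖) (Icc 0 1) :=
      (continuous_dilation x).norm.continuousOn
    have hmem : r / 2 ∈ Icc ‖dilation (0 : ℝ) x‖ ‖dilation (1 : ℝ) x‖ := by
      rw [dilation_zero, dilation_one, norm_zero]
      constructor <;> linarith
    obtain ⟨t, ⟨ht0, ht1⟩, ht⟩ := intermediate_value_Icc zero_le_one hc hmem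
    have ht0' : 0 < t := by
      refine lt_of_le_of_ne ht0 fun h => ?_
      simp only [← h, dilation_zero, norm_zero] at ht
      linarith
    have h1 : ν x₀ ≤ ν (dilation t x) := hmin (by simpa using ht)
    rw [ν.dilation' t ht0'] at h1
    have h2 : ν x < ν x₀ := hx
    nlinarith [ν.nonneg' x]
  · refine mem_comap.mpr ⟨univ, univ_mem, fun x _ => hrW ?_⟩
    by_contra hxr
    have hxr' : r ≤ ‖x‖ := by simpa using hxr
    refine hS ⟨(r / 2 / ‖x‖) • x, ?_⟩
    have : 0 < ‖x‖ := by linarith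
    simp only [mem_sphere_iff_norm, sub_zero, norm_smul, norm_div, Real.norm_eq_abs]
    rw [abs_of_pos hr]
    field_simp
    norm_num
    ring

theorem nhds_eq_comap (p : G) : 𝓝 p = comap (fun q => ν (p⁻¹ * q)) (𝓝 0) := by
  have : IsTopologicalGroup G := topologicalGroup_of_lieGroup 𝓘(ℝ, G) ∞
  apply le_antisymm
  · rw [← tendsto_iff_comap]
    have hc : Continuous fun q => ν (p⁻¹ * q) := ν.continuous'.comp (continuous_const.mul continuous_id)
    have := hc.tendsto p
    rwa [inv_mul_cancel, (ν.eq_zero_iff' 1).mpr rfl] at this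
  · have h := comap_mono (m := fun q => p⁻¹ * q) ν.comap_le_nhds
    rw [comap_comap] at h
    refine h.trans (le_of_eq ?_)
    have := (Homeomorph.mulLeft p⁻¹).comap_nhds_eq 1
    refine this.trans (congrArg 𝓝 ?_)
    rw [Homeomorph.symm_apply_eq]
    simp

/-- The metric `d(p, q) = ‖q⁻¹ p‖` before its topology is identified with that of `G`. -/
noncomputable abbrev preMetricSpace : MetricSpace G where
  dist p q := ν (q⁻¹ * p)
  dist_self p := by simp [(ν.eq_zero_iff' 1).mpr rfl]
  dist_comm p q := by rw [← ν.inv', mul_inv_rev, inv_inv]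
  dist_triangle p q r := by
    have := ν.mul_le' (r⁻¹ * q) (q⁻¹ * p)
    rw [mul_assoc, mul_inv_cancel_left] at this
    linarith
  eq_of_dist_eq_zero {p q} h := by
    have := (ν.eq_zero_iff' _).mp h
    exact (inv_mul_eq_one.mp this).symm

theorem topology_eq : (inferInstance : TopologicalSpace G) =
    ν.preMetricSpace.toUniformSpace.toTopologicalSpace := by
  refine TopologicalSpace.ext_nhds fun p => ?_
  have h := @nhds_comap_dist G ν.preMetricSpace.toPseudoMetricSpace p
  rw [← h]
  exact ν.nhds_eq_comap p

/-- The homogeneous left-invariant distance `d(p, q) = ‖q⁻¹ p‖` of a homogeneous norm. Its topology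
is the topology of the Carnot group. -/
noncomputable abbrev metricSpace : MetricSpace G :=
  @MetricSpace.replaceTopology G inferInstance ν.preMetricSpace ν.topology_eq

end HomogeneousNorm

end CarnotGroup

/-! ### Spherical Hausdorff measures and the module of a family of measures -/

/-- The spherical Hausdorff measure `𝒮ˢ` of a metric space: Carathéodory's construction from
coverings by closed balls `B`, of weight `diam(B) ^ s`. -/
noncomputable def sphericalMeasure (X : Type*) [MetricSpace X] [MeasurableSpace X] [BorelSpace X]
    (s : ℝ) : Measure X :=
  Measure.mkMetric' fun E : Set X =>
    ⨅ (x : X) (r : ℝ) (_ : 0 < r) (_ : E = Metric.closedBall x r), Metric.ediam E ^ s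

/-- The `p`-module of a family `E` of measures, with respect to the basic measure `m`. -/
noncomputable def pModule {X : Type*} [MeasurableSpace X] (m : Measure X) (p : ℝ)
    (E : Set (Measure X)) : ℝ≥0∞ :=
  ⨅ (f : X → ℝ≥0) (_ : Measurable f) (_ : ∀ μ ∈ E, 1 ≤ ∫⁻ x, (f x : ℝ≥0∞) ∂μ),
    ∫⁻ x, (f x : ℝ≥0∞) ^ p ∂m

namespace CarnotGroup

variable {G : Type*} [NormedAddCommGroup G] [NormedSpace ℝ G] [FiniteDimensional ℝ G] [Group G]
  [CarnotGroup G]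

/-- The measure `𝒮ˢ` of the distance of a homogeneous norm. -/
noncomputable def HomogeneousNorm.sphericalMeasure (ν : HomogeneousNorm G) [MeasurableSpace G]
    [hB : BorelSpace G] (s : ℝ) : Measure G :=
  @_root_.sphericalMeasure G ν.metricSpace _ hB s

/-- The metric dimension of a set: its Hausdorff dimension for the distance of `ν`. -/
noncomputable def HomogeneousNorm.metricDim (ν : HomogeneousNorm G) (A : Set G) : ℝ≥0∞ :=
  @dimH G ν.metricSpace.toEMetricSpace A

/-! ### Homogeneous subgroups, decompositions, isometries -/

/-- A homogeneous subgroup: a closed (Lie) subgroup invariant under the dilations. -/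
def IsHomogeneousSubgroup (M : Subgroup G) : Prop :=
  IsClosed (M : Set G) ∧ ∀ t : ℝ, 0 < t → ∀ x ∈ M, dilation t x ∈ M

/-- The Lie algebra `{x | exp (t x) ∈ M for all t}` of a closed subgroup `M`; as `exp = id`, it is
read inside `G`. (This set is a linear subspace, so taking the span does not enlarge it.) -/
def lieAlgebraOf (M : Subgroup G) : Submodule ℝ G :=
  Submodule.span ℝ {x | ∀ t : ℝ, t • x ∈ M}

/-- `M` is a `(dₜ, dₘ)`-subgroup: a homogeneous subgroup of topological dimension `dₜ` and metric
dimension `dₘ`. -/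
def IsSubgroupOfDims (ν : HomogeneousNorm G) (dt : ℕ) (dm : ℝ≥0) (M : Subgroup G) : Prop :=
  IsHomogeneousSubgroup M ∧ Module.finrank ℝ (lieAlgebraOf M) = dt ∧
    ν.metricDim (M : Set G) = dm

variable (G) in
/-- A decomposition `G = M · H` into complementary homogeneous subgroups. -/
structure Decomposition where
  M : Subgroup G
  H : Subgroup G
  homogeneous_M : IsHomogeneousSubgroup M
  homogeneous_H : IsHomogeneousSubgroup H
  /-- Every element of `G` is in a unique way a product of an element of `M` and one of `H`. -/
  complement : Subgroup.IsComplement' M H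

/-- The projection `G = M · H → M`. -/
noncomputable def Decomposition.projM (D : Decomposition G) (p : G) : G :=
  ((Subgroup.IsComplement.equiv D.complement p).1 : G)

/-- The projection `G = M · H → H`. -/
noncomputable def Decomposition.projH (D : Decomposition G) (p : G) : G :=
  ((Subgroup.IsComplement.equiv D.complement p).2 : G)

/-- The grading-preserving isometries: the group automorphisms that preserve every layer of the
stratification and the homogeneous norm (hence the distance). -/
def gradedIsometryGroup (ν : HomogeneousNorm G) : Subgroup (MulAut G) where
  carrier := {φ | (∀ k, φ '' (layer (G := G) k : Set G) = layer (G := G) k) ∧ ∀ p, ν (φ p) = ν p}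
  mul_mem' {φ ψ} hφ hψ := by
    refine ⟨fun k => ?_, fun p => ?_⟩
    · rw [MulAut.coe_mul, image_comp, hψ.1, hφ.1]
    · rw [MulAut.mul_apply, hφ.2, hψ.2]
  one_mem' := ⟨fun k => by simp, fun p => rfl⟩
  inv_mem' {φ} hφ := by
    refine ⟨fun k => ?_, fun p => ?_⟩
    · conv_lhs => rw [← hφ.1 k]
      rw [← image_comp, ← MulAut.coe_mul, inv_mul_cancel]
      simp
    · rw [← hφ.2 (φ⁻¹ p), MulAut.apply_inv_self]

/-- The orbit of a decomposition `G = M · H`: the decompositions `G = k(M) · k(H)`, `k ∈ K`. -/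
def Decomposition.orbit (D : Decomposition G) (K : Subgroup (MulAut G)) :
    Set (Decomposition G) :=
  {D' | ∃ k ∈ K, D'.M = D.M.map k.toMonoidHom ∧ D'.H = D.H.map k.toMonoidHom}

/-! ### Intrinsic Lipschitz graphs and surfaces -/

/-- The intrinsic cone with vertex `q` and opening `β`. -/
def Decomposition.cone (D : Decomposition G) (ν : HomogeneousNorm G) (q : G) (β : ℝ) : Set G :=
  (fun p => q * p) '' {p | ν (D.projM p) ≤ β * ν (D.projH p)}

/-- The intrinsic graph of `f : Ω → H`, `Ω ⊆ M` (the values of `f` outside `Ω` play no role). -/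
def Decomposition.graph (D : Decomposition G) (Ω : Set D.M) (f : D.M → D.H) : Set G :=
  (fun m : D.M => (m : G) * (f m : G)) '' Ω

/-- `f : Ω → H` is an intrinsic Lipschitz function. -/
def Decomposition.IsIntrinsicLipschitz (D : Decomposition G) (ν : HomogeneousNorm G)
    (Ω : Set D.M) (f : D.M → D.H) : Prop :=
  ∃ L : ℝ, 0 < L ∧ ∀ p ∈ D.graph Ω f, D.cone ν p (1 / L) ∩ D.graph Ω f = {p}

/-- `S` is an intrinsic `(dₜ, dₘ)`-Lipschitz surface which near each of its points is an intrinsic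
Lipschitz graph over a decomposition `G = M · H` belonging to `𝒟`. For `𝒟 = Set.univ` this is the
notion of an intrinsic `(dₜ, dₘ)`-Lipschitz surface. -/
def IsIntrinsicLipschitzSurface (ν : HomogeneousNorm G) (𝒟 : Set (Decomposition G)) (dt : ℕ)
    (dm : ℝ≥0) (S : Set G) : Prop :=
  (1 ≤ dt ∧ dt + 1 ≤ Module.finrank ℝ G) ∧ (1 ≤ dm ∧ dm + 1 ≤ homogeneousDim G) ∧
  S.Nonempty ∧
  ∀ x ∈ S, ∃ U : Set G, IsOpen U ∧ x ∈ U ∧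
    ∃ D ∈ 𝒟, IsSubgroupOfDims ν dt dm D.M ∧
      ∃ (Ω : Set D.M) (f : D.M → D.H), IsOpen Ω ∧ D.IsIntrinsicLipschitz ν Ω f ∧
        S ∩ U = D.graph Ω f ∩ U

end CarnotGroup

/-! Put d_n = 2^(-n!). There are disjoint closed sets K_n in ℝ of density d_n/2, evenly distributed
on bounded intervals up to an error O(d_{n+1}) (`exists_sparse_sets`). For a suitable function u on
the group, let h = 1/d_n on u⁻¹(K_n) and h = 0 elsewhere. If u⁻¹(K_n) has Haar measure O(d_n) in
balls, then ∫ h^p is locally bounded by a multiple of Σ d_n^(1-p), which is finite because p < 1. If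
a surface measure σ gives u⁻¹(K_n), inside some ball, mass at least c d_n for infinitely many n,
then ∫ h dσ = ∞. Damping h by small constants on concentric shells makes the p-integral as small as
desired and keeps the σ-integrals infinite (`pModule_eq_zero_of_infinite`). The module is
subadditive, so it suffices that finitely many functions u serve all surfaces.

The functions are u = ξ ∘ P_M ∘ κ, where ξ is a linear functional on M of lowest weight, hence
additive for the group law, and κ belongs to the group acting on the decomposition. Along suitable
one-parameter translations u grows with unit speed, and Fubini's theorem gives the Haar estimate
(`exists_measure_preimage_le`).

For the surfaces, an automorphism k moves the graph to a graph Φ over the fixed subgroup M, and the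
spherical measure dominates the Haar measure μ of projections to M (`exists_measure_pr_image_le`).
It remains to bound μ{ξ ∘ T ∈ K_n} from below for T = P_M ∘ κ ∘ k ∘ Φ, a map of which only
continuity is known. Smooth approximations of Φ at scale 2^(-j) (`exists_smooth_approximation`) give
maps T_j. Their Jacobians are uniformly bounded, because the action m ↦ P_M(g m) of the group on M
has Jacobian one and the dilations cancel; only the full derivative grows, like 2^(js). Determinants
are null Lagrangians, so for every continuous |ψ| ≤ 1 the integral of χ ψ(ξ T_j) det DT_j changes by
O(2^(-j)) from j to j+1, regardless of the derivative of ψ. Taking ψ close to the indicator of K_n,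
and integrating by parts at level j against the primitive of 1_{K_n} - d_n/2, one gets
(`exists_lower_bound_of_approximation`) (d_n/2) |∫ χ det DT_j| ≤ C (μ{ξ ∘ T ∈ K_n} + 2^(-j) + 2^(jN)
d_{n+1}). For j = 2 n! the last two terms are O(d_n^2), since d_{n+1} = d_n^(n+1).

Finally ∫ χ det DT_j must stay away from zero. For κ = k⁻¹ the map T_j is the identity. The forms A
↦ det(DP_M κ A) span a finite-dimensional space, so finitely many κ represent the form of k⁻¹ for
every k (`exists_finset_det_comp`). Hence for each j one of them has a large integral, and one κ
occurs for infinitely many n. -/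

namespace CarnotGroup

variable {G : Type*} [NormedAddCommGroup G] [NormedSpace ℝ G] [FiniteDimensional ℝ G] [Group G]
  [CarnotGroup G]

/-! ### The group law in coordinates -/

theorem contDiff_mul_prod : ContDiff ℝ ∞ (fun p : G × G => p.1 * p.2) := by
  rw [← contMDiff_iff_contDiff, modelWithCornersSelf_prod, ← chartedSpaceSelf_prod]
  exact contMDiff_mul 𝓘(ℝ, G) ∞

theorem contDiff_inv_coord : ContDiff ℝ ∞ (fun p : G => p⁻¹) :=
  contMDiff_iff_contDiff.mp (contMDiff_inv 𝓘(ℝ, G) ∞ (G := G))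

instance isTopologicalGroup_coord : IsTopologicalGroup G := topologicalGroup_of_lieGroup 𝓘(ℝ, G) ∞

theorem _root_.ContDiff.carnotMul {E : Type*} [NormedAddCommGroup E] [NormedSpace ℝ E] {f g : E → G}
    (hf : ContDiff ℝ ∞ f) (hg : ContDiff ℝ ∞ g) : ContDiff ℝ ∞ (fun x => f x * g x) :=
  contDiff_mul_prod.comp (hf.prodMk hg)

theorem _root_.ContDiff.carnotInv {E : Type*} [NormedAddCommGroup E] [NormedSpace ℝ E] {f : E → G}
    (hf : ContDiff ℝ ∞ f) : ContDiff ℝ ∞ (fun x => (f x)⁻¹) :=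
  contDiff_inv_coord.comp hf

theorem mul_zero_coord (x : G) : x * (0 : G) = x := by rw [← one_eq_zero, mul_one]

theorem zero_mul_coord (x : G) : (0 : G) * x = x := by rw [← one_eq_zero, one_mul]

theorem inv_eq_neg (x : G) : x⁻¹ = -x := by
  have h := smul_mul_smul (1 : ℝ) (-1) x
  rw [one_smul, neg_one_smul, add_neg_cancel, zero_smul, ← one_eq_zero] at h
  exact inv_eq_of_mul_eq_one_right h

theorem pow_eq_smul (x : G) (n : ℕ) : x ^ n = (n : ℝ) • x := by
  induction n with
  | zero => simp [one_eq_zero]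
  | succ n ih =>
    rw [pow_succ, ih]
    have := smul_mul_smul (n : ℝ) 1 x
    rw [one_smul] at this
    rw [this]; push_cast; rfl

theorem zpow_eq_smul (x : G) (n : ℤ) : x ^ n = (n : ℝ) • x := by
  cases n with
  | ofNat n => simpa using pow_eq_smul x n
  | negSucc n => rw [zpow_negSucc, pow_eq_smul, inv_eq_neg, ← neg_smul]; push_cast; rfl

/-- The product is smooth and restricts to the identity on both axes, because `0` is the unit; this
determines its derivative. -/
theorem hasStrictFDerivAt_mul_zero : HasStrictFDerivAt (fun p : G × G => p.1 * p.2)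
    (ContinuousLinearMap.fst ℝ G G + ContinuousLinearMap.snd ℝ G G) ((0, 0) : G × G) := by
  have h := (contDiff_mul_prod (G := G)).contDiffAt.hasStrictFDerivAt (x := (0, 0)) (by simp)
  have hd := h.hasFDerivAt
  suffices hs : ContinuousLinearMap.fst ℝ G G + ContinuousLinearMap.snd ℝ G G =
      fderiv ℝ (fun p : G × G => p.1 * p.2) (0, 0) by rw [hs]; exact h
  refine ContinuousLinearMap.ext fun p => ?_
  have h1 : HasFDerivAt (fun x : G => ((x, (0 : G)) : G × G)) (ContinuousLinearMap.inl ℝ G G) 0 :=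
    (ContinuousLinearMap.inl ℝ G G).hasFDerivAt
  have h2 := HasFDerivAt.comp (0 : G) (g := fun p : G × G => p.1 * p.2) (by exact hd) h1
  have h3 : ((fun p : G × G => p.1 * p.2) ∘ fun x : G => ((x, (0 : G)) : G × G)) = id := by
    ext x; simp [mul_zero_coord]
  rw [h3] at h2
  have h4 := congrArg (fun f => f p.1) (h2.unique (hasFDerivAt_id 0))
  have h1' : HasFDerivAt (fun x : G => (((0 : G), x) : G × G)) (ContinuousLinearMap.inr ℝ G G) 0 :=
    (ContinuousLinearMap.inr ℝ G G).hasFDerivAt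
  have h2' := HasFDerivAt.comp (0 : G) (g := fun p : G × G => p.1 * p.2) (by exact hd) h1'
  have h3' : ((fun p : G × G => p.1 * p.2) ∘ fun x : G => (((0 : G), x) : G × G)) = id := by
    ext x; simp [zero_mul_coord]
  rw [h3'] at h2'
  have h4' := congrArg (fun f => f p.2) (h2'.unique (hasFDerivAt_id 0))
  simp only [ContinuousLinearMap.comp_apply, ContinuousLinearMap.inl_apply,
    ContinuousLinearMap.inr_apply, ContinuousLinearMap.id_apply] at h4 h4'
  rw [add_apply, ContinuousLinearMap.coe_fst', ContinuousLinearMap.coe_snd']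
  nth_rewrite 1 [← h4, ← h4']
  rw [← map_add]
  simp

/-- Trotter's formula. -/
theorem tendsto_smul_mul (x y : G) :
    Tendsto (fun n : ℕ => (n : ℝ) • (((n : ℝ)⁻¹ • x) * ((n : ℝ)⁻¹ • y))) atTop (𝓝 (x + y)) := by
  have h1 : HasDerivAt (fun t : ℝ => (t • x) * (t • y)) (x + y) 0 := by
    have h2 : HasFDerivAt (fun t : ℝ => ((t • x, t • y) : G × G))
        ((ContinuousLinearMap.toSpanSingleton ℝ x).prod (ContinuousLinearMap.toSpanSingleton ℝ y)) 0 :=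
      ((ContinuousLinearMap.toSpanSingleton ℝ x).prod
        (ContinuousLinearMap.toSpanSingleton ℝ y)).hasFDerivAt
    have h3 : HasFDerivAt (fun p : G × G => p.1 * p.2)
      (ContinuousLinearMap.fst ℝ G G + ContinuousLinearMap.snd ℝ G G)
      ((fun t : ℝ => ((t • x, t • y) : G × G)) 0) := by
        simpa using hasStrictFDerivAt_mul_zero.hasFDerivAt
    have := (h3.comp (0 : ℝ) h2).hasDerivAt
    simpa [Function.comp_def] using this
  have h2 := (hasDerivAt_iff_tendsto_slope_zero.mp h1)
  have h3 : Tendsto (fun n : ℕ => (n : ℝ)⁻¹) atTop (𝓝[≠] 0) := by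
    refine tendsto_nhdsWithin_iff.mpr ⟨tendsto_inv_atTop_nhds_zero_nat, ?_⟩
    filter_upwards [eventually_gt_atTop 0] with n hn
    simp; lia
  have h4 := h2.comp h3
  refine h4.congr fun n => ?_
  simp [mul_zero_coord]

/-! ### Dilations -/

theorem dilation_apply_layer (t : ℝ) {k : ℕ} {x : G} (hx : x ∈ layer (G := G) k) :
    dilation t x = t ^ k • x := by
  classical
  have h : (LinearEquiv.ofBijective (DirectSum.coeLinearMap (layer (G := G))) isInternal).symm x =
      DirectSum.lof ℝ ℕ (fun k => layer (G := G) k) k ⟨x, hx⟩ := by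
    rw [LinearEquiv.symm_apply_eq]
    exact (DirectSum.coeLinearMap_lof (layer (G := G)) k ⟨x, hx⟩).symm
  change DirectSum.toModule ℝ ℕ G (fun k => t ^ k • (layer (G := G) k).subtype) _ = _
  erw [h]
  simp

variable (G) in
theorem exists_components : ∃ (s : ℕ) (c : ℕ → G →L[ℝ] G),
    (∀ t : ℝ, ∀ x, dilation t x = ∑ k ∈ Finset.Icc 1 s, t ^ k • c k x) ∧
      ∀ k x, c k x ∈ layer (G := G) k := by
  classical
  obtain ⟨s, hs⟩ := exists_step (G := G)
  let e := (LinearEquiv.ofBijective (DirectSum.coeLinearMap (layer (G := G))) isInternal).symm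
  refine ⟨s, fun k => LinearMap.toContinuousLinearMap
    ((layer (G := G) k).subtype ∘ₗ DirectSum.component ℝ ℕ (fun k => layer (G := G) k) k ∘ₗ
      e.toLinearMap), fun t x => ?_, fun k x => ?_⟩
  · change DirectSum.toModule ℝ ℕ G (fun k => t ^ k • (layer (G := G) k).subtype) (e x) = _
    rw [DirectSum.toModule, DFinsupp.lsum_apply_apply, DFinsupp.sumAddHom_apply]
    refine Finset.sum_subset_zero_on_sdiff ?_ ?_ ?_
    · intro k hk
      rw [DFinsupp.mem_support_iff] at hk
      rw [Finset.mem_Icc]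
      by_contra hcon
      refine hk ?_
      have : layer (G := G) k = ⊥ := by
        rcases Nat.eq_zero_or_pos k with rfl | h
        · exact layer_zero
        · exact hs k (by lia)
      exact Subtype.ext ((Submodule.eq_bot_iff _).mp this _ (e x k).2)
    · intro k hk
      have hk := (Finset.mem_sdiff.mp hk).2
      rw [DFinsupp.notMem_support_iff] at hk
      have : DirectSum.component ℝ ℕ (fun k => layer (G := G) k) k (e x) = 0 := hk
      simp [this]
    · intro k hk
      rfl
  · exact (DirectSum.component ℝ ℕ (fun k => layer (G := G) k) k (e x)).2

/-- The dilation `δ_t` as a continuous linear map. -/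
noncomputable def dil (t : ℝ) : G →L[ℝ] G := LinearMap.toContinuousLinearMap (dilation t)

theorem dil_apply (t : ℝ) (x : G) : dil t x = dilation t x := rfl

theorem dil_mul {t : ℝ} (ht : 0 < t) (x y : G) : dil t (x * y) = dil t x * dil t y :=
  dilation_mul t ht x y

theorem dil_inv (t : ℝ) (x : G) : dil t x⁻¹ = (dil t x)⁻¹ := by
  rw [inv_eq_neg, inv_eq_neg, map_neg]

@[simp] theorem dil_one (x : G) : dil (1 : ℝ) x = x := dilation_one x

theorem dil_dil (s t : ℝ) (x : G) : dil s (dil t x) = dil (s * t) x := by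
  obtain ⟨l, c, hc, hl⟩ := exists_components G
  simp only [dil_apply]
  rw [hc t, hc (s * t), map_sum]
  refine Finset.sum_congr rfl fun k _ => ?_
  rw [map_smul, dilation_apply_layer s (hl k x), smul_smul, mul_pow, mul_comm]

theorem dil_inv_dil {t : ℝ} (ht : t ≠ 0) (x : G) : dil t⁻¹ (dil t x) = x := by
  rw [dil_dil, inv_mul_cancel₀ ht, dil_one]

theorem dil_dil_inv {t : ℝ} (ht : t ≠ 0) (x : G) : dil t (dil t⁻¹ x) = x := by
  rw [dil_dil, mul_inv_cancel₀ ht, dil_one]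

theorem continuous_dil : Continuous (dil : ℝ → G →L[ℝ] G) := by
  obtain ⟨l, c, hc, hl⟩ := exists_components G
  have : (dil : ℝ → G →L[ℝ] G) = fun t => ∑ k ∈ Finset.Icc 1 l, t ^ k • c k := by
    ext t x; simp [dil_apply, hc]
  rw [this]; fun_prop

variable (G) in
theorem exists_norm_dil_le : ∃ C : ℝ, 0 < C ∧ ∀ t : ℝ, 0 ≤ t → t ≤ 1 → ‖dil (G := G) t‖ ≤ C * t := by
  obtain ⟨l, c, hc, hl⟩ := exists_components G
  have : (dil : ℝ → G →L[ℝ] G) = fun t => ∑ k ∈ Finset.Icc 1 l, t ^ k • c k := by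
    ext t x; simp [dil_apply, hc]
  refine ⟨∑ k ∈ Finset.Icc 1 l, ‖c k‖ + 1, by positivity, fun t ht0 ht1 => ?_⟩
  rw [this]
  refine (norm_sum_le _ _).trans ?_
  rw [add_mul, Finset.sum_mul]
  refine le_add_of_le_of_nonneg (Finset.sum_le_sum fun k hk => ?_) (by simpa)
  rw [norm_smul, mul_comm, norm_pow, Real.norm_of_nonneg ht0]
  gcongr
  exact pow_le_of_le_one ht0 ht1 (by have := Finset.mem_Icc.mp hk; lia)

variable (G) in
theorem exists_norm_dil_inv_le : ∃ (C : ℝ) (s : ℕ), 0 < C ∧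
    ∀ t : ℝ, 1 ≤ t → ‖dil (G := G) t‖ ≤ C * t ^ s := by
  obtain ⟨l, c, hc, hl⟩ := exists_components G
  have : (dil : ℝ → G →L[ℝ] G) = fun t => ∑ k ∈ Finset.Icc 1 l, t ^ k • c k := by
    ext t x; simp [dil_apply, hc]
  refine ⟨∑ k ∈ Finset.Icc 1 l, ‖c k‖ + 1, l, by positivity, fun t ht => ?_⟩
  rw [this]
  refine (norm_sum_le _ _).trans ?_
  rw [add_mul, Finset.sum_mul]
  refine le_add_of_le_of_nonneg (Finset.sum_le_sum fun k hk => ?_) (by positivity)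
  rw [norm_smul, mul_comm, norm_pow, Real.norm_of_nonneg (by linarith)]
  gcongr
  exact (Finset.mem_Icc.mp hk).2

theorem tendsto_dil_zero (x : G) : Tendsto (fun t : ℝ => dil t x) (𝓝 0) (𝓝 0) := by
  have := (continuous_dilation x).tendsto 0
  rwa [dilation_zero] at this

/-! ### Homogeneous norms -/

namespace HomogeneousNorm

variable (ν : HomogeneousNorm G)

theorem dil_eq {t : ℝ} (ht : 0 < t) (x : G) : ν (dil t x) = t * ν x := ν.dilation' t ht x

theorem map_zero' : ν 0 = 0 := by rw [← one_eq_zero]; exact (ν.eq_zero_iff' 1).mpr rfl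

theorem pos {x : G} (hx : x ≠ 0) : 0 < ν x :=
  lt_of_le_of_ne (ν.nonneg' x) fun h => hx (by rw [(ν.eq_zero_iff' x).mp h.symm, one_eq_zero])

/-- Dilating the unit `ν`-ball into the unit norm ball. -/
theorem exists_norm_le_of_le_one : ∃ C : ℝ, 0 < C ∧ ∀ x : G, ν x ≤ 1 → ‖x‖ ≤ C := by
  have h := ν.comap_le_nhds (by rw [one_eq_zero]; exact Metric.ball_mem_nhds (0 : G) one_pos)
  obtain ⟨V, hV, hVs⟩ := mem_comap.mp h
  obtain ⟨ε, hε, hεV⟩ := Metric.mem_nhds_iff.mp hV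
  refine ⟨‖dil (G := G) (2 / ε)‖ + 1, by positivity, fun x hx => ?_⟩
  have hpos : (0 : ℝ) < ε / 2 := by positivity
  have h1 : ‖dil (ε / 2) x‖ < 1 := by
    have : dil (ε / 2) x ∈ Metric.ball (0 : G) 1 := hVs (hεV (by
      rw [Metric.mem_ball, dist_zero_right, Real.norm_of_nonneg (ν.nonneg' _), ν.dil_eq hpos]
      nlinarith))
    simpa using this
  have h2 : x = dil (2 / ε) (dil (ε / 2) x) := by
    rw [dil_dil, div_mul_div_cancel₀ (by positivity)]
    simp
  rw [h2]
  calc _ ≤ ‖dil (G := G) (2 / ε)‖ * ‖dil (ε / 2) x‖ := ContinuousLinearMap.le_opNorm _ _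
    _ ≤ ‖dil (G := G) (2 / ε)‖ * 1 := by gcongr
    _ ≤ _ := by linarith

theorem isCompact_le (R : ℝ) : IsCompact {x : G | ν x ≤ R} := by
  obtain ⟨C, hC, h⟩ := ν.exists_norm_le_of_le_one
  refine Metric.isCompact_of_isClosed_isBounded (isClosed_le ν.continuous' continuous_const) ?_
  set R' := max R 1
  have hR : 0 < R' := lt_of_lt_of_le one_pos (le_max_right _ _)
  refine (Metric.isBounded_iff_subset_closedBall 0).mpr ⟨‖dil (G := G) R'‖ * C, fun x hx => ?_⟩
  have h2 : x = dil R' (dil R'⁻¹ x) := (dil_dil_inv hR.ne' x).symm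
  rw [mem_closedBall_zero_iff, h2]
  refine (ContinuousLinearMap.le_opNorm _ _).trans ?_
  gcongr
  refine h _ ?_
  rw [ν.dil_eq (by positivity), inv_mul_le_iff₀ hR, mul_one]
  exact le_trans hx (le_max_left _ _)

theorem dist_eq (x y : G) : (@dist G ν.metricSpace.toDist x y) = ν (y⁻¹ * x) := rfl

theorem le_add_of_mul (x y z : G) : ν (x⁻¹ * z) ≤ ν (x⁻¹ * y) + ν (y⁻¹ * z) := by
  have := ν.mul_le' (x⁻¹ * y) (y⁻¹ * z)
  rwa [mul_assoc, mul_inv_cancel_left] at this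

theorem inv_mul_comm (x y : G) : ν (x⁻¹ * y) = ν (y⁻¹ * x) := by
  rw [← ν.inv', mul_inv_rev, inv_inv]

end HomogeneousNorm

/-! ### Graded isometries -/

section GradedIsometry

variable {ν : HomogeneousNorm G} {k : MulAut G}

/-- Small values of `ν` mean nearness to the identity, so preserving `ν` gives continuity at `1`. -/
theorem continuous_of_norm_preserving (h : ∀ p, ν (k p) = ν p) : Continuous k := by
  refine continuous_of_continuousAt_one k ?_
  rw [ContinuousAt, map_one]
  refine Tendsto.mono_right ?_ ν.comap_le_nhds
  rw [tendsto_comap_iff]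
  have : ν ∘ k = ν := funext h
  rw [this]
  have := ν.continuous'.tendsto 1
  rwa [(ν.eq_zero_iff' 1).mpr rfl] at this

/-- Integer multiples are powers; rational multiples follow by division, real ones by density. -/
theorem map_smul_of_continuous (hk : Continuous k) (s : ℝ) (x : G) : k (s • x) = s • k x := by
  have hint : ∀ (n : ℤ) (y : G), k ((n : ℝ) • y) = (n : ℝ) • k y := fun n y => by
    rw [← zpow_eq_smul, map_zpow, zpow_eq_smul]
  have hrat : ∀ q : ℚ, k ((q : ℝ) • x) = (q : ℝ) • k x := fun q => by
    have hd : ((q.den : ℤ) : ℝ) ≠ 0 := by simp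
    have h1 := hint q.den ((q : ℝ) • x)
    have h2 : ((q.den : ℤ) : ℝ) * q = (q.num : ℝ) := by
      have := Rat.den_mul_eq_num q
      exact_mod_cast this
    rw [smul_smul, h2, hint] at h1
    have h3 := congrArg (fun z => ((q.den : ℤ) : ℝ)⁻¹ • z) h1
    simp only [smul_smul, inv_mul_cancel₀ hd, one_smul] at h3
    rw [← h3, ← h2, ← mul_assoc, inv_mul_cancel₀ hd, one_mul]
  have : (fun s : ℝ => k (s • x)) = fun s : ℝ => s • k x := by
    refine Continuous.ext_on Rat.denseRange_cast (by fun_prop) (by fun_prop) ?_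
    rintro _ ⟨q, rfl⟩
    exact hrat q
  exact congrFun this s

/-- Trotter's formula expresses a sum through products, scalings and a limit, all respected by `k`.
-/
theorem map_add_of_continuous (hk : Continuous k) (x y : G) : k (x + y) = k x + k y := by
  refine tendsto_nhds_unique (((hk.tendsto _).comp (tendsto_smul_mul x y)).congr fun n => ?_)
    (tendsto_smul_mul (k x) (k y))
  simp only [Function.comp_apply]
  rw [map_smul_of_continuous hk, map_mul, map_smul_of_continuous hk, map_smul_of_continuous hk]

/-- A continuous automorphism, as a linear map. -/
noncomputable def autLin (k : MulAut G) (hk : Continuous k) : G →L[ℝ] G where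
  toFun := k
  map_add' := map_add_of_continuous hk
  map_smul' := map_smul_of_continuous hk
  cont := hk

/-- By linearity it is enough to look at one layer, where `dil t` is multiplication by a power of
`t`. -/
theorem map_dil_of_layer (hk : Continuous k)
    (hl : ∀ j, k '' (layer (G := G) j : Set G) = layer (G := G) j) (t : ℝ) (x : G) :
    k (dil t x) = dil t (k x) := by
  obtain ⟨s, c, hc, hcl⟩ := exists_components G
  have hx : x = ∑ j ∈ Finset.Icc 1 s, c j x := by
    have := hc 1 x
    rw [dilation_one] at this
    simpa using this
  change autLin k hk (dil t x) = dil t (autLin k hk x)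
  have h1 : autLin k hk x = ∑ j ∈ Finset.Icc 1 s, autLin k hk (c j x) := by
    rw [← map_sum, ← hx]
  rw [h1, dil_apply, hc, map_sum, map_sum]
  refine Finset.sum_congr rfl fun j _ => ?_
  rw [map_smul, dil_apply, dilation_apply_layer (k := j)]
  rw [← SetLike.mem_coe, ← hl j]
  exact mem_image_of_mem _ (hcl j x)

end GradedIsometry

end CarnotGroup

/-! ### Null Lagrangians: integrals of Jacobian determinants -/

section NullLagrangian

variable {E : Type*} [NormedAddCommGroup E] [NormedSpace ℝ E] [FiniteDimensional ℝ E]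

/-- On the segment from `t • id` to `t • id - A` all maps are injective because `‖A‖ < t`, so the
determinant keeps the sign of `t ^ n`. -/
theorem det_smul_id_sub_pos {A : E →L[ℝ] E} {t : ℝ} (ht : ‖A‖ < t) :
    0 < (t • ContinuousLinearMap.id ℝ E - A).det := by
  have ht0 : 0 < t := (norm_nonneg A).trans_lt ht
  set h : ℝ → ℝ := fun s => (t • ContinuousLinearMap.id ℝ E - s • A).det
  have hc : Continuous h := ContinuousLinearMap.continuous_det.comp (by fun_prop)
  have h0 : 0 < h 0 := by
    have : h 0 = t ^ Module.finrank ℝ E := by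
      simp [h, ContinuousLinearMap.det]
    rw [this]; positivity
  have hne : ∀ s ∈ Icc (0 : ℝ) 1, h s ≠ 0 := by
    intro s hs h1
    obtain ⟨v, hv, hv0⟩ := LinearMap.bot_lt_ker_of_det_eq_zero
      (f := ((t • ContinuousLinearMap.id ℝ E - s • A : E →L[ℝ] E) : E →ₗ[ℝ] E)) h1 |>.ne' |>
        Submodule.exists_mem_ne_zero_of_ne_bot
    have hv' : t • v = s • A v := by simpa [sub_eq_zero] using hv
    have h2 := congrArg norm hv'
    rw [norm_smul, norm_smul, Real.norm_of_nonneg ht0.le, Real.norm_of_nonneg hs.1] at h2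
    have h3 := A.le_opNorm v
    have h4 : 0 < ‖v‖ := norm_pos_iff.mpr hv0
    have h5 : s * ‖A v‖ ≤ ‖A‖ * ‖v‖ := by
      nlinarith [hs.1, hs.2, norm_nonneg (A v)]
    nlinarith
  have : 0 < h 1 := by
    by_contra hcon
    push Not at hcon
    obtain ⟨s, hs, hs0⟩ := intermediate_value_Icc' zero_le_one hc.continuousOn
      (show (0 : ℝ) ∈ Icc (h 1) (h 0) from ⟨hcon, h0.le⟩)
    exact hne s hs hs0
  simpa [h] using this

variable [MeasurableSpace E] [BorelSpace E] (μ : Measure E) [μ.IsAddHaarMeasure]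

/-- The map `x ↦ x - t⁻¹ • f x` perturbs the identity by a map with Lipschitz constant `K / t < 1`,
so it is bijective. It is the identity off `B`, hence maps `B` onto itself, and the change of
variables formula computes the integral. -/
theorem setIntegral_det_smul_id_sub_fderiv [Nontrivial E] {f : E → E} (hf : ContDiff ℝ 1 f) {K : ℝ≥0}
    (hK : LipschitzWith K f) {B : Set E} (hB : MeasurableSet B) (hfB : Function.support f ⊆ B) {t : ℝ}
    (ht : K < t) :
    ∫ x in B, (t • ContinuousLinearMap.id ℝ E - fderiv ℝ f x).det ∂μ =
      t ^ Module.finrank ℝ E * μ.real B := by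
  have ht0 : 0 < t := K.2.trans_lt ht
  set h : E → E := fun x => x - t⁻¹ • f x
  have hA : ApproximatesLinearOn h ((ContinuousLinearEquiv.refl ℝ E : E ≃L[ℝ] E) : E →L[ℝ] E) univ
      (Real.toNNReal t⁻¹ * K) := by
    rw [ApproximatesLinearOn.approximatesLinearOn_iff_lipschitzOnWith, lipschitzOnWith_univ]
    refine LipschitzWith.of_dist_le_mul fun x y => ?_
    have := hK.dist_le_mul x y
    simp only [h, Pi.sub_apply, dist_eq_norm, ContinuousLinearEquiv.coe_refl,
      ContinuousLinearMap.coe_id', id_eq, sub_sub_cancel_left] at this ⊢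
    rw [← neg_add', norm_neg, ← sub_eq_add_neg, ← smul_sub, norm_smul,
      Real.norm_of_nonneg (by positivity), NNReal.coe_mul, mul_assoc,
      Real.coe_toNNReal _ (by positivity)]
    gcongr
  have hbij : Function.Bijective h := by
    refine (hA.toHomeomorph h (Or.inr ?_)).bijective
    have : ‖(((ContinuousLinearEquiv.refl ℝ E : E ≃L[ℝ] E).symm : E ≃L[ℝ] E) : E →L[ℝ] E)‖₊ = 1 :=
      Subtype.ext ContinuousLinearMap.norm_id
    rw [this, inv_one, ← NNReal.coe_lt_coe]
    rw [NNReal.coe_mul, Real.coe_toNNReal _ (by positivity), inv_mul_lt_iff₀ ht0]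
    simpa using ht
  have himg : h '' B = B := by
    have hc : ∀ x, x ∉ B → h x = x := fun x hx => by
      have : f x = 0 := by
        by_contra h0; exact hx (hfB h0)
      simp [h, this]
    ext y
    constructor
    · rintro ⟨x, hx, rfl⟩
      by_contra hcon
      have := hbij.1 (hc _ hcon)
      rw [this] at hcon
      exact hcon hx
    · intro hy
      obtain ⟨x, rfl⟩ := hbij.2 y
      refine ⟨x, ?_, rfl⟩
      by_contra hcon
      rw [hc x hcon] at hy
      exact hcon hy
  have hd : ∀ x, HasFDerivAt h (ContinuousLinearMap.id ℝ E - t⁻¹ • fderiv ℝ f x) x := fun x =>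
    (hasFDerivAt_id x).sub ((hf.differentiable (by simp) x).hasFDerivAt.const_smul t⁻¹)
  have hJ := integral_image_eq_integral_abs_det_fderiv_smul μ hB
    (fun x _ => (hd x).hasFDerivWithinAt) hbij.1.injOn (fun _ => (1 : ℝ))
  rw [himg] at hJ
  simp only [integral_const, smul_eq_mul, mul_one, measureReal_restrict_apply_univ] at hJ
  rw [hJ, ← integral_const_mul]
  refine integral_congr_ae (Eventually.of_forall fun x => ?_)
  have hn : ‖fderiv ℝ f x‖ < t := (norm_fderiv_le_of_lipschitz ℝ hK).trans_lt ht
  have hpos := det_smul_id_sub_pos hn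
  have heq : (t • ContinuousLinearMap.id ℝ E - fderiv ℝ f x).det =
      t ^ Module.finrank ℝ E * (ContinuousLinearMap.id ℝ E - t⁻¹ • fderiv ℝ f x).det := by
    rw [ContinuousLinearMap.det, ContinuousLinearMap.det, ← LinearMap.det_smul]
    congr 1
    ext v
    simp [smul_sub, smul_smul, ht0.ne']
  beta_reduce
  rw [heq, abs_of_pos]
  rw [heq] at hpos
  exact pos_of_mul_pos_right hpos (by positivity)

/-- The integral of a Jacobian determinant of a compactly supported map vanishes. -/
theorem integral_det_fderiv_eq_zero [Nontrivial E] {f : E → E} (hf : ContDiff ℝ 1 f)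
    (hs : HasCompactSupport f) : ∫ x, (fderiv ℝ f x).det ∂μ = 0 := by
  classical
  obtain ⟨K, hK⟩ := hf.lipschitzWith_of_hasCompactSupport hs (by simp)
  set B := tsupport f
  have hB : IsCompact B := hs
  set n := Module.finrank ℝ E
  have hn : 0 < n := Module.finrank_pos
  -- For `t > K` the integral of `det (t • id - Df)` is `t ^ n * μ B`, and both sides are
  -- polynomials in `t` of degree at most `n`. Interpolation at the `n + 1` nodes `v i > K` carries
  -- the identity to `t = 0`, where the right side vanishes.
  set v : ℕ → ℝ := fun i => K + 1 + i
  set s := Finset.range (n + 1)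
  have hv : InjOn v s := fun i _ j _ h => by simpa [v] using h
  have hcont : Continuous (fderiv ℝ f) := hf.continuous_fderiv (by simp)
  have hexp : ∀ A : E →L[ℝ] E, (-A).det = ∑ i ∈ s, (v i • ContinuousLinearMap.id ℝ E - A).det *
      (Lagrange.basis s v i).eval 0 := fun A => by
    have h1 := Lagrange.eq_interpolate (f := (A : E →ₗ[ℝ] E).charpoly) hv (by
      rw [Polynomial.degree_eq_natDegree (LinearMap.charpoly_monic _).ne_zero,
        LinearMap.charpoly_natDegree]
      simp [s, n]
      norm_cast
      lia)
    have h2 := congrArg (Polynomial.eval 0) h1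
    rw [LinearMap.eval_charpoly, Lagrange.interpolate_apply, Polynomial.eval_finsetSum] at h2
    simp only [Polynomial.eval_mul, Polynomial.eval_C, LinearMap.eval_charpoly, map_zero,
      zero_sub] at h2
    exact h2
  have hpoly : ∑ i ∈ s, v i ^ n * (Lagrange.basis s v i).eval 0 = 0 := by
    have h1 := Lagrange.eq_interpolate (f := (Polynomial.X : Polynomial ℝ) ^ n) hv (by
      rw [Polynomial.degree_X_pow]
      simp [s]
      norm_cast
      lia)
    have h2 := congrArg (Polynomial.eval 0) h1
    rw [Lagrange.interpolate_apply, Polynomial.eval_finsetSum] at h2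
    simp only [Polynomial.eval_mul, Polynomial.eval_C, Polynomial.eval_pow, Polynomial.eval_X,
      zero_pow hn.ne'] at h2
    exact h2.symm
  have hsupp : ∀ x, x ∉ B → (fderiv ℝ f x).det = 0 := fun x hx => by
    have : fderiv ℝ f x = 0 := by
      by_contra h
      exact hx (support_fderiv_subset ℝ h)
    rw [this, ContinuousLinearMap.det]
    simp
  rw [← setIntegral_eq_integral_of_forall_compl_eq_zero (s := B) (fun x hx => hsupp x hx)]
  have hneg : ∀ x, (fderiv ℝ f x).det = (-1) ^ n * (-fderiv ℝ f x).det := fun x => by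
    rw [ContinuousLinearMap.det, ContinuousLinearMap.det]
    rw [← LinearMap.det_smul]
    congr 1
    ext; simp
  simp only [hneg, hexp]
  rw [integral_const_mul, integral_finsetSum]
  · have : ∀ i ∈ s, ∫ x in B, (v i • ContinuousLinearMap.id ℝ E - fderiv ℝ f x).det *
        (Lagrange.basis s v i).eval 0 ∂μ =
        v i ^ n * (Lagrange.basis s v i).eval 0 * μ.real B := fun i _ => by
      rw [integral_mul_const, setIntegral_det_smul_id_sub_fderiv μ hf hK hB.measurableSet
        (subset_tsupport f)]
      · ring
      · simp only [v]
        have : (0 : ℝ) ≤ i := Nat.cast_nonneg i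
        linarith
    rw [Finset.sum_congr rfl this, ← Finset.sum_mul, hpoly]
    simp
  · intro i _
    refine Integrable.mul_const ?_ _
    refine ContinuousOn.integrableOn_compact hB (Continuous.continuousOn ?_)
    exact ContinuousLinearMap.continuous_det.comp (continuous_const.sub hcont)

/-- It is enough that one coordinate has compact support. -/
theorem integral_det_fderiv_eq_zero_of_coord {f : E → E} (hf : ContDiff ℝ 1 f)
    (φ : E →L[ℝ] ℝ) (hφ : φ ≠ 0) (hs : HasCompactSupport fun x => φ (f x)) :
    ∫ x, (fderiv ℝ f x).det ∂μ = 0 := by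
  obtain ⟨e, he⟩ : ∃ e, φ e ≠ 0 := by
    by_contra! h
    exact hφ (ContinuousLinearMap.ext h)
  have : Nontrivial E := ⟨e, 0, fun h => he (by simp [h])⟩
  -- Cutting `f` off away from the support of `φ ∘ f` does not change that coordinate. Off this
  -- support both Jacobians vanish, because the derivatives take values in the kernel of `φ`.
  obtain ⟨K, hK, hKs⟩ := exists_compact_superset hs
  obtain ⟨θ, hθ1, hθ, -⟩ := exists_contMDiffMap_one_nhds_of_subset_interior 𝓘(ℝ, E) (n := ⊤)
    hs.isClosed hKs
  have hθc : ContDiff ℝ 1 θ := (contMDiff_iff_contDiff.mp θ.contMDiff).of_le (by exact_mod_cast le_top)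
  have hθs : HasCompactSupport θ := by
    refine HasCompactSupport.intro hK fun x hx => hθ x hx
  set F : E → E := fun x => θ x • f x
  have hF : ContDiff ℝ 1 F := hθc.smul hf
  rw [← integral_det_fderiv_eq_zero μ hF (hθs.smul_right)]
  refine integral_congr_ae (Eventually.of_forall fun x => ?_)
  have hdet0 : ∀ {h : E → E}, Differentiable ℝ h → fderiv ℝ (fun x => φ (h x)) x = 0 →
      (fderiv ℝ h x).det = 0 := by
    intro h hh h0
    by_contra hne
    have h1 : fderiv ℝ (fun x => φ (h x)) x = φ.comp (fderiv ℝ h x) :=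
      (φ.hasFDerivAt.comp x (hh x).hasFDerivAt).fderiv
    rw [h1] at h0
    have hsurj : Function.Surjective (fderiv ℝ h x) := by
      have := LinearMap.isUnit_iff_isUnit_det (fderiv ℝ h x : E →ₗ[ℝ] E) |>.mpr
        (isUnit_iff_ne_zero.mpr hne)
      exact ((Module.End.isUnit_iff _).mp this).2
    obtain ⟨w, hw⟩ := hsurj e
    have := congrArg (fun A => A w) h0
    simp [hw, he] at this
  have heq : (fun x => φ (F x)) = fun x => φ (f x) := by
    ext y
    by_cases hy : y ∈ tsupport fun x => φ (f x)
    · simp [F, hθ1.self_of_nhdsSet y hy]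
    · have : φ (f y) = 0 :=
        image_eq_zero_of_notMem_tsupport (f := fun x => φ (f x)) hy
      simp [F, this]
  by_cases hx : x ∈ tsupport fun x => φ (f x)
  · have h1 : ∀ᶠ y in 𝓝 x, θ y = 1 := hθ1.filter_mono (nhds_le_nhdsSet hx)
    have h2 : F =ᶠ[𝓝 x] f := by
      filter_upwards [h1] with y hy
      simp [F, hy]
    change _ = (fderiv ℝ F x).det
    rw [h2.fderiv_eq]
  · have h0 : fderiv ℝ (fun x => φ (f x)) x = 0 := by
      by_contra h
      exact hx (support_fderiv_subset ℝ h)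
    change (fderiv ℝ f x).det = (fderiv ℝ F x).det
    rw [hdet0 (hf.differentiable (by simp)) h0, hdet0 (hF.differentiable (by simp)) (heq ▸ h0)]

end NullLagrangian

/-! ### Linearity of the determinant in one row -/

section RowReplacement

variable {E : Type*} [NormedAddCommGroup E] [NormedSpace ℝ E]

/-- Replace the `φ`-coordinate of `A` (with respect to the direction `e`) by `α`. -/
noncomputable def rowReplace (φ : E →L[ℝ] ℝ) (e : E) (A : E →L[ℝ] E) (α : E →L[ℝ] ℝ) : E →L[ℝ] E :=
  A + (α - φ.comp A).smulRight e

theorem rowReplace_self (φ : E →L[ℝ] ℝ) (e : E) (A : E →L[ℝ] E) :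
    rowReplace φ e A (φ.comp A) = A := by
  ext; simp [rowReplace]

variable [FiniteDimensional ℝ E]

/-- In a basis made of `e` and a basis of the kernel of `φ`, the first coordinate is `φ`; replacing
the `φ`-coordinate is then replacing the first row. -/
theorem exists_matrix_rowReplace {φ : E →L[ℝ] ℝ} {e : E} (he : φ e = 1) (A : E →L[ℝ] E) :
    ∃ (n : ℕ) (b : Fin (n + 1) → E) (X : Matrix (Fin (n + 1)) (Fin (n + 1)) ℝ),
      ∀ α : E →L[ℝ] ℝ, (rowReplace φ e A α).det = (X.updateRow 0 fun j => α (b j)).det := by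
  classical
  set N := LinearMap.ker (φ : E →ₗ[ℝ] ℝ)
  let b0 := Module.finBasis ℝ N
  let b := Module.Basis.mkFinCons e b0
    (fun c x hx h => by
      have h1 := congrArg φ h
      have hx' : φ x = 0 := hx
      simpa [he, hx'] using h1)
    (fun z => ⟨-φ z, by simp [N, he]⟩)
  have hcoord : ∀ x, b.repr x 0 = φ x := by
    intro x
    have h1 : (b.coord 0) = (φ : E →ₗ[ℝ] ℝ) := by
      refine b.ext fun i => ?_
      rw [Module.Basis.coord_apply, Module.Basis.repr_self]
      refine Fin.cases ?_ (fun j => ?_) i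
      · simp [b, he]
      · simp [b]
    exact congrArg (fun f => f x) h1
  have hcoord' : ∀ i : Fin _, b.repr e (Fin.succ i) = 0 := by
    intro i
    have : b 0 = e := by simp [b]
    rw [← this]; simp
  refine ⟨_, b, LinearMap.toMatrix b b (A : E →ₗ[ℝ] E), fun α => ?_⟩
  rw [ContinuousLinearMap.det, ← LinearMap.det_toMatrix b]
  congr 1
  ext i j
  refine Fin.cases ?_ (fun i => ?_) i
  · rw [Matrix.updateRow_self, LinearMap.toMatrix_apply, hcoord]
    simp [rowReplace, he]
  · rw [Matrix.updateRow_ne (Fin.succ_ne_zero i), LinearMap.toMatrix_apply, LinearMap.toMatrix_apply]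
    simp [rowReplace, hcoord']

theorem det_rowReplace_add {φ : E →L[ℝ] ℝ} {e : E} (he : φ e = 1) (A : E →L[ℝ] E)
    (α β : E →L[ℝ] ℝ) : (rowReplace φ e A (α + β)).det =
      (rowReplace φ e A α).det + (rowReplace φ e A β).det := by
  obtain ⟨n, b, X, h⟩ := exists_matrix_rowReplace he A
  simp only [h]
  rw [← Matrix.det_updateRow_add]
  rfl

theorem det_rowReplace_smul {φ : E →L[ℝ] ℝ} {e : E} (he : φ e = 1) (A : E →L[ℝ] E) (c : ℝ)
    (α : E →L[ℝ] ℝ) : (rowReplace φ e A (c • α)).det = c * (rowReplace φ e A α).det := by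
  obtain ⟨n, b, X, h⟩ := exists_matrix_rowReplace he A
  simp only [h]
  rw [← Matrix.det_updateRow_smul]
  rfl

end RowReplacement

namespace CarnotGroup

variable {G : Type*} [NormedAddCommGroup G] [NormedSpace ℝ G] [FiniteDimensional ℝ G] [Group G]
  [CarnotGroup G]

/-! ### Homogeneous subgroups are linear subspaces -/

theorem contDiff_mul_subspaces (A B : Submodule ℝ G) :
    ContDiff ℝ ∞ (fun p : A × B => (p.1 : G) * (p.2 : G)) :=
  ContDiff.carnotMul (A.subtypeL.contDiff.comp contDiff_fst) (B.subtypeL.contDiff.comp contDiff_snd)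

theorem hasStrictFDerivAt_mul_subspaces (A B : Submodule ℝ G) :
    HasStrictFDerivAt (fun p : A × B => (p.1 : G) * (p.2 : G)) (A.subtypeL.coprod B.subtypeL) 0 := by
  have h1 : HasStrictFDerivAt (fun p : A × B => ((p.1 : G), (p.2 : G)))
      (A.subtypeL.prodMap B.subtypeL) 0 := (A.subtypeL.prodMap B.subtypeL).hasStrictFDerivAt
  have h2 : HasStrictFDerivAt (fun p : G × G => p.1 * p.2)
      (ContinuousLinearMap.fst ℝ G G + ContinuousLinearMap.snd ℝ G G)
      ((fun p : A × B => ((p.1 : G), (p.2 : G))) 0) := hasStrictFDerivAt_mul_zero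
  have h3 := h2.comp (0 : A × B) h1
  have h4 : (ContinuousLinearMap.fst ℝ G G + ContinuousLinearMap.snd ℝ G G).comp
      (A.subtypeL.prodMap B.subtypeL) = A.subtypeL.coprod B.subtypeL :=
    ContinuousLinearMap.ext fun p => by simp
  rw [h4] at h3
  exact h3

namespace IsHomogeneousSubgroup

variable {M : Subgroup G} (hM : IsHomogeneousSubgroup M)

include hM

/-- The approximants in Trotter's formula are powers of elements of `M`, and `M` is closed. -/
theorem smul_add_mem {x y : G} (hx : ∀ t : ℝ, t • x ∈ M) (hy : ∀ t : ℝ, t • y ∈ M) (t : ℝ) :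
    t • (x + y) ∈ M := by
  rw [smul_add]
  refine hM.1.mem_of_tendsto (tendsto_smul_mul (t • x) (t • y)) (Eventually.of_forall fun n => ?_)
  rw [← pow_eq_smul]
  refine M.pow_mem (M.mul_mem ?_ ?_) n
  · rw [smul_smul]; exact hx _
  · rw [smul_smul]; exact hy _

theorem dil_mem {t : ℝ} (ht : 0 < t) {x : G} (hx : x ∈ M) : dil t x ∈ M := hM.2 t ht x hx

/-- The vectors whose whole line lies in `M` form the Lie algebra `𝔪`. Near the identity a closed
subgroup is no larger than `𝔪`, and the dilations bring every element of `M` near the identity. -/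
theorem smul_mem {x : G} (hx : x ∈ M) (t : ℝ) : t • x ∈ M := by
  let 𝔪 : Submodule ℝ G :=
    { carrier := {x | ∀ t : ℝ, t • x ∈ M}
      add_mem' := fun hx hy t => hM.smul_add_mem hx hy t
      zero_mem' := fun t => by rw [smul_zero, ← one_eq_zero]; exact M.one_mem
      smul_mem' := fun c x hx t => by rw [smul_smul]; exact hx _ }
  have h𝔪 : ∀ y ∈ 𝔪, y ∈ M := fun y hy => by simpa using hy 1
  suffices h : x ∈ 𝔪 from h t
  by_contra hx𝔪
  obtain ⟨W, hW⟩ := Submodule.exists_isCompl 𝔪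
  have hmap := HasStrictFDerivAt.map_nhds_eq_of_surj (hasStrictFDerivAt_mul_subspaces 𝔪 W) (by
    rw [LinearMap.range_eq_top]
    intro z
    obtain ⟨a, ha, b, hb, hab⟩ := Submodule.mem_sup.mp (hW.sup_eq_top ▸ Submodule.mem_top : z ∈ 𝔪 ⊔ W)
    exact ⟨(⟨a, ha⟩, ⟨b, hb⟩), by simpa using hab⟩)
  have h00 : ((0 : 𝔪 × W).1 : G) * ((0 : 𝔪 × W).2 : G) = 0 := mul_zero_coord 0
  rw [h00] at hmap
  -- Small dilates of `x`, factored along `𝔪` and the complement `W`, have a `W`-factor in `M`. It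
  -- is nonzero, since otherwise a dilate of `x`, and then `x` itself, would belong to `𝔪`.
  have key : ∀ n : ℕ, ∃ b : W, (b : G) ∈ M ∧ b ≠ 0 ∧ ‖b‖ < 1 / ((n : ℝ) + 1) := by
    intro n
    have h1 : (fun p : 𝔪 × W => (p.1 : G) * (p.2 : G)) '' Metric.ball 0 (1 / ((n : ℝ) + 1)) ∈
        𝓝 (0 : G) := by
      rw [← hmap]
      exact image_mem_map (Metric.ball_mem_nhds _ (by positivity))
    have h2 : Tendsto (fun t : ℝ => dil t x) (𝓝[>] 0) (𝓝 0) :=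
      (tendsto_dil_zero x).mono_left nhdsWithin_le_nhds
    obtain ⟨s, hs, hs0⟩ := ((h2.eventually h1).and self_mem_nhdsWithin).exists
    have hs0 : 0 < s := hs0
    obtain ⟨⟨a, b⟩, hab, habs⟩ := hs
    simp only at habs
    have hb : (b : G) = (a : G)⁻¹ * dil s x := by rw [← habs, inv_mul_cancel_left]
    refine ⟨b, ?_, ?_, ?_⟩
    · rw [hb]
      exact M.mul_mem (M.inv_mem (h𝔪 _ a.2)) (hM.dil_mem hs0 hx)
    · rintro rfl
      rw [Submodule.coe_zero, mul_zero_coord] at habs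
      refine hx𝔪 fun t => ?_
      have h3 := a.2 t
      rw [habs, ← map_smul] at h3
      have h4 := hM.dil_mem (inv_pos.mpr hs0) h3
      rwa [dil_inv_dil hs0.ne'] at h4
    · rw [mem_ball_zero_iff] at hab
      exact (norm_snd_le (a, b)).trans_lt hab
  choose b hbM hb0 hbn using key
  have hu : ∀ n, ‖b n‖⁻¹ • b n ∈ Metric.sphere (0 : W) 1 := fun n => by
    rw [mem_sphere_zero_iff_norm, norm_smul, norm_inv, norm_norm,
      inv_mul_cancel₀ (norm_ne_zero_iff.mpr (hb0 n))]
  obtain ⟨u, hu1, φ, hφ, hφu⟩ := (isCompact_sphere (0 : W) 1).tendsto_subseq hu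
  have hb_lim : Tendsto (fun n => ‖b (φ n)‖) atTop (𝓝 0) := by
    refine squeeze_zero (fun n => norm_nonneg _) (fun n => (hbn _).le) ?_
    exact tendsto_one_div_add_atTop_nhds_zero_nat.comp hφ.tendsto_atTop
  -- The multiples of `b (φ n)` by the integers `⌊t / ‖b (φ n)‖⌋` lie in `M` and converge to `t •
  -- u`. Thus the unit vector `u` lies in `𝔪 ⊓ W`, which is trivial.
  have hu𝔪 : (u : G) ∈ 𝔪 := by
    intro t
    have hlim : Tendsto (fun n => ((⌊t / ‖b (φ n)‖⌋ : ℤ) : ℝ) • (b (φ n) : G)) atTop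
        (𝓝 (t • (u : G))) := by
      have h1 : Tendsto (fun n => ((⌊t / ‖b (φ n)‖⌋ : ℤ) : ℝ) * ‖b (φ n)‖) atTop (𝓝 t) := by
        have h2 : Tendsto (fun n => t - ‖b (φ n)‖) atTop (𝓝 t) := by
          simpa using tendsto_const_nhds.sub hb_lim
        refine tendsto_of_tendsto_of_tendsto_of_le_of_le h2 tendsto_const_nhds (fun n => ?_)
          (fun n => ?_)
        · have hp := norm_pos_iff.mpr (hb0 (φ n))
          have := Int.lt_floor_add_one (t / ‖b (φ n)‖)
          rw [div_lt_iff₀ hp] at this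
          simp only
          linarith
        · have hp := norm_pos_iff.mpr (hb0 (φ n))
          exact (le_div_iff₀ hp).mp (Int.floor_le _)
      have h2 := h1.smul ((continuous_subtype_val.tendsto u).comp hφu)
      refine h2.congr fun n => ?_
      simp only [Function.comp_apply, Submodule.coe_smul, smul_smul]
      rw [mul_assoc, mul_inv_cancel₀ (norm_ne_zero_iff.mpr (hb0 (φ n))), mul_one]
    refine hM.1.mem_of_tendsto hlim (Eventually.of_forall fun n => ?_)
    rw [← zpow_eq_smul]
    exact M.zpow_mem (hbM _) _
  have hu0 : (u : G) = 0 := Submodule.disjoint_def.mp hW.disjoint u hu𝔪 u.2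
  rw [mem_sphere_zero_iff_norm, Submodule.coe_norm, hu0, norm_zero] at hu1
  exact zero_ne_one hu1

omit hM in
/-- A homogeneous subgroup, as a linear subspace. -/
def toSubmodule (hM : IsHomogeneousSubgroup M) : Submodule ℝ G where
  carrier := M
  add_mem' {x y} hx hy := by simpa using hM.smul_add_mem (hM.smul_mem hx) (hM.smul_mem hy) 1
  zero_mem' := by rw [← one_eq_zero]; exact M.one_mem
  smul_mem' c x hx := hM.smul_mem hx c

end IsHomogeneousSubgroup

/-! ### The projection of a decomposition -/

namespace Decomposition

variable (D : Decomposition G)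

/-- The subgroup `M` of a decomposition, as a linear subspace. -/
abbrev subM : Submodule ℝ G := D.homogeneous_M.toSubmodule

/-- The subgroup `H` of a decomposition, as a linear subspace. -/
abbrev subH : Submodule ℝ G := D.homogeneous_H.toSubmodule

theorem projM_mem (x : G) : D.projM x ∈ D.subM := (Subgroup.IsComplement.equiv D.complement x).1.2

theorem projH_mem (x : G) : D.projH x ∈ D.subH := (Subgroup.IsComplement.equiv D.complement x).2.2

theorem projM_mul_projH (x : G) : D.projM x * D.projH x = x :=
  Subgroup.IsComplement.equiv_fst_mul_equiv_snd D.complement x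

theorem proj_mul {m h : G} (hm : m ∈ D.subM) (hh : h ∈ D.subH) :
    D.projM (m * h) = m ∧ D.projH (m * h) = h := by
  have h1 : Subgroup.IsComplement.equiv D.complement (m * h) = (⟨m, hm⟩, ⟨h, hh⟩) := by
    rw [← Equiv.eq_symm_apply, Subgroup.IsComplement.equiv_symm_apply]
  simp only [projM, projH, h1, and_self]

/-- If the dimensions added up to less than `dim G`, the range of the smooth product map `M × H → G`
would have a dense complement, but that map is onto. -/
theorem isCompl : IsCompl D.subM D.subH := by
  have hdis : Disjoint D.subM D.subH := by
    rw [Submodule.disjoint_def]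
    intro x hx hy
    have h1 := (D.proj_mul hx D.subH.zero_mem).1
    have h2 := (D.proj_mul D.subM.zero_mem hy).1
    rw [mul_zero_coord] at h1
    rw [zero_mul_coord] at h2
    rw [← h1, h2]
  refine ⟨hdis, ?_⟩
  rw [codisjoint_iff]
  apply Submodule.eq_top_of_finrank_eq
  refine le_antisymm (Submodule.finrank_le _) ?_
  have h1 := Submodule.finrank_sup_add_finrank_inf_eq D.subM D.subH
  rw [hdis.eq_bot, finrank_bot, add_zero] at h1
  rw [h1]
  by_contra! hlt
  have h2 := ContDiff.dense_compl_range_of_finrank_lt_finrank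
    ((contDiff_mul_subspaces D.subM D.subH).of_le (by exact_mod_cast le_top))
    (by rwa [Module.finrank_prod])
  have h3 : range (fun p : D.subM × D.subH => (p.1 : G) * (p.2 : G)) = univ := by
    refine eq_univ_of_forall fun x => ⟨(⟨_, D.projM_mem x⟩, ⟨_, D.projH_mem x⟩), ?_⟩
    exact D.projM_mul_projH x
  rw [h3, compl_univ] at h2
  simpa using h2.nonempty

theorem projM_dil {t : ℝ} (ht : 0 < t) (x : G) : D.projM (dil t x) = dil t (D.projM x) := by
  conv_lhs => rw [← D.projM_mul_projH x, dil_mul ht]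
  exact (D.proj_mul (D.homogeneous_M.dil_mem ht (D.projM_mem x))
    (D.homogeneous_H.dil_mem ht (D.projH_mem x))).1

/-- Near `0` the inverse function theorem applies to the product map `M × H → G`; the projection
commutes with dilations, which spread the smoothness to all of `G`. -/
theorem contDiff_projM : ContDiff ℝ ∞ D.projM := by
  have hf := contDiff_mul_subspaces D.subM D.subH
  let e : (D.subM × D.subH) ≃L[ℝ] G :=
    (Submodule.prodEquivOfIsCompl _ _ D.isCompl).toContinuousLinearEquiv
  have hd : HasFDerivAt (fun p : D.subM × D.subH => (p.1 : G) * (p.2 : G))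
      (e : (D.subM × D.subH) →L[ℝ] G) 0 := by
    have := (hasStrictFDerivAt_mul_subspaces D.subM D.subH).hasFDerivAt
    convert this using 1
    exact ContinuousLinearMap.ext fun p => rfl
  have h00 : ((0 : D.subM × D.subH).1 : G) * ((0 : D.subM × D.subH).2 : G) = 0 := mul_zero_coord 0
  have hinv := hf.contDiffAt.to_localInverse hd (by simp)
  have hright := (hf.contDiffAt.hasStrictFDerivAt' hd (by simp)).eventually_right_inverse
  rw [h00] at hinv hright
  have hat : ContDiffAt ℝ ∞ D.projM 0 := by
    have h2 := (D.subM.subtypeL.contDiff (n := ∞)).contDiffAt.comp (0 : G)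
      (contDiff_fst.contDiffAt.comp (0 : G) hinv)
    refine h2.congr_of_eventuallyEq ?_
    filter_upwards [hright] with y hy
    conv_lhs => rw [← hy]
    exact (D.proj_mul (Subtype.coe_prop _) (Subtype.coe_prop _)).1
  rw [contDiff_infty]
  intro n
  have hev := ((contDiffAt_infty.mp hat n).eventually (by simp))
  rw [contDiff_iff_contDiffAt]
  intro x
  have h2 : Tendsto (fun t : ℝ => dil t x) (𝓝[>] 0) (𝓝 0) :=
    (tendsto_dil_zero x).mono_left nhdsWithin_le_nhds
  obtain ⟨s, hs, hs0⟩ := ((h2.eventually hev).and self_mem_nhdsWithin).exists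
  have hs0 : 0 < s := hs0
  have h3 : D.projM = fun y => dil s⁻¹ (D.projM (dil s y)) := by
    ext y
    rw [D.projM_dil hs0, dil_inv_dil hs0.ne']
  rw [h3]
  exact (dil s⁻¹).contDiff.contDiffAt.comp x (hs.comp x (dil s).contDiff.contDiffAt)

/-- The projection onto `M`, with values in the linear subspace `M`. -/
noncomputable def pr (x : G) : D.subM := ⟨D.projM x, D.projM_mem x⟩

theorem coe_pr (x : G) : (D.pr x : G) = D.projM x := rfl

/-- A linear projection onto `M`. -/
noncomputable def linM : G →L[ℝ] D.subM :=
  LinearMap.toContinuousLinearMap (Submodule.projectionOnto _ _ D.isCompl)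

theorem linM_coe (m : D.subM) : D.linM m = m := Submodule.projectionOnto_apply_left D.isCompl m

theorem contDiff_pr : ContDiff ℝ ∞ D.pr := by
  have : D.pr = fun x => D.linM (D.projM x) := by
    ext x; rw [← D.coe_pr, linM_coe]
  rw [this]
  exact D.linM.contDiff.comp D.contDiff_projM

theorem pr_mul (m : D.subM) {h : G} (hh : h ∈ D.subH) : D.pr (m * h) = m :=
  Subtype.ext (D.proj_mul m.2 hh).1

theorem pr_coe (m : D.subM) : D.pr m = m := by
  have := D.pr_mul m D.subH.zero_mem
  rwa [mul_zero_coord] at this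

theorem pr_zero : D.pr 0 = 0 := by
  have := D.pr_coe 0
  simpa using this

/-- The `H`-factor of `x` stands on the right and is invisible to the projection of `g * x`. This
makes `m ↦ P_M (g m)` an action: `M` is a model of the quotient `G / H`. -/
theorem pr_mul_pr (g x : G) : D.pr (g * D.pr x) = D.pr (g * x) := by
  conv_rhs => rw [← D.projM_mul_projH x, ← mul_assoc, ← D.projM_mul_projH (g * D.projM x), mul_assoc]
  refine Eq.symm ((D.pr_mul (D.pr (g * D.projM x)) ?_).trans rfl)
  exact D.H.mul_mem (D.projH_mem _) (D.projH_mem _)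

/-- The dilations of `M`. -/
noncomputable def dilM (t : ℝ) : D.subM →L[ℝ] D.subM := D.linM.comp ((dil t).comp D.subM.subtypeL)

theorem coe_dilM {t : ℝ} (ht : 0 < t) (m : D.subM) : (D.dilM t m : G) = dil t (m : G) := by
  have h := D.linM_coe ⟨dil t (m : G), D.homogeneous_M.dil_mem ht m.2⟩
  exact congrArg Subtype.val h

theorem pr_dil {t : ℝ} (ht : 0 < t) (x : G) : D.pr (dil t x) = D.dilM t (D.pr x) :=
  Subtype.ext (by rw [coe_dilM _ ht, coe_pr, coe_pr, D.projM_dil ht])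

theorem dilM_dilM {s t : ℝ} (hs : 0 < s) (ht : 0 < t) (m : D.subM) :
    D.dilM s (D.dilM t m) = D.dilM (s * t) m :=
  Subtype.ext (by rw [coe_dilM _ hs, coe_dilM _ ht, coe_dilM _ (mul_pos hs ht), dil_dil])

theorem dilM_one : D.dilM 1 = ContinuousLinearMap.id ℝ _ := by
  ext m; rw [coe_dilM _ one_pos, dil_one]; rfl

theorem dilM_inv_dilM {t : ℝ} (ht : 0 < t) (m : D.subM) : D.dilM t⁻¹ (D.dilM t m) = m := by
  rw [dilM_dilM _ (by positivity) ht, inv_mul_cancel₀ ht.ne', dilM_one]; rfl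

theorem dilM_dilM_inv {t : ℝ} (ht : 0 < t) (m : D.subM) : D.dilM t (D.dilM t⁻¹ m) = m := by
  rw [dilM_dilM _ ht (by positivity), mul_inv_cancel₀ ht.ne', dilM_one]; rfl

theorem continuous_dilM : Continuous D.dilM :=
  continuous_const.clm_comp (continuous_dil.clm_comp continuous_const)

theorem det_dilM_mul {s t : ℝ} (hs : 0 < s) (ht : 0 < t) :
    (D.dilM (s * t)).det = (D.dilM s).det * (D.dilM t).det := by
  have : D.dilM (s * t) = (D.dilM s).comp (D.dilM t) := by
    ext m; rw [ContinuousLinearMap.comp_apply, dilM_dilM _ hs ht]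
  rw [this]
  exact LinearMap.det_comp _ _

theorem det_dilM_pos {t : ℝ} (ht : 0 < t) : 0 < (D.dilM t).det := by
  have h := D.det_dilM_mul (Real.sqrt_pos.mpr ht) (Real.sqrt_pos.mpr ht)
  rw [Real.mul_self_sqrt ht.le] at h
  have h1 := D.det_dilM_mul ht (inv_pos.mpr ht)
  rw [mul_inv_cancel₀ ht.ne', dilM_one] at h1
  have h2 : (D.dilM t).det ≠ 0 := by
    intro h0
    rw [h0, zero_mul] at h1
    simp [ContinuousLinearMap.det] at h1
  exact lt_of_le_of_ne (h ▸ mul_self_nonneg _) h2.symm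

/-- The homogeneous dimension of `M`. -/
theorem exists_det_dilM : ∃ a : ℝ, ∀ t : ℝ, 0 < t → (D.dilM t).det = t ^ a := by
  -- The logarithm of the determinant of `dilM (exp u)` is additive and continuous in `u`, hence
  -- linear.
  let F : ℝ →+ ℝ :=
    { toFun := fun u => Real.log (D.dilM (Real.exp u)).det
      map_zero' := by simp [dilM_one, ContinuousLinearMap.det]
      map_add' := fun u v => by
        rw [Real.exp_add, det_dilM_mul _ (Real.exp_pos _) (Real.exp_pos _),
          Real.log_mul (D.det_dilM_pos (Real.exp_pos _)).ne' (D.det_dilM_pos (Real.exp_pos _)).ne'] }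
  have hF : Continuous F :=
    (ContinuousLinearMap.continuous_det.comp (D.continuous_dilM.comp Real.continuous_exp)).log
      fun u => (D.det_dilM_pos (Real.exp_pos _)).ne'
  refine ⟨F 1, fun t ht => ?_⟩
  have h := map_real_smul F hF (Real.log t) 1
  rw [smul_eq_mul, mul_one, smul_eq_mul] at h
  have h2 : F (Real.log t) = Real.log (D.dilM t).det := by
    change Real.log (D.dilM (Real.exp (Real.log t))).det = _
    rw [Real.exp_log ht]
  rw [Real.rpow_def_of_pos ht, ← h, h2, Real.exp_log (D.det_dilM_pos ht)]

/-! ### The induced action of the group on `M` -/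

/-- The action `m ↦ P_M (g m)` of `G` on `M`. -/
noncomputable def act (g : G) (m : D.subM) : D.subM := D.pr (g * m)

theorem act_mul (g h : G) (m : D.subM) : D.act (g * h) m = D.act g (D.act h m) := by
  rw [act, act, act, pr_mul_pr, mul_assoc]

theorem act_one (m : D.subM) : D.act 1 m = m := by rw [act, one_mul, pr_coe]

theorem act_pr (g x : G) : D.act g (D.pr x) = D.pr (g * x) := D.pr_mul_pr g x

theorem act_dilM (g : G) {t : ℝ} (ht : 0 < t) (m : D.subM) :
    D.act (dil t g) (D.dilM t m) = D.dilM t (D.act g m) := by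
  rw [act, act, coe_dilM _ ht, ← dil_mul ht, pr_dil _ ht]

theorem contDiff_act_uncurry : ContDiff ℝ ∞ (fun q : G × D.subM => D.act q.1 q.2) :=
  D.contDiff_pr.comp (ContDiff.carnotMul contDiff_fst (D.subM.subtypeL.contDiff.comp contDiff_snd))

theorem contDiff_act (g : G) : ContDiff ℝ ∞ (D.act g) :=
  D.contDiff_act_uncurry.comp (contDiff_prodMk_right g)

theorem fderiv_act (g : G) (m : D.subM) : fderiv ℝ (D.act g) m =
    (fderiv ℝ (fun q : G × D.subM => D.act q.1 q.2) (g, m)).comp (ContinuousLinearMap.inr ℝ G _) := by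
  have h1 := ((D.contDiff_act_uncurry.differentiable (by simp)) (g, m)).hasFDerivAt
  have h2 := h1.comp m (hasFDerivAt_prodMk_right g m)
  exact h2.fderiv

/-- The action commutes with simultaneous dilation of `g` and `m`, so the Jacobian at `(dil t g,
dilM t m)` does not depend on `t`. As `t → 0` it tends to its value at the origin, where the action
is the identity. -/
theorem det_fderiv_act (g : G) (m : D.subM) : (fderiv ℝ (D.act g) m).det = 1 := by
  set J : G × D.subM → ℝ := fun q => (fderiv ℝ (D.act q.1) q.2).det
  have hJ : Continuous J := by
    simp only [J, fderiv_act]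
    exact ContinuousLinearMap.continuous_det.comp
      ((D.contDiff_act_uncurry.continuous_fderiv (by simp)).clm_comp continuous_const)
  have hinv : ∀ t : ℝ, 0 < t → J (dil t g, D.dilM t m) = J (g, m) := by
    intro t ht
    have h1 : D.act (dil t g) ∘ D.dilM t = D.dilM t ∘ D.act g :=
      funext fun x => D.act_dilM g ht x
    have hdiff : ∀ g x, DifferentiableAt ℝ (D.act g) x := fun g x =>
      (D.contDiff_act g).differentiable (by simp) x
    have h2 := congrArg (fun f => (fderiv ℝ f m).det) h1
    rw [fderiv_comp _ (hdiff _ _) (D.dilM t).differentiableAt,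
      fderiv_comp _ (D.dilM t).differentiableAt (hdiff _ _), ContinuousLinearMap.fderiv,
      ContinuousLinearMap.fderiv] at h2
    have h3 : ∀ A B : D.subM →L[ℝ] D.subM, (A.comp B).det = A.det * B.det := fun A B =>
      LinearMap.det_comp _ _
    rw [h3, h3, mul_comm] at h2
    exact mul_left_cancel₀ (D.det_dilM_pos ht).ne' h2
  have h0 : J (0, 0) = 1 := by
    have : D.act 0 = id := funext fun m => by rw [← one_eq_zero, act_one]; rfl
    simp [J, this, ContinuousLinearMap.det]
  have hlim : Tendsto (fun t : ℝ => (dil t g, D.dilM t m)) (𝓝[>] 0) (𝓝 (0, 0)) := by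
    refine (Tendsto.prodMk_nhds (tendsto_dil_zero g) ?_).mono_left nhdsWithin_le_nhds
    have := (D.linM.continuous.tendsto 0).comp (tendsto_dil_zero (m : G))
    rwa [map_zero] at this
  have h2 := (hJ.tendsto (0, 0)).comp hlim
  rw [h0] at h2
  refine tendsto_nhds_unique (tendsto_const_nhds.congr' ?_) h2
  filter_upwards [self_mem_nhdsWithin] with t ht
  exact (hinv t ht).symm

theorem injective_act (g : G) : Function.Injective (D.act g) := by
  intro m m' h
  have := congrArg (D.act g⁻¹) h
  rwa [← act_mul, ← act_mul, inv_mul_cancel, act_one, act_one] at this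

end Decomposition

end CarnotGroup

/-! ### Separated sets and comparison with spherical measures -/

theorem exists_maximal_separated {X : Type*} (r : X → X → Prop) (hr : ∀ x y, r x y → r y x)
    (A : Set X) (N : ℕ) (hN : ∀ S : Finset X, (S : Set X) ⊆ A → (S : Set X).Pairwise r → S.card ≤ N) :
    ∃ S : Finset X, (S : Set X) ⊆ A ∧ (S : Set X).Pairwise r ∧
      ∀ a ∈ A, a ∈ S ∨ ∃ s ∈ S, ¬ r a s := by
  classical
  let p : ℕ → Prop := fun n => ∃ S : Finset X, (S : Set X) ⊆ A ∧ (S : Set X).Pairwise r ∧ S.card = n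
  have h0 : p 0 := ⟨∅, by simp, by simp, rfl⟩
  obtain ⟨S, hSA, hSr, hS⟩ := Nat.findGreatest_spec (P := p) (Nat.zero_le N) h0
  refine ⟨S, hSA, hSr, fun a ha => ?_⟩
  by_contra! hcon
  obtain ⟨haS, har⟩ := hcon
  have hpair : ((insert a S : Finset X) : Set X).Pairwise r := by
    rw [Finset.coe_insert]
    exact hSr.insert fun b hb _ => ⟨har b hb, hr _ _ (har b hb)⟩
  have hsub : ((insert a S : Finset X) : Set X) ⊆ A := by
    rw [Finset.coe_insert]; exact insert_subset ha hSA
  have h1 := hN _ hsub hpair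
  have h2 := Nat.le_findGreatest (P := p) h1 ⟨_, hsub, hpair, rfl⟩
  rw [← hS, Finset.card_insert_of_notMem haS] at h2
  lia

/-- Comparison on small balls suffices for Carathéodory's construction. By `hd` the diameter
controls the radius, so balls of diameter at most `r₀` fall under `hF`. -/
theorem le_sphericalMeasure {X : Type*} [MetricSpace X] [MeasurableSpace X] [BorelSpace X] {s : ℝ}
    (F : OuterMeasure X) {C : ℝ≥0} (hC : C ≠ 0) {r₀ : ℝ} (hr₀ : 0 < r₀) (hs : 0 ≤ s)
    (hd : ∀ (x : X) (r : ℝ), 0 < r → ENNReal.ofReal r ≤ Metric.ediam (Metric.closedBall x r))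
    (hF : ∀ (x : X) (r : ℝ), 0 < r → r ≤ r₀ → F (Metric.closedBall x r) ≤ C * ENNReal.ofReal r ^ s)
    (E : Set X) : F E ≤ C * sphericalMeasure X s E := by
  set w : Set X → ℝ≥0∞ := fun E =>
    ⨅ (x : X) (r : ℝ) (_ : 0 < r) (_ : E = Metric.closedBall x r), Metric.ediam E ^ s
  have hC0 : (C : ℝ≥0∞) ≠ 0 := by simpa using hC
  have h1 : (C : ℝ≥0∞)⁻¹ • F ≤ OuterMeasure.mkMetric'.pre w (ENNReal.ofReal r₀) := by
    rw [OuterMeasure.mkMetric'.le_pre]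
    intro E hE
    refine le_iInf fun x => le_iInf fun r => le_iInf fun hr => le_iInf fun hEr => ?_
    have hrr : r ≤ r₀ := by
      have := (hd x r hr).trans (hEr ▸ hE)
      exact (ENNReal.ofReal_le_ofReal_iff hr₀.le).mp this
    rw [smul_apply, hEr, smul_eq_mul, ← ENNReal.div_eq_inv_mul,
      ENNReal.div_le_iff_le_mul (Or.inl hC0) (Or.inl ENNReal.coe_ne_top), mul_comm]
    exact (hF x r hr hrr).trans (mul_le_mul_right (ENNReal.rpow_le_rpow (hd x r hr) hs) _)
  have h2 : OuterMeasure.mkMetric'.pre w (ENNReal.ofReal r₀) E ≤ sphericalMeasure X s E :=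
    (le_iSup₂ (f := fun (r : ℝ≥0∞) (_ : r > 0) => OuterMeasure.mkMetric'.pre w r)
      (ENNReal.ofReal r₀) (ENNReal.ofReal_pos.mpr hr₀) E).trans
        (le_toMeasure_apply _ (OuterMeasure.mkMetric'_isMetric _).le_caratheodory _)
  have h3 := (h1 E).trans h2
  rw [smul_apply, smul_eq_mul, ← ENNReal.div_eq_inv_mul,
    ENNReal.div_le_iff_le_mul (Or.inl hC0) (Or.inl ENNReal.coe_ne_top), mul_comm] at h3
  exact h3

/-- A maximal `ε`-separated set is an `ε`-net, so a packing bound yields coverings by sets of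
diameter at most `2 ε` with bounded total weight. -/
theorem dimH_le_of_separated {X : Type*} [MetricSpace X] {a : ℝ≥0} {A : Set X} {C : ℝ}
    (h : ∀ ε : ℝ, 0 < ε → ε ≤ 1 → ∀ S : Finset X, (S : Set X) ⊆ A →
      (S : Set X).Pairwise (fun x y => ε < dist x y) → (S.card : ℝ) * ε ^ (a : ℝ) ≤ C) :
    dimH A ≤ a := by
  borelize X
  refine dimH_le_of_hausdorffMeasure_ne_top ?_
  set ε : ℕ → ℝ := fun n => 1 / ((n : ℝ) + 1)
  have hε : ∀ n, 0 < ε n := fun n => by positivity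
  have hε1 : ∀ n, ε n ≤ 1 := fun n => by
    rw [div_le_one (by positivity)]; linarith [Nat.cast_nonneg (α := ℝ) n]
  have hnet : ∀ n, ∃ S : Finset X, (S : Set X) ⊆ A ∧
      (S : Set X).Pairwise (fun x y => ε n < dist x y) ∧
      ∀ x ∈ A, x ∈ S ∨ ∃ s ∈ S, ¬ ε n < dist x s := fun n => by
    refine exists_maximal_separated _ (fun x y hxy => by rwa [dist_comm]) A
      ⌈C / (ε n) ^ (a : ℝ)⌉₊ fun S hS hSp => ?_
    have := h (ε n) (hε n) (hε1 n) S hS hSp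
    have hp : 0 < ε n ^ (a : ℝ) := Real.rpow_pos_of_pos (hε n) _
    exact_mod_cast ((le_div_iff₀ hp).mpr this).trans (Nat.le_ceil _)
  choose S hSA hSp hSc using hnet
  have hlim : Tendsto (fun n => 2 * ENNReal.ofReal (ε n)) atTop (𝓝 0) := by
    have := ENNReal.Tendsto.const_mul (a := 2) (ENNReal.tendsto_ofReal
      tendsto_one_div_add_atTop_nhds_zero_nat) (Or.inr (by simp))
    rwa [ENNReal.ofReal_zero, mul_zero] at this
  have hdiam : ∀ n (i : S n), Metric.ediam (Metric.closedBall (i : X) (ε n)) ≤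
      2 * ENNReal.ofReal (ε n) := fun n i => by
    rw [← Metric.closedEBall_ofReal (hε n).le]
    exact Metric.ediam_closedEBall_le
  have hle := Measure.hausdorffMeasure_le_liminf_sum (X := X) (a : ℝ) A (l := atTop) _ hlim
    (ι := fun n => S n) (fun n i => Metric.closedBall (i : X) (ε n))
    (Eventually.of_forall hdiam) (Eventually.of_forall fun n x hx => by
      rw [mem_iUnion]
      rcases hSc n x hx with hxS | ⟨s, hs, hsd⟩
      · exact ⟨⟨x, hxS⟩, Metric.mem_closedBall_self (hε n).le⟩
      · exact ⟨⟨s, hs⟩, not_lt.mp hsd⟩)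
  refine (hle.trans_lt ?_).ne
  have hbound : ∀ n, ∑ i : S n, Metric.ediam (Metric.closedBall (i : X) (ε n)) ^ (a : ℝ) ≤
      2 ^ (a : ℝ) * ENNReal.ofReal C := fun n => by
    calc _ ≤ ∑ i : S n, (2 * ENNReal.ofReal (ε n)) ^ (a : ℝ) :=
          Finset.sum_le_sum fun i _ => ENNReal.rpow_le_rpow (hdiam n i) a.2
      _ = (S n).card * (2 ^ (a : ℝ) * ENNReal.ofReal (ε n ^ (a : ℝ))) := by
          rw [Finset.sum_const, Finset.card_univ, Fintype.card_coe, nsmul_eq_mul,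
            ENNReal.mul_rpow_of_nonneg _ _ a.coe_nonneg, ENNReal.ofReal_rpow_of_pos (hε n)]
      _ = 2 ^ (a : ℝ) * ENNReal.ofReal ((S n).card * ε n ^ (a : ℝ)) := by
          rw [ENNReal.ofReal_mul (Nat.cast_nonneg _), ENNReal.ofReal_natCast]; ring
      _ ≤ _ := mul_le_mul_right (ENNReal.ofReal_le_ofReal
          (h (ε n) (hε n) (hε1 n) (S n) (hSA n) (hSp n))) _
  refine ((liminf_le_liminf (Eventually.of_forall hbound)).trans
    (liminf_const (f := (atTop : Filter ℕ)) (2 ^ (a : ℝ) * ENNReal.ofReal C)).le).trans_lt ?_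
  exact ENNReal.mul_lt_top (ENNReal.rpow_lt_top_of_nonneg a.2 (by simp)) ENNReal.ofReal_lt_top

namespace CarnotGroup

variable {G : Type*} [NormedAddCommGroup G] [NormedSpace ℝ G] [FiniteDimensional ℝ G] [Group G]
  [CarnotGroup G]

namespace Decomposition

variable (D : Decomposition G)

/-! ### An additive homogeneous functional on `M` -/

/-- Let `w` be the lowest weight with a nonzero component on `M`, and `ξ` a functional of that
component; it is homogeneous of degree `w`. The product is a sum to first order at the origin. So
the deviation of `ξ` from additivity, homogeneous of degree `w`, is `o(t ^ w)` along dilations,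
hence zero. -/
theorem exists_additive_functional (hD : D.subM ≠ ⊥) : ∃ (ξ : D.subM →L[ℝ] ℝ) (X : D.subM),
    ξ X = 1 ∧ ∀ m m' : D.subM, ξ (D.act (m : G) m') = ξ m + ξ m' := by
  classical
  obtain ⟨s, c, hc, -⟩ := exists_components G
  have hex : ∃ k, k ∈ Finset.Icc 1 s ∧ ∃ m : D.subM, c k m ≠ 0 := by
    obtain ⟨m, hm, hm0⟩ := Submodule.exists_mem_ne_zero_of_ne_bot hD
    by_contra! hcon
    have := hc 1 m
    rw [dilation_one, Finset.sum_eq_zero (fun k hk => by rw [hcon k hk ⟨m, hm⟩, smul_zero])] at this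
    exact hm0 this
  set w := Nat.find hex
  obtain ⟨hw, m₀, hm₀⟩ := Nat.find_spec hex
  have hlow : ∀ k < w, k ∈ Finset.Icc 1 s → ∀ m : D.subM, c k m = 0 := fun k hk hks m => by
    by_contra h
    exact Nat.find_min hex hk ⟨hks, m, h⟩
  obtain ⟨φ, hφ⟩ := SeparatingDual.exists_eq_one (R := ℝ) hm₀
  let ξ : D.subM →L[ℝ] ℝ := φ.comp ((c w).comp D.subM.subtypeL)
  -- The components of weight below `w` vanish on `M`, so dividing the dilate by `t ^ w` isolates
  -- the component of weight `w`.
  have hlim : ∀ m : D.subM, Tendsto (fun t : ℝ => (t ^ w)⁻¹ • dil t (m : G)) (𝓝[>] 0)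
      (𝓝 (c w m)) := by
    intro m
    have h1 : Tendsto (fun t : ℝ => ∑ k ∈ Finset.Icc 1 s, if k < w then (0 : G) else
        t ^ (k - w) • c k m) (𝓝[>] 0)
        (𝓝 (∑ k ∈ Finset.Icc 1 s, if k < w then (0 : G) else (0 : ℝ) ^ (k - w) • c k m)) := by
      refine tendsto_finsetSum _ fun k _ => ?_
      split_ifs
      · exact tendsto_const_nhds
      · exact (((continuous_id.pow _).tendsto 0).smul_const _).mono_left nhdsWithin_le_nhds
    have h2 : (∑ k ∈ Finset.Icc 1 s, if k < w then (0 : G) else (0 : ℝ) ^ (k - w) • c k m) =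
        c w m := by
      rw [← if_pos (c := w ∈ Finset.Icc 1 s) (t := c w (m : G)) (e := 0) hw]
      rw [← Finset.sum_ite_eq' (Finset.Icc 1 s) w (fun k => c k (m : G))]
      refine Finset.sum_congr rfl fun k _ => ?_
      rcases lt_trichotomy k w with h | h | h
      · simp [h, h.ne]
      · simp [h]
      · simp [h.ne', not_lt.mpr h.le, zero_pow (Nat.sub_pos_of_lt h).ne']
    rw [h2] at h1
    refine h1.congr' ?_
    filter_upwards [self_mem_nhdsWithin] with t ht
    have ht : 0 < t := ht
    rw [dil_apply, hc, Finset.smul_sum]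
    refine Finset.sum_congr rfl fun k hks => ?_
    split_ifs with hk
    · rw [hlow k hk hks, smul_zero, smul_zero]
    · rw [smul_smul]
      congr 1
      rw [pow_sub₀ _ ht.ne' (not_lt.mp hk), mul_comm]
  refine ⟨ξ, m₀, hφ, fun m m' => ?_⟩
  have hξdil : ∀ (t : ℝ), 0 < t → ∀ m : D.subM, ξ (D.dilM t m) = t ^ w * ξ m := by
    intro t ht m
    have h1 : Tendsto (fun u : ℝ => (u ^ w)⁻¹ • dil u (D.dilM t m : G)) (𝓝[>] 0)
        (𝓝 (t ^ w • c w m)) := by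
      have h2 : Tendsto (fun u : ℝ => u * t) (𝓝[>] 0) (𝓝[>] 0) := by
        refine tendsto_nhdsWithin_iff.mpr ⟨?_, ?_⟩
        · have : Tendsto (fun u : ℝ => u * t) (𝓝 0) (𝓝 (0 * t)) := tendsto_id.mul_const t
          rw [zero_mul] at this
          exact this.mono_left nhdsWithin_le_nhds
        · filter_upwards [self_mem_nhdsWithin] with u hu
          exact mul_pos hu ht
      refine (((hlim m).comp h2).const_smul (t ^ w)).congr fun u => ?_
      rw [Function.comp_apply, coe_dilM _ ht, dil_dil, smul_smul, mul_pow, mul_inv, mul_comm,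
        mul_assoc, inv_mul_cancel₀ (pow_pos ht w).ne', mul_one]
    have h3 := tendsto_nhds_unique (hlim (D.dilM t m)) h1
    change φ (c w (D.dilM t m)) = t ^ w * φ (c w m)
    rw [h3, map_smul, smul_eq_mul]
  have hder : HasFDerivAt (fun q : D.subM × D.subM => ξ (D.act (q.1 : G) q.2))
      (ξ.coprod ξ) (0, 0) := by
    have h1 : HasFDerivAt (fun q : D.subM × D.subM => (q.1 : G) * (q.2 : G))
        (D.subM.subtypeL.coprod D.subM.subtypeL) (0, 0) :=
      (hasStrictFDerivAt_mul_subspaces D.subM D.subM).hasFDerivAt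
    have h2 := (ξ.comp D.linM).hasFDerivAt.comp ((0, 0) : D.subM × D.subM) h1
    have h3 : (ξ.comp D.linM).comp (D.subM.subtypeL.coprod D.subM.subtypeL) = ξ.coprod ξ := by
      refine ContinuousLinearMap.ext fun q => ?_
      simp [linM_coe]
    rw [h3] at h2
    refine h2.congr_of_eventuallyEq (Eventually.of_forall fun q => ?_)
    have h4 : D.act (q.1 : G) q.2 = D.linM ((q.1 : G) * (q.2 : G)) := by
      have h5 := D.linM_coe ⟨(q.1 : G) * (q.2 : G), D.M.mul_mem q.1.2 q.2.2⟩
      have h6 := D.pr_coe ⟨(q.1 : G) * (q.2 : G), D.M.mul_mem q.1.2 q.2.2⟩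
      rw [act]
      exact h6.trans h5.symm
    simp only [Function.comp_apply, h4, ContinuousLinearMap.comp_apply]
  have hcurve : Tendsto (fun t : ℝ => ((D.dilM t m, D.dilM t m') : D.subM × D.subM)) (𝓝[>] 0)
      (𝓝 (0, 0)) := by
    have h0 : ∀ m : D.subM, Tendsto (fun t : ℝ => D.dilM t m) (𝓝[>] 0) (𝓝 0) := fun m => by
      have := (D.linM.continuous.tendsto 0).comp (tendsto_dil_zero (m : G))
      rw [map_zero] at this
      exact this.mono_left nhdsWithin_le_nhds
    exact (h0 m).prodMk_nhds (h0 m')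
  have hlimM : ∀ m : D.subM, Tendsto (fun t : ℝ => (t ^ w)⁻¹ • D.dilM t m) (𝓝[>] 0)
      (𝓝 (D.linM (c w m))) := fun m => by
    refine ((D.linM.continuous.tendsto _).comp (hlim m)).congr fun t => ?_
    simp [dilM]
  have ho := hder.isLittleO.comp_tendsto hcurve
  have hO : (fun t : ℝ => ((D.dilM t m, D.dilM t m') : D.subM × D.subM) - (0, 0)) =O[𝓝[>] 0]
      fun t : ℝ => t ^ w := by
    have h1 := ((hlimM m).prodMk_nhds (hlimM m')).isBigO_one ℝ
    have h2 := (Asymptotics.isBigO_refl (fun t : ℝ => t ^ w) (𝓝[>] 0)).smul h1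
    refine h2.congr' ?_ ?_
    · filter_upwards [self_mem_nhdsWithin] with t ht
      have ht : 0 < t := ht
      have : (t ^ w) ≠ 0 := (pow_pos ht w).ne'
      simp [smul_smul, this]
    · exact Eventually.of_forall fun t => by simp
  have ho2 := ho.trans_isBigO hO
  have hconst : (fun t : ℝ => t ^ w * (ξ (D.act (m : G) m') - (ξ m + ξ m'))) =o[𝓝[>] 0]
      fun t : ℝ => t ^ w := by
    refine ho2.congr' ?_ EventuallyEq.rfl
    filter_upwards [self_mem_nhdsWithin] with t ht
    have ht : 0 < t := ht
    simp only [Function.comp_apply, coe_dilM _ ht m, D.act_dilM _ ht, hξdil t ht]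
    rw [ContinuousLinearMap.map_sub]
    simp only [ContinuousLinearMap.coprod_apply, hξdil t ht]
    simp [act, pr_zero, mul_zero_coord]
    ring
  have h4 : (fun t : ℝ => ξ (D.act (m : G) m') - (ξ m + ξ m')) =o[𝓝[>] 0] fun _ : ℝ => (1 : ℝ) := by
    rw [Asymptotics.isLittleO_iff] at hconst ⊢
    intro ε hε
    filter_upwards [hconst hε, self_mem_nhdsWithin] with t h ht
    have ht : 0 < t := ht
    rw [norm_mul, mul_comm ε, mul_comm, mul_comm ‖t ^ w‖] at h
    rw [norm_one, mul_one]
    exact le_of_mul_le_mul_right h (norm_pos_iff.mpr (pow_pos ht w).ne')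
  rw [Asymptotics.isLittleO_const_iff one_ne_zero] at h4
  have h5 := tendsto_nhds_unique h4 tendsto_const_nhds
  linarith

end Decomposition

end CarnotGroup

/-! ### Volumes of projected balls and the metric dimension of M -/

theorem ofReal_le_ediam_closedBall_of_dist_eq {X : Type*} [PseudoMetricSpace X] {x y : X} {r : ℝ}
    (hr : 0 ≤ r) (h : dist y x = r) : ENNReal.ofReal r ≤ Metric.ediam (Metric.closedBall x r) := by
  rw [← h, ← edist_dist, h]
  exact Metric.edist_le_ediam_of_mem (Metric.mem_closedBall.mpr h.le)
    (Metric.mem_closedBall_self hr)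

namespace CarnotGroup

variable {G : Type*} [NormedAddCommGroup G] [NormedSpace ℝ G] [FiniteDimensional ℝ G] [Group G]
  [CarnotGroup G]

namespace HomogeneousNorm

variable (ν : HomogeneousNorm G)

theorem exists_eq [Nontrivial G] {r : ℝ} (hr : 0 < r) : ∃ x, ν x = r := by
  obtain ⟨x, hx⟩ := exists_ne (0 : G)
  have hp := ν.pos hx
  exact ⟨dil (r / ν x) x, by rw [ν.dil_eq (by positivity)]; field_simp⟩

theorem ofReal_le_ediam_closedBall [Nontrivial G] (x : G) (r : ℝ) (hr : 0 < r) :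
    ENNReal.ofReal r ≤ @Metric.ediam G ν.metricSpace.toPseudoMetricSpace.toPseudoEMetricSpace
      (@Metric.closedBall G ν.metricSpace.toPseudoMetricSpace x r) := by
  obtain ⟨z, hz⟩ := ν.exists_eq hr
  exact @ofReal_le_ediam_closedBall_of_dist_eq G ν.metricSpace.toPseudoMetricSpace x (x * z) r hr.le
    (by rw [ν.dist_eq, inv_mul_cancel_left, hz])

theorem closedBall_eq (x : G) (r : ℝ) :
    @Metric.closedBall G ν.metricSpace.toPseudoMetricSpace x r = {y | ν (x⁻¹ * y) ≤ r} := rfl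

end HomogeneousNorm

namespace Decomposition

variable (D : Decomposition G) (ν : HomogeneousNorm G)

theorem continuous_pr : Continuous D.pr := D.contDiff_pr.continuous

theorem continuous_act (g : G) : Continuous (D.act g) := (D.contDiff_act g).continuous

theorem coe_act_coe (m m' : D.subM) : (D.act (m : G) m' : G) = (m : G) * (m' : G) := by
  have := D.pr_coe ⟨(m : G) * (m' : G), D.M.mul_mem m.2 m'.2⟩
  exact congrArg Subtype.val this

/-- A ball is a translate of a dilated unit ball, and the projection intertwines translations with
the action on `M`. As the action preserves Haar measure, the measure of the projection is
proportional to `r ^ a`. -/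
theorem pr_image_closedBall (x : G) {r : ℝ} (hr : 0 < r) :
    D.pr '' {y | ν (x⁻¹ * y) ≤ r} = D.act x '' (D.dilM r '' (D.pr '' {y | ν y ≤ 1})) := by
  have h1 : {y | ν (x⁻¹ * y) ≤ r} = (fun y => x * dil r y) '' {y | ν y ≤ 1} := by
    ext y
    constructor
    · intro hy
      refine ⟨dil r⁻¹ (x⁻¹ * y), ?_, ?_⟩
      · rw [mem_ofPred_eq, ν.dil_eq (by positivity), inv_mul_le_iff₀ hr, mul_one]
        exact hy
      · simp only [dil_dil_inv hr.ne', mul_inv_cancel_left]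
    · rintro ⟨z, hz, rfl⟩
      have hz : ν z ≤ 1 := hz
      rw [mem_ofPred_eq, inv_mul_cancel_left, ν.dil_eq hr]
      nlinarith
  rw [h1, image_image, image_image, image_image]
  refine image_congr fun y _ => ?_
  rw [← pr_dil _ hr, act_pr]

theorem isCompact_ballM (r : ℝ) : IsCompact {m : D.subM | ν m ≤ r} := by
  have : {m : D.subM | ν m ≤ r} = Subtype.val ⁻¹' {x : G | ν x ≤ r} := rfl
  rw [this]
  refine (Topology.IsClosedEmbedding.subtypeVal ?_).isCompact_preimage (ν.isCompact_le r)
  exact D.homogeneous_M.1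

theorem ballM_eq_image {r : ℝ} (hr : 0 < r) :
    {m : D.subM | ν m ≤ r} = D.dilM r '' {m : D.subM | ν m ≤ 1} := by
  ext m
  constructor
  · intro hm
    refine ⟨D.dilM r⁻¹ m, ?_, D.dilM_dilM_inv hr m⟩
    rw [mem_ofPred_eq, coe_dilM _ (by positivity), ν.dil_eq (by positivity), inv_mul_le_iff₀ hr,
      mul_one]
    exact hm
  · rintro ⟨z, hz, rfl⟩
    have hz : ν z ≤ 1 := hz
    rw [mem_ofPred_eq, coe_dilM _ hr, ν.dil_eq hr]
    nlinarith

variable [MeasurableSpace G] [BorelSpace G] (μ : Measure D.subM) [μ.IsAddHaarMeasure]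

theorem measure_act_image (g : G) {A : Set D.subM} (hA : MeasurableSet A) :
    μ (D.act g '' A) = μ A := by
  have := lintegral_abs_det_fderiv_eq_addHaar_image μ hA
    (fun x _ => ((D.contDiff_act g).differentiable (by simp) x).hasFDerivAt.hasFDerivWithinAt)
    (D.injective_act g).injOn
  rw [← this]
  simp [det_fderiv_act]

theorem measure_dilM_image {a : ℝ} (ha : ∀ t : ℝ, 0 < t → (D.dilM t).det = t ^ a) {t : ℝ}
    (ht : 0 < t) (A : Set D.subM) : μ (D.dilM t '' A) = ENNReal.ofReal (t ^ a) * μ A := by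
  have h := ha t ht
  rw [ContinuousLinearMap.det] at h
  rw [Measure.addHaar_image_continuousLinearMap, h, abs_of_pos (Real.rpow_pos_of_pos ht _)]

theorem measure_pr_image_closedBall {a : ℝ} (ha : ∀ t : ℝ, 0 < t → (D.dilM t).det = t ^ a) (x : G)
    {r : ℝ} (hr : 0 < r) : μ (D.pr '' {y | ν (x⁻¹ * y) ≤ r}) =
      ENNReal.ofReal (r ^ a) * μ (D.pr '' {y | ν y ≤ 1}) := by
  rw [pr_image_closedBall D ν x hr, measure_act_image, measure_dilM_image D μ ha hr]
  exact (((ν.isCompact_le 1).image D.continuous_pr).image (D.dilM r).continuous).measurableSet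

theorem measure_ballM {a : ℝ} (ha : ∀ t : ℝ, 0 < t → (D.dilM t).det = t ^ a) {r : ℝ} (hr : 0 < r) :
    μ {m : D.subM | ν m ≤ r} = ENNReal.ofReal (r ^ a) * μ {m : D.subM | ν m ≤ 1} := by
  rw [ballM_eq_image D ν hr, measure_dilM_image D μ ha hr]

omit [BorelSpace G] in
theorem measure_ballM_one_pos : 0 < μ {m : D.subM | ν m ≤ 1} := by
  have ho : IsOpen {m : D.subM | ν m < 1} :=
    isOpen_lt (ν.continuous'.comp continuous_subtype_val) continuous_const
  refine lt_of_lt_of_le (ho.measure_pos μ ⟨0, ?_⟩) (measure_mono fun m (hm : ν m < 1) => show ν m ≤ 1 from hm.le)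
  simp [ν.map_zero']

theorem rpow_exponent_nonneg (ν : HomogeneousNorm G) {a : ℝ} (ha : ∀ t : ℝ, 0 < t → (D.dilM t).det = t ^ a) : 0 ≤ a := by
  let μ : Measure D.subM := Measure.addHaar
  have h1 := D.measure_ballM ν μ ha (r := 2) two_pos
  have h2 : μ {m : D.subM | ν m ≤ 1} ≤ μ {m : D.subM | ν m ≤ 2} :=
    measure_mono fun m (hm : ν m ≤ 1) => show ν m ≤ 2 by linarith
  rw [h1] at h2
  have h3 := D.measure_ballM_one_pos ν μ
  have h4 := (D.isCompact_ballM ν 1).measure_lt_top (μ := μ)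
  by_contra! hcon
  have h5 : ENNReal.ofReal ((2 : ℝ) ^ a) < 1 := by
    rw [ENNReal.ofReal_lt_one]
    exact Real.rpow_lt_one_of_one_lt_of_neg one_lt_two hcon
  have h6 := ENNReal.mul_lt_mul_left h3.ne' h4.ne h5
  rw [one_mul] at h6
  exact absurd h2 (not_le.mpr h6)

/-- Volume packing: the translates of the `ε / 2`-ball of `M` by `ε`-separated points are disjoint,
and their measures are proportional to `ε ^ a`. The opposite inequality is not needed. -/
theorem metricDim_le {a : ℝ} (ha : ∀ t : ℝ, 0 < t → (D.dilM t).det = t ^ a) :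
    ν.metricDim (D.M : Set G) ≤ ENNReal.ofReal a := by
  have ha0 := D.rpow_exponent_nonneg ν ha
  let μ : Measure D.subM := Measure.addHaar
  let _ := ν.metricSpace
  have hU : (D.M : Set G) = ⋃ n : ℕ, {x | x ∈ D.M ∧ ν x ≤ n} := by
    ext x
    simp only [mem_iUnion, mem_ofPred_eq, exists_and_left, SetLike.mem_coe]
    exact ⟨fun h => ⟨h, exists_nat_ge _⟩, fun h => h.1⟩
  change dimH (D.M : Set G) ≤ _
  rw [hU, dimH_iUnion]
  refine iSup_le fun n => ?_
  rw [ENNReal.ofReal]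
  set c := (μ {m : D.subM | ν m ≤ 1}).toReal
  have hfin : ∀ r, μ {m : D.subM | ν m ≤ r} ≠ ⊤ := fun r =>
    ((D.isCompact_ballM ν r).measure_lt_top (μ := μ)).ne
  have hc : 0 < c := ENNReal.toReal_pos (D.measure_ballM_one_pos ν μ).ne' (hfin 1)
  refine dimH_le_of_separated (C := (μ {m : D.subM | ν m ≤ n + 1}).toReal / c * 2 ^ a)
    fun ε hε hε1 S hS hSp => ?_
  rw [Real.coe_toNNReal _ ha0]
  have hmeas : MeasurableSet {m : D.subM | ν m ≤ ε / 2} := (D.isCompact_ballM ν _).measurableSet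
  have hdisj : ((S : Set G).PairwiseDisjoint fun x => D.act x '' {m : D.subM | ν m ≤ ε / 2}) := by
    intro x hx y hy hxy
    rw [Function.onFun, disjoint_left]
    rintro _ ⟨b, hb, rfl⟩ ⟨b', hb', heq⟩
    have h1 := D.coe_act_coe ⟨x, (hS hx).1⟩ b
    have h2 := D.coe_act_coe ⟨y, (hS hy).1⟩ b'
    simp only at h1 h2
    rw [heq, h1] at h2
    have h3 : y⁻¹ * x = b' * (b : G)⁻¹ := by
      rw [inv_mul_eq_iff_eq_mul, ← mul_assoc, ← h2, mul_inv_cancel_right]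
    have h4 : ε < ν (y⁻¹ * x) := hSp hx hy hxy
    rw [h3] at h4
    have h5 := ν.mul_le' (b' : G) (b : G)⁻¹
    rw [ν.inv'] at h5
    have hb : ν b ≤ ε / 2 := hb
    have hb' : ν b' ≤ ε / 2 := hb'
    linarith
  have hsub : ⋃ x ∈ S, D.act x '' {m : D.subM | ν m ≤ ε / 2} ⊆ {m : D.subM | ν m ≤ n + 1} := by
    intro m hm
    rw [mem_iUnion₂] at hm
    obtain ⟨x, hx, b, hb, rfl⟩ := hm
    have h1 := D.coe_act_coe ⟨x, (hS hx).1⟩ b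
    simp only at h1
    rw [mem_ofPred_eq, h1]
    have hb : ν b ≤ ε / 2 := hb
    have := (hS hx).2
    linarith [ν.mul_le' x b]
  have h1 := measure_mono (μ := μ) hsub
  rw [measure_biUnion_finset hdisj (fun x _ => ((D.isCompact_ballM ν _).image
    (D.continuous_act x)).measurableSet)] at h1
  simp only [D.measure_act_image μ _ hmeas, D.measure_ballM ν μ ha (half_pos hε),
    Finset.sum_const, nsmul_eq_mul] at h1
  have h2 := ENNReal.toReal_mono (hfin _) h1
  rw [ENNReal.toReal_mul, ENNReal.toReal_mul, ENNReal.toReal_ofReal (by positivity),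
    ENNReal.toReal_natCast, Real.div_rpow hε.le two_pos.le] at h2
  have h2a : (0 : ℝ) < 2 ^ a := by positivity
  have h3 : (S.card : ℝ) * ε ^ a = (S.card * (ε ^ a / 2 ^ a * c)) / c * 2 ^ a := by
    field_simp
  rw [h3]
  gcongr

/-- The spherical measure controls the measure of projections to `M`. -/
theorem exists_measure_pr_image_le [Nontrivial G] {dm : ℝ≥0} (hdm : ν.metricDim (D.M : Set G) = dm)
    {k : MulAut G} (hk : ∀ p, ν (k p) = ν p) : ∃ C : ℝ≥0, ∀ E : Set G,
      μ ((fun x => D.pr (k⁻¹ x)) '' E) ≤ C * ν.sphericalMeasure dm E := by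
  obtain ⟨a, ha⟩ := D.exists_det_dilM
  have ha0 := D.rpow_exponent_nonneg ν ha
  -- Since `dm ≤ a`, the measure `c * r ^ a` of a projected `r`-ball is at most `c * r ^ dm` for `r
  -- ≤ 1`.
  have hda : (dm : ℝ) ≤ a := by
    have := D.metricDim_le ν ha
    rw [hdm, ENNReal.ofReal, ENNReal.coe_le_coe] at this
    have h2 := NNReal.coe_le_coe.mpr this
    rwa [Real.coe_toNNReal _ ha0] at h2
  set c := μ (D.pr '' {y | ν y ≤ 1})
  have hc : c ≠ ⊤ := (((ν.isCompact_le 1).image D.continuous_pr).measure_lt_top (μ := μ)).ne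
  have hkinv : ∀ p, ν (k⁻¹ p) = ν p := fun p => by
    rw [← hk (k⁻¹ p), MulAut.apply_inv_self]
  -- The summand `1` makes the constant nonzero, as the comparison lemma requires.
  refine ⟨c.toNNReal + 1, fun E => ?_⟩
  refine @le_sphericalMeasure G ν.metricSpace _ _ dm
    (OuterMeasure.comap (fun x => D.pr (k⁻¹ x)) μ.toOuterMeasure) (c.toNNReal + 1) (by simp) 1
    one_pos dm.2 ν.ofReal_le_ediam_closedBall (fun x r hr hr1 => ?_) E
  rw [OuterMeasure.comap_apply, ν.closedBall_eq]
  have himg : (fun x => D.pr (k⁻¹ x)) '' {y | ν (x⁻¹ * y) ≤ r} =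
      D.pr '' {y | ν ((k⁻¹ x)⁻¹ * y) ≤ r} := by
    ext m
    constructor
    · rintro ⟨y, hy, rfl⟩
      refine ⟨k⁻¹ y, ?_, rfl⟩
      rw [mem_ofPred_eq, ← map_inv, ← map_mul, hkinv]
      exact hy
    · rintro ⟨y, hy, rfl⟩
      refine ⟨k y, ?_, by simp⟩
      rw [mem_ofPred_eq, ← hkinv, map_mul, map_inv, MulAut.inv_apply_self]
      exact hy
  rw [himg]
  change μ _ ≤ _
  rw [D.measure_pr_image_closedBall ν μ ha _ hr, mul_comm]
  have h1 : c ≤ ((c.toNNReal + 1 : ℝ≥0) : ℝ≥0∞) := by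
    rw [ENNReal.coe_add, ENNReal.coe_toNNReal hc]
    exact le_self_add
  refine mul_le_mul' h1 ?_
  rw [ENNReal.ofReal_rpow_of_pos hr]
  exact ENNReal.ofReal_le_ofReal (Real.rpow_le_rpow_of_exponent_ge hr hr1 hda)

end Decomposition

end CarnotGroup

/-! ### Smooth approximation of intrinsic Lipschitz graphs -/

theorem exists_smooth_one_nhds {E : Type*} [NormedAddCommGroup E] [NormedSpace ℝ E]
    [FiniteDimensional ℝ E] {K : Set E} (hK : IsCompact K) :
    ∃ η : E → ℝ, ContDiff ℝ ∞ η ∧ HasCompactSupport η ∧ (∀ᶠ x in 𝓝ˢ K, η x = 1) ∧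
      ∀ x, η x ∈ Icc (0 : ℝ) 1 := by
  obtain ⟨L, hL, hKL⟩ := exists_compact_superset hK
  obtain ⟨η, h1, h0, h01⟩ := exists_contMDiffMap_one_nhds_of_subset_interior 𝓘(ℝ, E) (n := ⊤)
    hK.isClosed hKL
  exact ⟨η, contMDiff_iff_contDiff.mp η.contMDiff, HasCompactSupport.intro hL fun x hx => h0 x hx,
    h1, h01⟩

/-- Bounds for a composition, uniform over a compact set. -/
theorem exists_bound_comp {E W Y : Type*} [NormedAddCommGroup E] [NormedSpace ℝ E]
    [NormedAddCommGroup W] [NormedSpace ℝ W] [NormedAddCommGroup Y] [NormedSpace ℝ Y]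
    {Q : W → Y} (hQ : ContDiff ℝ 1 Q) {K : Set W} (hK : IsCompact K) :
    ∃ C : ℝ, 0 < C ∧ ∀ (z : E → W) (x : E), DifferentiableAt ℝ z x → z x ∈ K →
      ‖Q (z x)‖ ≤ C ∧ ‖fderiv ℝ (fun y => Q (z y)) x‖ ≤ C * ‖fderiv ℝ z x‖ := by
  obtain ⟨C1, h1⟩ := hK.exists_bound_of_continuousOn hQ.continuous.continuousOn
  obtain ⟨C2, h2⟩ := hK.exists_bound_of_continuousOn
    (hQ.continuous_fderiv (by simp)).continuousOn
  refine ⟨max (max C1 C2) 1, by positivity, fun z x hz hx => ⟨?_, ?_⟩⟩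
  · exact (h1 _ hx).trans ((le_max_left _ _).trans (le_max_left _ _))
  · have h3 : fderiv ℝ (fun y => Q (z y)) x = (fderiv ℝ Q (z x)).comp (fderiv ℝ z x) :=
      fderiv_comp x (hQ.differentiable (by simp) _) hz
    rw [h3]
    refine (ContinuousLinearMap.opNorm_comp_le _ _).trans ?_
    gcongr
    exact (h2 _ hx).trans ((le_max_right _ _).trans (le_max_left _ _))

namespace CarnotGroup

variable {G : Type*} [NormedAddCommGroup G] [NormedSpace ℝ G] [FiniteDimensional ℝ G] [Group G]
  [CarnotGroup G]

/-- Move `y` towards `x`: the result is `y` for `s = 0` and `x` for `s = 1`. -/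
def pull (y x : G) (s : ℝ) : G := y * (s • (y⁻¹ * x))

theorem pull_zero (y x : G) : pull y x 0 = y := by rw [pull, zero_smul, mul_zero_coord]

omit [FiniteDimensional ℝ G] [CarnotGroup G] in
theorem pull_one (y x : G) : pull y x 1 = x := by rw [pull, one_smul, mul_inv_cancel_left]

omit [FiniteDimensional ℝ G] [CarnotGroup G] in
theorem pull_mul (g y x : G) (s : ℝ) : pull (g * y) (g * x) s = g * pull y x s := by
  simp only [pull, mul_inv_rev, mul_assoc, inv_mul_cancel_left]

theorem pull_dil {t : ℝ} (ht : 0 < t) (y x : G) (s : ℝ) :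
    pull (dil t y) (dil t x) s = dil t (pull y x s) := by
  simp only [pull, dil_mul ht, dil_inv, map_smul]

theorem contDiff_pull : ContDiff ℝ ∞ (fun q : G × G × ℝ => pull q.1 q.2.1 q.2.2) :=
  ContDiff.carnotMul contDiff_fst ((contDiff_snd.comp contDiff_snd).smul
    (ContDiff.carnotMul (ContDiff.carnotInv contDiff_fst) (contDiff_fst.comp contDiff_snd)))

/-- Separated subsets of a `ν`-ball have boundedly many elements. -/
theorem HomogeneousNorm.exists_card_le_of_separated (ν : HomogeneousNorm G) (R : ℝ) {ε : ℝ}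
    (hε : 0 < ε) : ∃ N : ℕ, ∀ S : Finset G, (∀ x ∈ S, ν x ≤ R) →
      (S : Set G).Pairwise (fun x y => ε < ν (x⁻¹ * y)) → S.card ≤ N := by
  classical
  have hopen : ∀ c : G, IsOpen {y | ν (c⁻¹ * y) < ε / 2} := fun c =>
    isOpen_lt (ν.continuous'.comp (continuous_const.mul continuous_id)) continuous_const
  obtain ⟨T, -, hT⟩ := (ν.isCompact_le R).elim_nhds_subcover (fun c => {y | ν (c⁻¹ * y) < ε / 2})
    (fun c _ => (hopen c).mem_nhds (by
      change ν (c⁻¹ * c) < ε / 2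
      rw [inv_mul_cancel, one_eq_zero, ν.map_zero']; positivity))
  refine ⟨T.card, fun S hS hSp => ?_⟩
  have hex : ∀ x ∈ S, ∃ c ∈ T, ν (c⁻¹ * x) < ε / 2 := fun x hx => by
    have := hT (hS x hx)
    rw [mem_iUnion₂] at this
    obtain ⟨c, hc, h⟩ := this
    exact ⟨c, hc, h⟩
  choose! f hf1 hf2 using hex
  refine Finset.card_le_card_of_injOn f hf1 fun x hx y hy hxy => ?_
  by_contra hne
  have h1 : ε < ν (x⁻¹ * y) := hSp hx hy hne
  have h2 := ν.le_add_of_mul x (f x) y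
  rw [ν.inv_mul_comm x (f x)] at h2
  have h3 := hf2 x hx
  have h4 := hf2 y hy
  rw [← hxy] at h4
  linarith

namespace Decomposition

variable (D : Decomposition G)

theorem pr_inv_mul_act (g y : G) (b : D.subM) : D.pr ((g * y)⁻¹ * D.act g b) = D.pr (y⁻¹ * b) := by
  rw [act, pr_mul_pr, mul_inv_rev, mul_assoc, inv_mul_cancel_left]

/-- Successively move the point `y₀` towards the points `y` of a list, with strengths
`η (P_M (y⁻¹ b))`. -/
noncomputable def pullFold (η : D.subM → ℝ) (y₀ : G) (ys : List G) (b : D.subM) : G :=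
  ys.foldr (fun y u => pull u y (η (D.pr (y⁻¹ * b)))) y₀

theorem pullFold_cons (η : D.subM → ℝ) (y₀ y : G) (ys : List G) (b : D.subM) :
    D.pullFold η y₀ (y :: ys) b = pull (D.pullFold η y₀ ys b) y (η (D.pr (y⁻¹ * b))) := rfl

/-- The construction is equivariant under left translations, so it can be estimated at the origin
after moving any graph point to the identity. -/
theorem pullFold_mul (η : D.subM → ℝ) (y₀ g : G) (ys : List G) (b : D.subM) :
    D.pullFold η (g * y₀) (ys.map (g * ·)) (D.act g b) = g * D.pullFold η y₀ ys b := by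
  induction ys with
  | nil => rfl
  | cons y ys ih => rw [List.map_cons, pullFold_cons, pullFold_cons, ih, pr_inv_mul_act, pull_mul]

theorem contDiff_pr_inv_mul : ContDiff ℝ ∞ (fun q : G × D.subM => D.pr (q.1⁻¹ * q.2)) :=
  D.contDiff_pr.comp (ContDiff.carnotMul (ContDiff.carnotInv contDiff_fst)
    (D.subM.subtypeL.contDiff.comp contDiff_snd))

theorem contDiff_pullFold {η : D.subM → ℝ} (hη : ContDiff ℝ ∞ η) (y₀ : G) (ys : List G) :
    ContDiff ℝ ∞ (D.pullFold η y₀ ys) := by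
  induction ys with
  | nil => exact contDiff_const
  | cons y ys ih =>
    exact contDiff_pull.comp (ih.prodMk (contDiff_const.prodMk
      (hη.comp (D.contDiff_pr_inv_mul.comp (contDiff_const.prodMk contDiff_id)))))

/-- Correct a map into `G` such that its projection is the identity. -/
noncomputable def correct (u : G) (b : D.subM) : G := u * D.pr (u⁻¹ * b)

theorem pr_correct (u : G) (b : D.subM) : D.pr (D.correct u b) = b := by
  rw [correct, pr_mul_pr, mul_inv_cancel_left, pr_coe]

theorem correct_mul (g u : G) (b : D.subM) : D.correct (g * u) (D.act g b) = g * D.correct u b := by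
  rw [correct, pr_inv_mul_act, correct, mul_assoc]

theorem contDiff_correct : ContDiff ℝ ∞ (fun q : G × D.subM => D.correct q.1 q.2) :=
  ContDiff.carnotMul contDiff_fst (D.subM.subtypeL.contDiff.comp D.contDiff_pr_inv_mul)

/-- Near `b = 0`, pulling towards `y` does one of three things. If `ν y ≤ 1`, the value is reset to
the constant `y`. If `D.pr y⁻¹` is outside the support of `η`, nothing happens. Otherwise a fixed
smooth function is applied to bounded data. There is at least one reset and there are at most `n`
active points, so the bound depends neither on `y₀` nor on the length of the list. -/
theorem exists_pullFold_bound (ν : HomogeneousNorm G) {η : D.subM → ℝ} (hη : ContDiff ℝ ∞ η)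
    (hη1 : ∀ y : G, ν y ≤ 1 → ∀ᶠ z in 𝓝 (D.pr y⁻¹), η z = 1) (R : ℝ) (n : ℕ) :
    ∃ C : ℝ, ∀ (y₀ : G) (ys : List G), (∃ y ∈ ys, ν y ≤ 1) →
      (∀ y ∈ ys, D.pr y⁻¹ ∈ tsupport η → ν y ≤ R) →
      (open Classical in ys.countP (fun y => D.pr y⁻¹ ∈ tsupport η) ≤ n) →
      ‖D.pullFold η y₀ ys 0‖ ≤ C ∧ ‖fderiv ℝ (D.pullFold η y₀ ys) 0‖ ≤ C := by
  classical
  have hact : ∀ y : G, ν y ≤ 1 → D.pr y⁻¹ ∈ tsupport η := fun y hy =>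
    subset_tsupport η (by rw [Function.mem_support, (hη1 y hy).self_of_nhds]; exact one_ne_zero)
  have hcont : ∀ y : G, Tendsto (fun b : D.subM => D.pr (y⁻¹ * b)) (𝓝 0) (𝓝 (D.pr y⁻¹)) := fun y => by
    have h1 : Continuous fun b : D.subM => D.pr (y⁻¹ * b) :=
      (D.contDiff_pr_inv_mul.comp (contDiff_const.prodMk contDiff_id)).continuous
    have := h1.tendsto 0
    rwa [Submodule.coe_zero, mul_zero_coord] at this
  induction n with
  | zero =>
    -- A resetting point is active, so the count cannot be zero.
    refine ⟨0, fun y₀ ys ⟨y, hy, hy1⟩ _ hcount => ?_⟩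
    have : 0 < ys.countP (fun y => D.pr y⁻¹ ∈ tsupport η) :=
      List.countP_pos_iff.mpr ⟨y, hy, decide_eq_true (hact y hy1)⟩
    lia
  | succ n ihn =>
    obtain ⟨C, hC⟩ := ihn
    obtain ⟨C1, hC1⟩ := (ν.isCompact_le 1).exists_bound_of_continuousOn continuousOn_id
    let Q : G × G × D.subM → G := fun q => pull q.1 q.2.1 (η (D.pr (q.2.1⁻¹ * q.2.2)))
    have hQ : ContDiff ℝ ∞ Q := contDiff_pull.comp (contDiff_fst.prodMk
      ((contDiff_fst.comp contDiff_snd).prodMk (hη.comp (D.contDiff_pr_inv_mul.comp contDiff_snd))))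
    obtain ⟨C2, hC20, hC2⟩ := exists_bound_comp (E := D.subM) (hQ.of_le (m := 1) (by simp))
      ((isCompact_closedBall (0 : G) C).prod ((ν.isCompact_le R).prod
        (isCompact_singleton (x := (0 : D.subM)))))
    set B := max (max C1 0) (max C2 (C2 * max C 1))
    refine ⟨B, fun y₀ ys => ?_⟩
    induction ys with
    | nil => rintro ⟨y, hy, -⟩; simp at hy
    | cons y ys ih =>
      intro hnear hR hcount
      have hfold : D.pullFold η y₀ (y :: ys) =
          fun b => pull (D.pullFold η y₀ ys b) y (η (D.pr (y⁻¹ * b))) := rfl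
      by_cases hy1 : ν y ≤ 1
      · have hev : D.pullFold η y₀ (y :: ys) =ᶠ[𝓝 0] fun _ => y := by
          filter_upwards [(hcont y).eventually (hη1 y hy1)] with b hb
          rw [hfold]
          simp only
          rw [hb, pull_one]
        rw [hev.fderiv_eq, hev.eq_of_nhds]
        refine ⟨(hC1 y hy1).trans ((le_max_left _ _).trans (le_max_left _ _)), ?_⟩
        rw [fderiv_fun_const]
        refine (norm_zero (E := D.subM →L[ℝ] G)).le.trans ?_
        exact (le_max_right C1 0).trans (le_max_left _ _)
      · have hnear' : ∃ y ∈ ys, ν y ≤ 1 := by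
          obtain ⟨z, hz, hz1⟩ := hnear
          rcases List.mem_cons.mp hz with rfl | hz
          · exact absurd hz1 hy1
          · exact ⟨z, hz, hz1⟩
        have hR' : ∀ y ∈ ys, D.pr y⁻¹ ∈ tsupport η → ν y ≤ R := fun z hz =>
          hR z (List.mem_cons_of_mem _ hz)
        by_cases hya : D.pr y⁻¹ ∈ tsupport η
        · rw [List.countP_cons_of_pos (by simpa using hya)] at hcount
          obtain ⟨h1, h2⟩ := hC y₀ ys hnear' hR' (by lia)
          have hd : DifferentiableAt ℝ (D.pullFold η y₀ ys) 0 :=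
            (D.contDiff_pullFold hη y₀ ys).differentiable (by simp) 0
          have hder : HasFDerivAt (fun b : D.subM => (D.pullFold η y₀ ys b, y, b))
              ((fderiv ℝ (D.pullFold η y₀ ys) 0).prod
                ((0 : D.subM →L[ℝ] G).prod (ContinuousLinearMap.id ℝ _))) 0 :=
            hd.hasFDerivAt.prodMk ((hasFDerivAt_const y _).prodMk (hasFDerivAt_id _))
          obtain ⟨h3, h4⟩ := hC2 (fun b : D.subM => (D.pullFold η y₀ ys b, y, b)) 0
            hder.differentiableAt ⟨by simpa using h1, hR y (List.mem_cons_self) hya, rfl⟩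
          refine ⟨h3.trans ((le_max_left _ _).trans (le_max_right _ _)), h4.trans ?_⟩
          refine le_trans ?_ ((le_max_right _ _).trans (le_max_right _ _))
          gcongr
          rw [hder.fderiv]
          rw [ContinuousLinearMap.opNorm_prod, Prod.norm_mk, ContinuousLinearMap.opNorm_prod,
            Prod.norm_mk, norm_zero]
          refine max_le (h2.trans (le_max_left _ _)) (max_le (by positivity) ?_)
          exact ContinuousLinearMap.norm_id_le.trans (le_max_right _ _)
        · rw [List.countP_cons_of_neg (by simpa using hya)] at hcount
          have hev : D.pullFold η y₀ (y :: ys) =ᶠ[𝓝 0] D.pullFold η y₀ ys := by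
            have : ∀ᶠ z in 𝓝 (D.pr y⁻¹), η z = 0 :=
              (notMem_tsupport_iff_eventuallyEq.mp hya)
            filter_upwards [(hcont y).eventually this] with b hb
            rw [hfold]
            simp only
            rw [hb, pull_zero]
          rw [hev.fderiv_eq, hev.eq_of_nhds]
          exact ih hnear' hR' hcount

end Decomposition

end CarnotGroup

namespace CarnotGroup

variable {G : Type*} [NormedAddCommGroup G] [NormedSpace ℝ G] [FiniteDimensional ℝ G] [Group G]
  [CarnotGroup G]

namespace Decomposition

variable (D : Decomposition G)

/-- By the Lipschitz bound the graph over `K` lies in a translate of one `ν`-ball, so the size of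
`ε`-separated families is bounded; a maximal family is a net. Distances are measured on the graph,
not in `M`. -/
theorem exists_net (ν : HomogeneousNorm G) {K : Set D.subM} (hK : IsCompact K)
    {Φ : D.subM → G} (h1 : ∀ m ∈ K, D.pr (Φ m) = m) {Λ : ℝ} (hΛ : 0 ≤ Λ)
    (h2 : ∀ m ∈ K, ∀ m' ∈ K, ν ((Φ m)⁻¹ * Φ m') ≤ Λ * ν (D.pr ((Φ m)⁻¹ * m')))
    {ε : ℝ} (hε : 0 < ε) : ∃ S : Finset D.subM, (S : Set D.subM) ⊆ K ∧
      (S : Set D.subM).Pairwise (fun m m' => ε < ν ((Φ m)⁻¹ * Φ m')) ∧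
      ∀ m ∈ K, ∃ s ∈ S, ν ((Φ m)⁻¹ * Φ s) ≤ ε := by
  classical
  rcases K.eq_empty_or_nonempty with rfl | ⟨m₁, hm₁⟩
  · exact ⟨∅, by simp, by simp, by simp⟩
  have hcont : Continuous fun m : D.subM => ν (D.pr ((Φ m₁)⁻¹ * m)) :=
    ν.continuous'.comp (continuous_subtype_val.comp
      (D.contDiff_pr_inv_mul.comp (contDiff_const.prodMk contDiff_id)).continuous)
  obtain ⟨B, hB⟩ := hK.exists_bound_of_continuousOn hcont.continuousOn
  obtain ⟨N, hN⟩ := ν.exists_card_le_of_separated (Λ * B) hε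
  obtain ⟨S, hSK, hSp, hSc⟩ := exists_maximal_separated
    (fun m m' : D.subM => ε < ν ((Φ m)⁻¹ * Φ m')) (fun x y h => by rwa [ν.inv_mul_comm])
    K N (fun S hS hSp => by
      have hinj : InjOn (fun m => (Φ m₁)⁻¹ * Φ m) (S : Set D.subM) := fun x hx y hy hxy => by
        have h3 := mul_left_cancel hxy
        rw [← h1 x (hS hx), h3, h1 y (hS hy)]
      rw [← Finset.card_image_of_injOn hinj]
      refine hN _ (fun x hx => ?_) ?_
      · obtain ⟨m, hm, rfl⟩ := Finset.mem_image.mp hx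
        refine (h2 m₁ hm₁ m (hS hm)).trans ?_
        gcongr
        exact (Real.le_norm_self _).trans (hB m (hS hm))
      · rw [Finset.coe_image]
        rintro _ ⟨x, hx, rfl⟩ _ ⟨y, hy, rfl⟩ hxy
        have hne : x ≠ y := fun h => hxy (by rw [h])
        have := hSp hx hy hne
        simpa [mul_assoc] using this)
  refine ⟨S, hSK, hSp, fun m hm => ?_⟩
  rcases hSc m hm with h | ⟨s, hs, h⟩
  · exact ⟨m, h, by rw [inv_mul_cancel, one_eq_zero, ν.map_zero']; exact hε.le⟩
  · exact ⟨s, hs, not_lt.mp h⟩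

/-- Smooth approximation of an intrinsic Lipschitz graph map at scale `ε`, with uniform control
after rescaling. -/
theorem exists_smooth_approximation (ν : HomogeneousNorm G) {K : Set D.subM} (hK : IsCompact K)
    {Φ : D.subM → G} (h1 : ∀ m ∈ K, D.pr (Φ m) = m) {Λ : ℝ} (hΛ : 0 ≤ Λ)
    (h2 : ∀ m ∈ K, ∀ m' ∈ K, ν ((Φ m)⁻¹ * Φ m') ≤ Λ * ν (D.pr ((Φ m)⁻¹ * m'))) :
    ∃ C : ℝ, ∀ ε : ℝ, 0 < ε → ∃ Ψ : D.subM → G, ContDiff ℝ ∞ Ψ ∧ (∀ m, D.pr (Ψ m) = m) ∧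
      ∀ m₀ ∈ K, ∃ F : D.subM → G, ContDiff ℝ ∞ F ∧ ‖F 0‖ ≤ C ∧ ‖fderiv ℝ F 0‖ ≤ C ∧
        ∀ b, Ψ (D.act (Φ m₀) (D.dilM ε b)) = Φ m₀ * dil ε (F b) := by
  classical
  have hcinv : Continuous fun y : G => D.pr y⁻¹ := D.continuous_pr.comp continuous_inv
  obtain ⟨η, hη, hηs, hη1, -⟩ := exists_smooth_one_nhds ((ν.isCompact_le 1).image hcinv)
  have hη1' : ∀ y : G, ν y ≤ 1 → ∀ᶠ z in 𝓝 (D.pr y⁻¹), η z = 1 := fun y hy =>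
    hη1.filter_mono (nhds_le_nhdsSet (mem_image_of_mem (fun y : G => D.pr y⁻¹) hy))
  obtain ⟨R, hR⟩ := IsCompact.exists_bound_of_continuousOn (f := fun z : D.subM => ν z) hηs
    (ν.continuous'.comp continuous_subtype_val).continuousOn
  obtain ⟨N, hN⟩ := ν.exists_card_le_of_separated (Λ * R) one_pos
  obtain ⟨C, hC⟩ := D.exists_pullFold_bound ν hη hη1' (Λ * R) N
  obtain ⟨C', hC'0, hC'⟩ := exists_bound_comp (E := D.subM) (D.contDiff_correct.of_le (m := 1) (by simp))
    ((isCompact_closedBall (0 : G) C).prod (isCompact_singleton (x := (0 : D.subM))))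
  refine ⟨max C' (C' * max C 1), fun ε hε => ?_⟩
  have hε' : 0 < ε⁻¹ := inv_pos.mpr hε
  obtain ⟨S, hSK, hSp, hSc⟩ := D.exists_net ν hK h1 hΛ h2 hε
  set xs : List G := S.toList.map Φ
  -- Rescale by `ε⁻¹`, pull the arbitrary base value `0` towards the rescaled net points one after
  -- the other, restore the projection with `correct`, and scale back.
  refine ⟨fun m => dil ε (D.correct (D.pullFold η 0 (xs.map (dil ε⁻¹)) (D.dilM ε⁻¹ m))
    (D.dilM ε⁻¹ m)), ?_, fun m => ?_, fun m₀ hm₀ => ?_⟩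
  · exact (dil ε).contDiff.comp (D.contDiff_correct.comp
      (((D.contDiff_pullFold hη _ _).comp (D.dilM ε⁻¹).contDiff).prodMk (D.dilM ε⁻¹).contDiff))
  · rw [pr_dil _ hε, pr_correct, dilM_dilM_inv _ hε]
  set g := Φ m₀
  set g' := dil ε⁻¹ g
  set ys : List G := xs.map fun x => dil ε⁻¹ (g⁻¹ * x)
  have hgg' : dil ε g' = g := dil_dil_inv hε.ne' g
  have hmem : ∀ y ∈ ys, ∃ s ∈ S, y = dil ε⁻¹ (g⁻¹ * Φ s) := fun y hy => by
    simp only [ys, xs, List.map_map, List.mem_map, Finset.mem_toList, Function.comp_apply] at hy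
    obtain ⟨s, hs, rfl⟩ := hy
    exact ⟨s, hs, rfl⟩
  have hnear : ∃ y ∈ ys, ν y ≤ 1 := by
    obtain ⟨s, hs, hle⟩ := hSc m₀ hm₀
    refine ⟨dil ε⁻¹ (g⁻¹ * Φ s), ?_, ?_⟩
    · simp only [ys, xs, List.map_map, List.mem_map, Finset.mem_toList, Function.comp_apply]
      exact ⟨s, hs, rfl⟩
    · rw [ν.dil_eq hε', inv_mul_le_iff₀ hε, mul_one]
      exact hle
  -- For an active point the projection is bounded, and the intrinsic Lipschitz inequality turns
  -- this into a bound for the point itself.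
  have hact : ∀ y ∈ ys, D.pr y⁻¹ ∈ tsupport η → ν y ≤ Λ * R := fun y hy hya => by
    obtain ⟨s, hs, rfl⟩ := hmem y hy
    have h3 := (Real.le_norm_self _).trans (hR _ hya)
    rw [← dil_inv, pr_dil _ hε', coe_dilM _ hε', ν.dil_eq hε', mul_inv_rev, inv_inv] at h3
    rw [ν.dil_eq hε', ν.inv_mul_comm]
    have h4 := h2 s (hSK hs) m₀ hm₀
    have h5 : D.pr ((Φ s)⁻¹ * m₀) = D.pr ((Φ s)⁻¹ * g) := by
      conv_lhs => rw [← h1 m₀ hm₀]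
      rw [pr_mul_pr]
    rw [h5] at h4
    calc _ ≤ ε⁻¹ * (Λ * ν (D.pr ((Φ s)⁻¹ * g))) := by gcongr
      _ = Λ * (ε⁻¹ * ν (D.pr ((Φ s)⁻¹ * g))) := by ring
      _ ≤ _ := by gcongr
  -- After rescaling, the active points are `1`-separated in a fixed ball, so their number is
  -- bounded independently of `ε`.
  have hcount : ys.countP (fun y => D.pr y⁻¹ ∈ tsupport η) ≤ N := by
    set f : D.subM → G := fun s => dil ε⁻¹ (g⁻¹ * Φ s)
    have hys : ys = S.toList.map f := by simp only [ys, xs, List.map_map]; rfl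
    set S' := S.filter fun s => D.pr (f s)⁻¹ ∈ tsupport η
    have hcard : ys.countP (fun y => D.pr y⁻¹ ∈ tsupport η) = S'.card := by
      rw [hys, List.countP_map]
      have : S' = (S.toList.filter (fun s => D.pr (f s)⁻¹ ∈ tsupport η)).toFinset := by
        ext s; simp [S']
      rw [this, List.toFinset_card_of_nodup (S.nodup_toList.filter _), List.countP_eq_length_filter]
      rfl
    have hsep : (S : Set D.subM).Pairwise (fun s t => 1 < ν ((f s)⁻¹ * f t)) := fun s hs t ht hst => by
      have := hSp hs ht hst
      simp only [f]
      rw [← dil_inv, ← dil_mul hε', ν.dil_eq hε']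
      have h6 : (g⁻¹ * Φ s)⁻¹ * (g⁻¹ * Φ t) = (Φ s)⁻¹ * Φ t := by group
      rw [h6, lt_inv_mul_iff₀ hε, mul_one]
      exact this
    have hinj : InjOn f (S' : Set D.subM) := fun s hs t ht hst => by
      by_contra hne
      have := hsep (Finset.mem_filter.mp hs).1 (Finset.mem_filter.mp ht).1 hne
      beta_reduce at this
      rw [hst, inv_mul_cancel, one_eq_zero, ν.map_zero'] at this
      linarith
    rw [hcard, ← Finset.card_image_of_injOn hinj]
    refine hN _ (fun y hy => ?_) ?_
    · obtain ⟨s, hs, rfl⟩ := Finset.mem_image.mp hy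
      obtain ⟨hs1, hs2⟩ := Finset.mem_filter.mp hs
      refine hact _ ?_ hs2
      rw [hys]
      exact List.mem_map_of_mem (Finset.mem_toList.mpr hs1)
    · rw [Finset.coe_image]
      rintro _ ⟨x, hx, rfl⟩ _ ⟨y, hy, rfl⟩ hxy
      exact hsep (Finset.mem_filter.mp hx).1 (Finset.mem_filter.mp hy).1 fun h => hxy (by rw [h])
  obtain ⟨h3, h4⟩ := hC (g'⁻¹ * 0) ys hnear hact hcount
  set P := D.pullFold η (g'⁻¹ * 0) ys
  have hPs : ContDiff ℝ ∞ P := D.contDiff_pullFold hη _ _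
  have hder : HasFDerivAt (fun b : D.subM => (P b, b))
      ((fderiv ℝ P 0).prod (ContinuousLinearMap.id ℝ _)) 0 :=
    (hPs.differentiable (by simp) 0).hasFDerivAt.prodMk (hasFDerivAt_id _)
  obtain ⟨h5, h6⟩ := hC' (fun b : D.subM => (P b, b)) 0 hder.differentiableAt
    ⟨by simpa using h3, rfl⟩
  refine ⟨fun b => D.correct (P b) b, D.contDiff_correct.comp (hPs.prodMk contDiff_id),
    h5.trans (le_max_left _ _), h6.trans (le_trans ?_ (le_max_right _ _)), fun b => ?_⟩
  · gcongr
    rw [hder.fderiv, ContinuousLinearMap.opNorm_prod, Prod.norm_mk]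
    exact max_le (h4.trans (le_max_left _ _))
      (ContinuousLinearMap.norm_id_le.trans (le_max_right _ _))
  · have h7 : D.dilM ε⁻¹ (D.act g (D.dilM ε b)) = D.act g' b := by
      rw [← hgg', act_dilM _ _ hε, dilM_inv_dilM _ hε]
    have h8 : xs.map (dil ε⁻¹) = ys.map (g' * ·) := by
      simp only [ys, List.map_map]
      refine List.map_congr_left fun x _ => ?_
      simp only [Function.comp_apply, g']
      rw [← dil_mul hε', mul_inv_cancel_left]
    -- The base value must also be written as a left translate by `g'`; its new value is harmless
    -- because the bounds do not depend on it.
    have h9 : (0 : G) = g' * (g'⁻¹ * 0) := by rw [mul_inv_cancel_left]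
    simp only
    rw [h7, h8]
    conv_lhs => rw [h9]
    rw [pullFold_mul, correct_mul, dil_mul hε, hgg']

end Decomposition

end CarnotGroup

/-! ### Weighted Jacobian integrals: integration by parts and homotopy -/

section Jacobians

variable {E : Type*} [NormedAddCommGroup E] [NormedSpace ℝ E] [FiniteDimensional ℝ E]

theorem det_prodMap_clm {F : Type*} [NormedAddCommGroup F] [NormedSpace ℝ F] [FiniteDimensional ℝ F]
    (A : E →L[ℝ] E) (B : F →L[ℝ] F) : (A.prodMap B).det = A.det * B.det :=
  LinearMap.det_prodMap _ _

omit [FiniteDimensional ℝ E] in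
theorem det_comp_clm (A B : E →L[ℝ] E) : (A.comp B).det = A.det * B.det := LinearMap.det_comp _ _

omit [FiniteDimensional ℝ E] in
theorem prod_eq_rowReplace (α : ℝ × E →L[ℝ] ℝ) (B : ℝ × E →L[ℝ] E) :
    α.prod B = rowReplace (ContinuousLinearMap.fst ℝ ℝ E) ((1, 0) : ℝ × E)
      ((0 : ℝ × E →L[ℝ] ℝ).prod B) α := by
  refine ContinuousLinearMap.ext fun x => ?_
  simp [rowReplace]

theorem det_prod_add (α β : ℝ × E →L[ℝ] ℝ) (B : ℝ × E →L[ℝ] E) :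
    ((α + β).prod B).det = (α.prod B).det + (β.prod B).det := by
  rw [prod_eq_rowReplace (α + β), prod_eq_rowReplace α, prod_eq_rowReplace β]
  exact det_rowReplace_add (by simp) _ _ _

theorem det_prod_smul (c : ℝ) (α : ℝ × E →L[ℝ] ℝ) (B : ℝ × E →L[ℝ] E) :
    ((c • α).prod B).det = c * (α.prod B).det := by
  rw [prod_eq_rowReplace (c • α), prod_eq_rowReplace α]
  exact det_rowReplace_smul (by simp) _ _ _

/-- The matrix is block triangular: a transvection composed with a block diagonal map. -/
theorem det_fst_prod (B : ℝ × E →L[ℝ] E) :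
    ((ContinuousLinearMap.fst ℝ ℝ E).prod B).det = (B.comp (ContinuousLinearMap.inr ℝ ℝ E)).det := by
  have h1 : (((ContinuousLinearMap.fst ℝ ℝ E).prod B : ℝ × E →L[ℝ] ℝ × E) : ℝ × E →ₗ[ℝ] ℝ × E) =
      (LinearMap.transvection (LinearMap.fst ℝ ℝ E) ((0, B (1, 0)) : ℝ × E)) ∘ₗ
        (((ContinuousLinearMap.id ℝ ℝ).prodMap (B.comp (ContinuousLinearMap.inr ℝ ℝ E)) :
          ℝ × E →L[ℝ] ℝ × E) : ℝ × E →ₗ[ℝ] ℝ × E) := by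
    refine LinearMap.ext fun x => ?_
    have : B x = B (0, x.2) + x.1 • B (1, 0) := by
      rw [← map_smul, ← map_add]; simp
    simp [LinearMap.transvection.apply, this]
  rw [ContinuousLinearMap.det, h1, LinearMap.det_comp, LinearMap.transvection.det]
  have := det_prodMap_clm (ContinuousLinearMap.id ℝ ℝ) (B.comp (ContinuousLinearMap.inr ℝ ℝ E))
  rw [ContinuousLinearMap.det] at this
  rw [this]
  simp [ContinuousLinearMap.det]

theorem det_prod_comp (α : ℝ × E →L[ℝ] ℝ) (B : ℝ × E →L[ℝ] E) (L : E →L[ℝ] E) :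
    (α.prod (L.comp B)).det = L.det * (α.prod B).det := by
  have : α.prod (L.comp B) = ((ContinuousLinearMap.id ℝ ℝ).prodMap L).comp (α.prod B) := by
    refine ContinuousLinearMap.ext fun x => by simp
  rw [this, det_comp_clm, det_prodMap_clm]
  simp [ContinuousLinearMap.det]

theorem exists_abs_det_le (C : ℝ) : ∃ C' : ℝ, ∀ A : E →L[ℝ] E, ‖A‖ ≤ C → |A.det| ≤ C' := by
  obtain ⟨C', h⟩ := (isCompact_closedBall (0 : E →L[ℝ] E) C).exists_bound_of_continuousOn
    (f := fun A : E →L[ℝ] E => A.det) ContinuousLinearMap.continuous_det.continuousOn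
  exact ⟨C', fun A hA => h A (by simpa using hA)⟩

/-- A shear in the direction `e`, with Jacobian determinant `b' ∘ ξ`. -/
theorem exists_shear {ξ : E →L[ℝ] ℝ} {e : E} (he : ξ e = 1) {b : ℝ → ℝ} (hb : ContDiff ℝ 1 b) :
    ContDiff ℝ 1 (fun z : E => z + (b (ξ z) - ξ z) • e) ∧
    ∀ z, (fderiv ℝ (fun z : E => z + (b (ξ z) - ξ z) • e) z).det = deriv b (ξ z) := by
  refine ⟨contDiff_id.add (((hb.comp ξ.contDiff).sub ξ.contDiff).smul contDiff_const), fun z => ?_⟩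
  have h1 : HasFDerivAt (fun z => b (ξ z)) (deriv b (ξ z) • ξ) z :=
    ((hb.differentiable (by simp) (ξ z)).hasDerivAt).comp_hasFDerivAt z ξ.hasFDerivAt
  have h2 := (hasFDerivAt_id (𝕜 := ℝ) z).add ((h1.sub ξ.hasFDerivAt).smul_const e)
  have h3 : ContinuousLinearMap.id ℝ E + (deriv b (ξ z) • ξ - ξ).smulRight e =
      rowReplace ξ e (ContinuousLinearMap.id ℝ E) (deriv b (ξ z) • ξ) := by
    simp [rowReplace]
  rw [h3] at h2
  have h4 : fderiv ℝ (fun z : E => z + (b (ξ z) - ξ z) • e) z = _ := h2.fderiv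
  rw [h4, det_rowReplace_smul he]
  have h5 := rowReplace_self ξ e (ContinuousLinearMap.id ℝ E)
  rw [ContinuousLinearMap.comp_id] at h5
  rw [h5]
  simp [ContinuousLinearMap.det]

theorem exists_primitive {ψ : ℝ → ℝ} (hψ : Continuous ψ) :
    ContDiff ℝ 1 (fun x : ℝ => ∫ t in (0 : ℝ)..x, ψ t) ∧
      ∀ x : ℝ, deriv (fun x : ℝ => ∫ t in (0 : ℝ)..x, ψ t) x = ψ x := by
  have hd : ∀ x : ℝ, HasDerivAt (fun x : ℝ => ∫ t in (0 : ℝ)..x, ψ t) (ψ x) x := fun x =>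
    intervalIntegral.integral_hasDerivAt_right (hψ.intervalIntegrable _ _)
      (hψ.stronglyMeasurableAtFilter _ _) hψ.continuousAt
  refine ⟨contDiff_one_iff_deriv.mpr ⟨fun x => (hd x).differentiableAt, ?_⟩, fun x => (hd x).deriv⟩
  rw [funext fun x => (hd x).deriv]
  exact hψ

variable [MeasurableSpace E] [BorelSpace E] (μ : Measure E) [μ.IsAddHaarMeasure]

/-- Integration by parts for the weighted Jacobian. -/
theorem integral_mul_det_fderiv_eq {T : E → E} (hT : ContDiff ℝ 1 T) {χ : E → ℝ}
    (hχ : ContDiff ℝ 1 χ) (hχs : HasCompactSupport χ) {ξ : E →L[ℝ] ℝ} {e : E} (he : ξ e = 1)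
    {b : ℝ → ℝ} (hb : ContDiff ℝ 1 b) :
    ∫ x, χ x * deriv b (ξ (T x)) * (fderiv ℝ T x).det ∂μ =
      -∫ x, b (ξ (T x)) * (rowReplace ξ e (fderiv ℝ T x) (fderiv ℝ χ x)).det ∂μ := by
  have hTd : ∀ x, HasFDerivAt T (fderiv ℝ T x) x := fun x =>
    (hT.differentiable (by simp) x).hasFDerivAt
  have hDT : Continuous (fderiv ℝ T) := hT.continuous_fderiv (by simp)
  have hDχ : Continuous (fderiv ℝ χ) := hχ.continuous_fderiv (by simp)
  -- The `ξ`-coordinate of `T` is replaced by `χ * b (ξ T)`. It has compact support, so the Jacobian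
  -- of `f` has integral zero; expanding it by the product rule gives the formula.
  set f : E → E := fun x => T x + (χ x * b (ξ (T x)) - ξ (T x)) • e
  have hf : ContDiff ℝ 1 f := hT.add (((hχ.mul (hb.comp (ξ.contDiff.comp hT))).sub
    (ξ.contDiff.comp hT)).smul contDiff_const)
  have hξf : (fun x => ξ (f x)) = fun x => χ x * b (ξ (T x)) := by
    ext x; simp [f, he]
  have h0 := integral_det_fderiv_eq_zero_of_coord μ hf ξ (fun h => by simp [h] at he) (by
    rw [hξf]; exact hχs.mul_right)
  have hfd : ∀ x, (fderiv ℝ f x).det = χ x * deriv b (ξ (T x)) * (fderiv ℝ T x).det +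
      b (ξ (T x)) * (rowReplace ξ e (fderiv ℝ T x) (fderiv ℝ χ x)).det := fun x => by
    have h1 : HasFDerivAt (fun x => ξ (T x)) (ξ.comp (fderiv ℝ T x)) x :=
      ξ.hasFDerivAt.comp x (hTd x)
    have h2 : HasFDerivAt (fun x => b (ξ (T x))) (deriv b (ξ (T x)) • ξ.comp (fderiv ℝ T x)) x :=
      (hb.differentiable (by simp) _).hasDerivAt.comp_hasFDerivAt x h1
    have h3 := (hTd x).add (((((hχ.differentiable (by simp) x).hasFDerivAt).mul h2).sub h1).smul_const
      e)
    have h4 : fderiv ℝ f x = rowReplace ξ e (fderiv ℝ T x)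
        ((χ x * deriv b (ξ (T x))) • ξ.comp (fderiv ℝ T x) + b (ξ (T x)) • fderiv ℝ χ x) := by
      refine h3.fderiv.trans ?_
      rw [rowReplace, smul_smul]
    rw [h4, det_rowReplace_add he, det_rowReplace_smul he, det_rowReplace_smul he, rowReplace_self]
  simp only [hfd] at h0
  rw [integral_add] at h0
  · linarith
  · refine Continuous.integrable_of_hasCompactSupport ?_ ((hχs.mul_right).mul_right)
    exact (hχ.continuous.mul ((hb.continuous_deriv le_rfl).comp (ξ.continuous.comp hT.continuous))).mul
      (ContinuousLinearMap.continuous_det.comp hDT)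
  · refine Continuous.integrable_of_hasCompactSupport ?_ ?_
    · refine (hb.continuous.comp (ξ.continuous.comp hT.continuous)).mul
        (ContinuousLinearMap.continuous_det.comp ?_)
      simp only [rowReplace]
      exact hDT.add ((ContinuousLinearMap.smulRightL ℝ E E).continuous₂.comp
        ((hDχ.sub (continuous_const.clm_comp hDT)).prodMk continuous_const))
    · refine HasCompactSupport.intro (K := tsupport χ) hχs fun x hx => ?_
      have : fderiv ℝ χ x = (0 : ℝ) • (0 : E →L[ℝ] ℝ) := by
        rw [zero_smul]
        by_contra h
        exact hx (support_fderiv_subset ℝ h)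
      rw [this, det_rowReplace_smul he, zero_mul, mul_zero]

/-- Homotopy estimate for the weighted Jacobian. -/
theorem abs_integral_mul_det_sub_le {T₀ T₁ : E → E} {H : ℝ × E → E} (hH : ContDiff ℝ 1 H)
    (h0 : ∀ s ≤ 0, ∀ x, H (s, x) = T₀ x) (h1 : ∀ s, 1 ≤ s → ∀ x, H (s, x) = T₁ x) {χ : E → ℝ}
    (hχ : ContDiff ℝ 1 χ) (hχs : HasCompactSupport χ) {ξ : E →L[ℝ] ℝ} {e : E} (he : ξ e = 1)
    {ψ : ℝ → ℝ} (hψ : Continuous ψ) (hψ1 : ∀ t, |ψ t| ≤ 1) {C : ℝ}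
    (hC : ∀ s ∈ Icc (0 : ℝ) 1, ∀ x ∈ tsupport χ,
      |(((fderiv ℝ χ x).comp (ContinuousLinearMap.snd ℝ ℝ E)).prod (fderiv ℝ H (s, x))).det| ≤ C) :
    |∫ x, χ x * ψ (ξ (T₀ x)) * (fderiv ℝ T₀ x).det ∂μ -
      ∫ x, χ x * ψ (ξ (T₁ x)) * (fderiv ℝ T₁ x).det ∂μ| ≤ C * μ.real (tsupport χ) := by
  obtain ⟨hb, hbψ⟩ := exists_primitive hψ
  set b : ℝ → ℝ := fun x : ℝ => ∫ t in (0 : ℝ)..x, ψ t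
  -- The shear absorbs the weight: `ψ (ξ T) * det DT` is the Jacobian of `ρ ∘ T`.
  obtain ⟨hρ, hρd⟩ := exists_shear he hb
  set ρ : E → E := fun z => z + (b (ξ z) - ξ z) • e
  obtain ⟨a, ha', has, ha1, ha01⟩ := exists_smooth_one_nhds (isCompact_Icc (a := (0 : ℝ)) (b := 1))
  have ha : ContDiff ℝ 1 a := ha'.of_le (by simp)
  have hHd : ∀ q, HasFDerivAt H (fderiv ℝ H q) q := fun q =>
    (hH.differentiable (by simp) q).hasFDerivAt
  have hDH : Continuous (fderiv ℝ H) := hH.continuous_fderiv (by simp)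
  have hDχ : Continuous (fderiv ℝ χ) := hχ.continuous_fderiv (by simp)
  have hDa : Continuous (deriv a) := ha.continuous_deriv le_rfl
  -- The first coordinate `a s * χ x` has compact support, so the Jacobian of `f` has integral zero.
  -- It splits into `g1`, which carries `a'`, and `g2`, which carries `dχ`.
  set f : ℝ × E → ℝ × E := fun q => (a q.1 * χ q.2, ρ (H q))
  have hf : ContDiff ℝ 1 f := ((ha.comp contDiff_fst).mul (hχ.comp contDiff_snd)).prodMk (hρ.comp hH)
  set g1 : ℝ × E → ℝ := fun q => deriv a q.1 * (χ q.2 * ψ (ξ (H q)) *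
    ((fderiv ℝ H q).comp (ContinuousLinearMap.inr ℝ ℝ E)).det)
  set g2 : ℝ × E → ℝ := fun q => a q.1 * (ψ (ξ (H q)) *
    (((fderiv ℝ χ q.2).comp (ContinuousLinearMap.snd ℝ ℝ E)).prod (fderiv ℝ H q)).det)
  have hfd : ∀ q, (fderiv ℝ f q).det = g1 q + g2 q := fun q => by
    have k1 : HasFDerivAt (fun q : ℝ × E => a q.1) (deriv a q.1 • ContinuousLinearMap.fst ℝ ℝ E) q :=
      (ha.differentiable (by simp) q.1).hasDerivAt.comp_hasFDerivAt q hasFDerivAt_fst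
    have k2 : HasFDerivAt (fun q : ℝ × E => χ q.2)
        ((fderiv ℝ χ q.2).comp (ContinuousLinearMap.snd ℝ ℝ E)) q :=
      (hχ.differentiable (by simp) q.2).hasFDerivAt.comp q hasFDerivAt_snd
    have k3 : HasFDerivAt (fun q : ℝ × E => ρ (H q)) ((fderiv ℝ ρ (H q)).comp (fderiv ℝ H q)) q :=
      (hρ.differentiable (by simp) _).hasFDerivAt.comp q (hHd q)
    have k4 := (k1.mul k2).prodMk k3
    have k5 : fderiv ℝ f q = _ := k4.fderiv
    rw [k5, det_prod_add, det_prod_smul, smul_smul, det_prod_smul, det_prod_comp, det_prod_comp,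
      det_fst_prod, hρd, hbψ]
    simp only [g1, g2]
    ring
  have hK : IsCompact (tsupport a ×ˢ tsupport χ) := IsCompact.prod has hχs
  have hχ0 : ∀ x, x ∉ tsupport χ → fderiv ℝ χ x = 0 := fun x hx => by
    by_contra h
    exact hx (support_fderiv_subset ℝ h)
  have hdet0 : ∀ (B : ℝ × E →L[ℝ] E), ((0 : ℝ × E →L[ℝ] ℝ).prod B).det = 0 := fun B => by
    have := det_prod_smul (0 : ℝ) (0 : ℝ × E →L[ℝ] ℝ) B
    rwa [zero_smul, zero_mul] at this
  have hg1 : Integrable g1 (volume.prod μ) := by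
    refine Continuous.integrable_of_hasCompactSupport ?_ (HasCompactSupport.intro hK fun q hq => ?_)
    · refine (hDa.comp continuous_fst).mul (((hχ.continuous.comp continuous_snd).mul
        (hψ.comp (ξ.continuous.comp hH.continuous))).mul (ContinuousLinearMap.continuous_det.comp ?_))
      exact hDH.clm_comp continuous_const
    · rw [mem_prod, not_and_or] at hq
      rcases hq with hq | hq
      · have : deriv a q.1 = 0 := by
          by_contra h
          exact hq (support_deriv_subset h)
        simp only [g1, this, zero_mul]
      · simp only [g1, image_eq_zero_of_notMem_tsupport hq, zero_mul, mul_zero]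
  -- For `s` outside `[0, 1]` the homotopy is stationary, so `(1, 0)` lies in the kernel and the
  -- determinant vanishes.
  have hg2z : ∀ q : ℝ × E, q ∉ Icc (0 : ℝ) 1 ×ˢ tsupport χ → g2 q = 0 := by
    rintro ⟨s, x⟩ hq
    by_cases hx : x ∈ tsupport χ
    · have hs : s < 0 ∨ 1 < s := by
        by_contra! hcon
        exact hq ⟨⟨hcon.1, hcon.2⟩, hx⟩
      have hker : fderiv ℝ H (s, x) (1, 0) = 0 := by
        have k1 : HasDerivAt (fun t : ℝ => (t, x)) ((1 : ℝ), (0 : E)) s :=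
          (hasDerivAt_id s).prodMk (hasDerivAt_const s x)
        have k2 := (hHd (s, x)).comp_hasDerivAt s k1
        have k3 : HasDerivAt (H ∘ fun t : ℝ => (t, x)) 0 s := by
          rcases hs with hs | hs
          · refine (hasDerivAt_const s (T₀ x)).congr_of_eventuallyEq ?_
            filter_upwards [Iio_mem_nhds hs] with t ht
            exact h0 t (le_of_lt ht) x
          · refine (hasDerivAt_const s (T₁ x)).congr_of_eventuallyEq ?_
            filter_upwards [Ioi_mem_nhds hs] with t ht
            exact h1 t (le_of_lt ht) x
        exact k2.unique k3
      have : (((fderiv ℝ χ x).comp (ContinuousLinearMap.snd ℝ ℝ E)).prod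
          (fderiv ℝ H (s, x))).det = 0 := by
        by_contra hne
        have hinj := LinearMap.isUnit_iff_isUnit_det ((((fderiv ℝ χ x).comp
          (ContinuousLinearMap.snd ℝ ℝ E)).prod (fderiv ℝ H (s, x)) : ℝ × E →L[ℝ] ℝ × E) :
          ℝ × E →ₗ[ℝ] ℝ × E) |>.mpr (isUnit_iff_ne_zero.mpr hne)
        have := ((Module.End.isUnit_iff _).mp hinj).1 (a₁ := ((1 : ℝ), (0 : E))) (a₂ := 0) (by
          simp [hker])
        simp at this
      simp only [g2, this, mul_zero]
    · simp only [g2, hχ0 x hx, ContinuousLinearMap.zero_comp, hdet0, mul_zero]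
  have hg2c : Continuous g2 := by
    refine (ha.continuous.comp continuous_fst).mul ((hψ.comp (ξ.continuous.comp hH.continuous)).mul
      (ContinuousLinearMap.continuous_det.comp ?_))
    have : Continuous fun q : ℝ × E => (ContinuousLinearMap.inl ℝ ℝ E).comp
        ((fderiv ℝ χ q.2).comp (ContinuousLinearMap.snd ℝ ℝ E)) +
        (ContinuousLinearMap.inr ℝ ℝ E).comp (fderiv ℝ H q) :=
      (continuous_const.clm_comp ((hDχ.comp continuous_snd).clm_comp continuous_const)).add
        (continuous_const.clm_comp hDH)
    refine this.congr fun q => ContinuousLinearMap.ext fun v => ?_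
    simp
  have hg2 : Integrable g2 (volume.prod μ) :=
    hg2c.integrable_of_hasCompactSupport (HasCompactSupport.intro (isCompact_Icc.prod hχs) hg2z)
  have hzero := integral_det_fderiv_eq_zero_of_coord ((volume : Measure ℝ).prod μ) hf
    (ContinuousLinearMap.fst ℝ ℝ E) (fun h => by
      have := congrArg (fun A => A ((1 : ℝ), (0 : E))) h
      simp at this)
    (HasCompactSupport.intro hK fun q hq => by
      rw [mem_prod, not_and_or] at hq
      rcases hq with hq | hq
      · simp [f, image_eq_zero_of_notMem_tsupport hq]
      · simp [f, image_eq_zero_of_notMem_tsupport hq])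
  simp only [hfd] at hzero
  rw [integral_add hg1 hg2, integral_prod _ hg1] at hzero
  set Λ₀ := ∫ x, χ x * ψ (ξ (T₀ x)) * (fderiv ℝ T₀ x).det ∂μ
  set Λ₁ := ∫ x, χ x * ψ (ξ (T₁ x)) * (fderiv ℝ T₁ x).det ∂μ
  have hslice : ∀ (s : ℝ) (T : E → E), (∀ x, H (s, x) = T x) → ∫ x, g1 (s, x) ∂μ =
      deriv a s * ∫ x, χ x * ψ (ξ (T x)) * (fderiv ℝ T x).det ∂μ := fun s T hT => by
    simp only [g1]
    rw [integral_const_mul]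
    congr 1
    refine integral_congr_ae (Eventually.of_forall fun x => ?_)
    have k1 : HasFDerivAt T ((fderiv ℝ H (s, x)).comp (ContinuousLinearMap.inr ℝ ℝ E)) x := by
      have := (hHd (s, x)).comp x (hasFDerivAt_prodMk_right s x)
      exact this.congr_of_eventuallyEq (Eventually.of_forall fun y => (hT y).symm)
    simp only [hT x, k1.fderiv]
  have hda : ∀ s ∈ Icc (0 : ℝ) 1, deriv a s = 0 := fun s hs => by
    have : a =ᶠ[𝓝 s] fun _ => 1 := ha1.filter_mono (nhds_le_nhdsSet hs)
    rw [this.deriv_eq, deriv_const]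
  -- Since `a' = 0` on `[0, 1]`, only the stationary ends contribute to `g1`. The integrals of `a'`
  -- over the two half-lines are `1` and `-1`, which produces the difference of the two weighted
  -- Jacobian integrals.
  have hsl : ∀ s : ℝ, ∫ x, g1 (s, x) ∂μ = (Iic 0).indicator (fun s => deriv a s * Λ₀) s +
      (Ioi 0).indicator (fun s => deriv a s * Λ₁) s := fun s => by
    rcases le_or_gt s 0 with hs | hs
    · rw [hslice s T₀ (h0 s hs), indicator_of_mem (mem_Iic.mpr hs),
        indicator_of_notMem (by simpa using hs), add_zero]
    · rw [indicator_of_notMem (by simpa using hs), indicator_of_mem (mem_Ioi.mpr hs), zero_add]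
      rcases le_or_gt 1 s with hs1 | hs1
      · rw [hslice s T₁ (h1 s hs1)]
      · simp [g1, hda s ⟨hs.le, hs1.le⟩]
  have hint : Integrable (deriv a) := hDa.integrable_of_hasCompactSupport has.deriv
  simp only [hsl] at hzero
  rw [integral_add ((hint.mul_const _).indicator measurableSet_Iic)
    ((hint.mul_const _).indicator measurableSet_Ioi), integral_indicator measurableSet_Iic,
    integral_indicator measurableSet_Ioi, integral_mul_const, integral_mul_const,
    has.integral_Iic_deriv_eq ha, has.integral_Ioi_deriv_eq ha] at hzero
  have ha0 : a 0 = 1 := (ha1.filter_mono (nhds_le_nhdsSet (by simp))).self_of_nhds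
  rw [ha0] at hzero
  have heq : Λ₀ - Λ₁ = -∫ q, g2 q ∂(volume.prod μ) := by linarith
  rw [heq, abs_neg, ← setIntegral_eq_integral_of_forall_compl_eq_zero
    (s := Icc (0 : ℝ) 1 ×ˢ tsupport χ) (fun q hq => hg2z q hq)]
  have hvol : (volume.prod μ).real (Icc (0 : ℝ) 1 ×ˢ tsupport χ) = μ.real (tsupport χ) := by
    rw [measureReal_def, Measure.prod_prod, Real.volume_Icc]
    simp [measureReal_def]
  rw [← hvol, ← Real.norm_eq_abs]
  refine norm_setIntegral_le_of_norm_le_const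
    ((isCompact_Icc.prod hχs).measure_lt_top) (fun q hq => ?_)
  simp only [g2, Real.norm_eq_abs, abs_mul]
  have k1 : |a q.1| ≤ 1 := by rw [abs_of_nonneg (ha01 _).1]; exact (ha01 _).2
  have k2 := hC q.1 hq.1 q.2 hq.2
  calc _ ≤ 1 * (1 * C) := by
        gcongr
        · exact hψ1 _
    _ = C := by ring

end Jacobians

theorem exists_abs_det_le_pow (E : Type*) [NormedAddCommGroup E] [NormedSpace ℝ E]
    [FiniteDimensional ℝ E] :
    ∃ (C : ℝ) (n : ℕ), 0 ≤ C ∧ ∀ (A : E →L[ℝ] E) (t : ℝ), 0 < t → ‖A‖ ≤ t → |A.det| ≤ C * t ^ n := by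
  obtain ⟨C, hC⟩ := exists_abs_det_le (E := E) 1
  refine ⟨max C 0, Module.finrank ℝ E, le_max_right _ _, fun A t ht hA => ?_⟩
  have h1 : (t⁻¹ • A).det = t⁻¹ ^ Module.finrank ℝ E * A.det := by
    have := LinearMap.det_smul t⁻¹ (A : E →ₗ[ℝ] E)
    exact this
  have h2 : ‖t⁻¹ • A‖ ≤ 1 := by
    rw [norm_smul, norm_inv, Real.norm_of_nonneg ht.le, inv_mul_le_iff₀ ht, mul_one]
    exact hA
  have h3 := hC _ h2
  rw [h1, abs_mul, abs_of_nonneg (by positivity), inv_pow, inv_mul_le_iff₀ (by positivity)] at h3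
  refine h3.trans ?_
  rw [mul_comm]
  gcongr
  exact le_max_left _ _

theorem norm_rowReplace_le {E : Type*} [NormedAddCommGroup E] [NormedSpace ℝ E]
    (φ : E →L[ℝ] ℝ) (e : E) (A : E →L[ℝ] E) (α : E →L[ℝ] ℝ) :
    ‖rowReplace φ e A α‖ ≤ (1 + ‖φ‖ * ‖e‖) * ‖A‖ + ‖α‖ * ‖e‖ := by
  refine ContinuousLinearMap.opNorm_le_bound _ (by positivity) fun x => ?_
  have h : rowReplace φ e A α x = A x + (α x - φ (A x)) • e := by simp [rowReplace]
  rw [h]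
  calc ‖A x + (α x - φ (A x)) • e‖ ≤ ‖A x‖ + (‖α x‖ + ‖φ (A x)‖) * ‖e‖ := by
        refine (norm_add_le _ _).trans ?_
        rw [norm_smul]
        gcongr
        exact norm_sub_le _ _
    _ ≤ ‖A‖ * ‖x‖ + (‖α‖ * ‖x‖ + ‖φ‖ * (‖A‖ * ‖x‖)) * ‖e‖ := by
        gcongr
        · exact A.le_opNorm x
        · exact α.le_opNorm x
        · exact (φ.le_opNorm _).trans (by gcongr; exact A.le_opNorm x)
    _ = _ := by ring

/-! ### Jacobians of projected approximations -/

namespace CarnotGroup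

variable {G : Type*} [NormedAddCommGroup G] [NormedSpace ℝ G] [FiniteDimensional ℝ G] [Group G]
  [CarnotGroup G]

/-- A linear map which is a group homomorphism commuting with dilations. -/
structure IsGradedHom (κ : G →L[ℝ] G) : Prop where
  map_mul : ∀ x y, κ (x * y) = κ x * κ y
  map_dil : ∀ t : ℝ, 0 < t → ∀ x, κ (dil t x) = dil t (κ x)

namespace Decomposition

/-- `Ψ` is a smooth approximation of `Φ` at scale `ε`, controlled after rescaling. -/
structure IsApproximation (D : Decomposition G) (K : Set D.subM) (Φ : D.subM → G) (C ε : ℝ)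
    (Ψ : D.subM → G) : Prop where
  contDiff : ContDiff ℝ ∞ Ψ
  exists_chart : ∀ m₀ ∈ K, ∃ F : D.subM → G, ContDiff ℝ ∞ F ∧ ‖F 0‖ ≤ C ∧ ‖fderiv ℝ F 0‖ ≤ C ∧
    ∀ b, Ψ (D.act (Φ m₀) (D.dilM ε b)) = Φ m₀ * dil ε (F b)

variable {D : Decomposition G}

theorem IsApproximation.exists_eq {K : Set D.subM} {Φ : D.subM → G} {C ε : ℝ} {Ψ : D.subM → G}
    (h : D.IsApproximation K Φ C ε Ψ) (hε : 0 < ε) {m₀ : D.subM} (hm₀ : m₀ ∈ K) :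
    ∃ F : D.subM → G, ContDiff ℝ ∞ F ∧ ‖F 0‖ ≤ C ∧ ‖fderiv ℝ F 0‖ ≤ C ∧
      ∀ m, Ψ m = Φ m₀ * dil ε (F (D.dilM ε⁻¹ (D.act (Φ m₀)⁻¹ m))) := by
  obtain ⟨F, h1, h2, h3, h4⟩ := h.exists_chart m₀ hm₀
  refine ⟨F, h1, h2, h3, fun m => ?_⟩
  rw [← h4, dilM_dilM_inv _ hε, ← act_mul, mul_inv_cancel, act_one]

theorem pr_gradedHom_mul_dil {κ : G →L[ℝ] G} (hκ : IsGradedHom κ) (g : G) {t : ℝ} (ht : 0 < t)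
    (y : G) : D.pr (κ (g * dil t y)) = D.act (κ g) (D.dilM t (D.pr (κ y))) := by
  rw [hκ.map_mul, hκ.map_dil t ht, ← D.act_pr, pr_dil _ ht]

theorem act_inv_eq_zero {g : G} {m : D.subM} (h : D.pr g = m) : D.act g⁻¹ m = 0 := by
  rw [← h, act_pr, inv_mul_cancel, one_eq_zero, pr_zero]

theorem differentiableAt_act (g : G) (m : D.subM) :
    HasFDerivAt (D.act g) (fderiv ℝ (D.act g) m) m :=
  ((D.contDiff_act g).differentiable (by simp) m).hasFDerivAt

theorem exists_norm_dilM_le (D : Decomposition G) :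
    ∃ C : ℝ, 0 < C ∧ ∀ t : ℝ, 0 ≤ t → t ≤ 1 → ‖D.dilM t‖ ≤ C * t := by
  obtain ⟨C, hC, h⟩ := exists_norm_dil_le (G := G)
  refine ⟨(‖D.linM‖ + 1) * C * (‖D.subM.subtypeL‖ + 1), by positivity, fun t h0 h1 => ?_⟩
  calc ‖D.dilM t‖ ≤ ‖D.linM‖ * (‖dil (G := G) t‖ * ‖D.subM.subtypeL‖) :=
        (ContinuousLinearMap.opNorm_comp_le _ _).trans
          (mul_le_mul_of_nonneg_left (ContinuousLinearMap.opNorm_comp_le _ _) (norm_nonneg _))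
    _ ≤ (‖D.linM‖ + 1) * ((C * t) * (‖D.subM.subtypeL‖ + 1)) := by
        gcongr
        · linarith
        · exact h t h0 h1
        · linarith
    _ = _ := by ring

theorem exists_norm_dilM_inv_le (D : Decomposition G) :
    ∃ (C : ℝ) (s : ℕ), 0 < C ∧ ∀ t : ℝ, 1 ≤ t → ‖D.dilM t‖ ≤ C * t ^ s := by
  obtain ⟨C, s, hC, h⟩ := exists_norm_dil_inv_le (G := G)
  refine ⟨(‖D.linM‖ + 1) * C * (‖D.subM.subtypeL‖ + 1), s, by positivity, fun t h1 => ?_⟩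
  calc ‖D.dilM t‖ ≤ ‖D.linM‖ * (‖dil (G := G) t‖ * ‖D.subM.subtypeL‖) :=
        (ContinuousLinearMap.opNorm_comp_le _ _).trans
          (mul_le_mul_of_nonneg_left (ContinuousLinearMap.opNorm_comp_le _ _) (norm_nonneg _))
    _ ≤ (‖D.linM‖ + 1) * ((C * t ^ s) * (‖D.subM.subtypeL‖ + 1)) := by
        gcongr
        · linarith
        · exact h t h1
        · linarith
    _ = _ := by ring

theorem exists_norm_fderiv_act_le (D : Decomposition G) {A : Set G} (hA : IsCompact A)
    {B : Set D.subM} (hB : IsCompact B) :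
    ∃ C : ℝ, 0 < C ∧ ∀ g ∈ A, ∀ m ∈ B, ‖fderiv ℝ (D.act g) m‖ ≤ C := by
  have hc : Continuous fun q : G × D.subM => fderiv ℝ (D.act q.1) q.2 := by
    simp only [fderiv_act]
    exact (D.contDiff_act_uncurry.continuous_fderiv (by simp)).clm_comp continuous_const
  obtain ⟨C, hC⟩ := (hA.prod hB).exists_bound_of_continuousOn
    (f := fun q : G × D.subM => fderiv ℝ (D.act q.1) q.2) hc.continuousOn
  exact ⟨max C 1, by positivity, fun g hg m hm => (hC (g, m) ⟨hg, hm⟩).trans (le_max_left _ _)⟩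

theorem contDiff_pr_gradedHom (κ : G →L[ℝ] G) : ContDiff ℝ ∞ fun x => D.pr (κ x) :=
  D.contDiff_pr.comp κ.contDiff

theorem det_dilM_inv {ε : ℝ} (hε : 0 < ε) : (D.dilM ε).det * (D.dilM ε⁻¹).det = 1 := by
  rw [← D.det_dilM_mul hε (inv_pos.mpr hε), mul_inv_cancel₀ hε.ne', dilM_one]
  simp [ContinuousLinearMap.det]

/-- The differential of `P_M ∘ κ ∘ Ψ`, read in the rescaled chart. -/
theorem hasFDerivAt_pr_gradedHom {κ : G →L[ℝ] G} (hκ : IsGradedHom κ) {g : G} {m : D.subM}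
    (hg : D.pr g = m) {ε : ℝ} (hε : 0 < ε) {F Ψ : D.subM → G} (hF : DifferentiableAt ℝ F 0)
    (h : ∀ m, Ψ m = g * dil ε (F (D.dilM ε⁻¹ (D.act g⁻¹ m)))) :
    HasFDerivAt (fun m => D.pr (κ (Ψ m)))
      ((fderiv ℝ (D.act (κ g)) (D.dilM ε (D.pr (κ (F 0))))).comp ((D.dilM ε).comp
        ((fderiv ℝ (fun b => D.pr (κ (F b))) 0).comp ((D.dilM ε⁻¹).comp
          (fderiv ℝ (D.act g⁻¹) m))))) m := by
  have h0 : D.dilM ε⁻¹ (D.act g⁻¹ m) = 0 := by rw [act_inv_eq_zero hg, map_zero]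
  have hT : (fun m => D.pr (κ (Ψ m))) = fun m =>
      D.act (κ g) (D.dilM ε (D.pr (κ (F (D.dilM ε⁻¹ (D.act g⁻¹ m)))))) := by
    funext m
    rw [h, pr_gradedHom_mul_dil hκ _ hε]
  rw [hT]
  have k1 := (D.dilM ε⁻¹).hasFDerivAt.comp m (differentiableAt_act g⁻¹ m)
  have hR : DifferentiableAt ℝ (fun b => D.pr (κ (F b))) 0 :=
    ((contDiff_pr_gradedHom κ).differentiable (by simp) _).comp _ hF
  have k2 : HasFDerivAt (fun b => D.pr (κ (F b))) (fderiv ℝ (fun b => D.pr (κ (F b))) 0)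
      (D.dilM ε⁻¹ (D.act g⁻¹ m)) := by rw [h0]; exact hR.hasFDerivAt
  have k3 := (D.dilM ε).hasFDerivAt.comp m (k2.comp m k1)
  have k4 := (differentiableAt_act (κ g) _).comp m k3
  simp only [Function.comp_apply, h0] at k4
  exact k4

/-- In the chart at `Φ m` the differential is a bounded map between `dilM ε` and `dilM ε⁻¹`,
composed with differentials of the action. The determinants of the dilations cancel and those of the
action are one, so the Jacobian is bounded uniformly in `ε`. Only the operator norm pays a power of
`ε⁻¹`. -/
theorem exists_bounds_of_isApproximation {K : Set D.subM} {Φ : D.subM → G}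
    (hK : IsCompact K) (hΦ : ContinuousOn Φ K) (h1 : ∀ m ∈ K, D.pr (Φ m) = m) {κ : G →L[ℝ] G}
    (hκ : IsGradedHom κ) (C : ℝ) :
    ∃ (C' : ℝ) (s : ℕ), 0 < C' ∧ ∀ (ε : ℝ) (Ψ : D.subM → G), 0 < ε → ε ≤ 1 →
      D.IsApproximation K Φ C ε Ψ → ∀ m ∈ K,
        |(fderiv ℝ (fun m => D.pr (κ (Ψ m))) m).det| ≤ C' ∧
        ‖fderiv ℝ (fun m => D.pr (κ (Ψ m))) m‖ ≤ C' * ε⁻¹ ^ s ∧ ‖D.pr (κ (Ψ m))‖ ≤ C' := by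
  obtain ⟨C1, hC1, hQ⟩ := exists_bound_comp (E := D.subM) (Q := fun x => D.pr (κ x))
    ((contDiff_pr_gradedHom κ).of_le (by simp)) (isCompact_closedBall (0 : G) C)
  obtain ⟨C2, hdet⟩ := exists_abs_det_le (E := D.subM) (C1 * C)
  obtain ⟨C3, hC3, hdil⟩ := D.exists_norm_dilM_le
  obtain ⟨C4, s, hC4, hdilinv⟩ := D.exists_norm_dilM_inv_le
  have hΦK : IsCompact (Φ '' K) := hK.image_of_continuousOn hΦ
  obtain ⟨C5, hC5, hA⟩ := D.exists_norm_fderiv_act_le (hΦK.image κ.continuous)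
    (isCompact_closedBall (0 : D.subM) (C3 * C1))
  obtain ⟨C6, hC6, hB⟩ := D.exists_norm_fderiv_act_le (hΦK.image continuous_inv) hK
  obtain ⟨C7, hE⟩ := ((hΦK.image κ.continuous).prod
    (isCompact_closedBall (0 : D.subM) (C3 * C1))).exists_bound_of_continuousOn
    D.contDiff_act_uncurry.continuous.continuousOn
  refine ⟨max (max (C5 * C3 * (C1 * |C|) * C4 * C6) C2) (max C7 1), s, by positivity,
    fun ε Ψ hε hε1 h m hm => ?_⟩
  obtain ⟨F, hF, hF0, hF1, hΨ⟩ := h.exists_eq hε hm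
  have hFd : DifferentiableAt ℝ F 0 := hF.differentiable (by simp) 0
  have hfd := (hasFDerivAt_pr_gradedHom hκ (h1 m hm) hε hFd hΨ).fderiv
  obtain ⟨hq1, hq2⟩ := hQ F 0 hFd (by simpa using hF0)
  have hC0 : 0 ≤ C := (norm_nonneg _).trans hF0
  have hq2' : ‖fderiv ℝ (fun b => D.pr (κ (F b))) 0‖ ≤ C1 * C := hq2.trans (by gcongr)
  have hd1 : ‖D.dilM ε‖ ≤ C3 := (hdil ε hε.le hε1).trans (mul_le_of_le_one_right hC3.le hε1)
  have hmem : D.dilM ε (D.pr (κ (F 0))) ∈ Metric.closedBall (0 : D.subM) (C3 * C1) := by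
    rw [mem_closedBall_zero_iff]
    exact ((D.dilM ε).le_opNorm _).trans (by gcongr)
  have hg : κ (Φ m) ∈ κ '' (Φ '' K) := mem_image_of_mem _ (mem_image_of_mem _ hm)
  refine ⟨?_, ?_, ?_⟩
  · rw [hfd, det_comp_clm, det_comp_clm, det_comp_clm, det_comp_clm, det_fderiv_act,
      det_fderiv_act]
    have : 1 * ((D.dilM ε).det * ((fderiv ℝ (fun b => D.pr (κ (F b))) 0).det *
        ((D.dilM ε⁻¹).det * 1))) = (fderiv ℝ (fun b => D.pr (κ (F b))) 0).det := by
      linear_combination (fderiv ℝ (fun b => D.pr (κ (F b))) 0).det * det_dilM_inv (D := D) hε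
    rw [this]
    exact (hdet _ hq2').trans ((le_max_right _ _).trans (le_max_left _ _))
  · rw [hfd]
    have e1 := hA _ hg _ hmem
    have e2 := hB (Φ m)⁻¹ (mem_image_of_mem _ (mem_image_of_mem _ hm)) m hm
    have e3 := hdilinv ε⁻¹ ((one_le_inv₀ hε).mpr hε1)
    have hle : ∀ A B : D.subM →L[ℝ] D.subM, ‖A.comp B‖ ≤ ‖A‖ * ‖B‖ :=
      fun A B => ContinuousLinearMap.opNorm_comp_le A B
    calc _ ≤ C5 * (C3 * ((C1 * C) * ((C4 * ε⁻¹ ^ s) * C6))) := by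
          refine (hle _ _).trans (mul_le_mul e1 ?_ (ContinuousLinearMap.opNorm_nonneg _) hC5.le)
          refine (hle _ _).trans (mul_le_mul hd1 ?_ (ContinuousLinearMap.opNorm_nonneg _) hC3.le)
          refine (hle _ _).trans (mul_le_mul hq2' ?_ (ContinuousLinearMap.opNorm_nonneg _) (by positivity))
          exact (hle _ _).trans (mul_le_mul e3 e2 (ContinuousLinearMap.opNorm_nonneg _) (by positivity))
      _ = (C5 * C3 * (C1 * |C|) * C4 * C6) * ε⁻¹ ^ s := by rw [abs_of_nonneg hC0]; ring
      _ ≤ _ := by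
          gcongr
          exact (le_max_left _ _).trans (le_max_left _ _)
  · have h0 : D.dilM ε⁻¹ (D.act (Φ m)⁻¹ m) = 0 := by rw [act_inv_eq_zero (h1 m hm), map_zero]
    rw [hΨ m, h0, pr_gradedHom_mul_dil hκ _ hε]
    exact (hE (κ (Φ m), D.dilM ε (D.pr (κ (F 0)))) ⟨hg, hmem⟩).trans
      ((le_max_left _ _).trans (le_max_right _ _))

/-- The hypothesis `hc` is applied to the differential at the origin of the translated map `W`. By
the chart formula with `ε = 1`, its left side becomes the sum of Jacobians and its right side the
Jacobian of `P_M ∘ Ψ`, which is the identity. -/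
theorem sum_det_fderiv_eq_one {ι : Type*} (s : Finset ι) {κ : ι → G →L[ℝ] G}
    (hκ : ∀ i, IsGradedHom (κ i)) (c : ι → ℝ)
    (hc : ∀ A : D.subM →L[ℝ] G, ∑ i ∈ s, c i * ((fderiv ℝ D.pr 0).comp ((κ i).comp A)).det =
      ((fderiv ℝ D.pr 0).comp A).det)
    {Ψ : D.subM → G} (hΨ : ContDiff ℝ ∞ Ψ) (hpr : ∀ m, D.pr (Ψ m) = m) (m : D.subM) :
    ∑ i ∈ s, c i * (fderiv ℝ (fun m => D.pr (κ i (Ψ m))) m).det = 1 := by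
  set g := Ψ m
  have hone : ∀ x : G, dil (1 : ℝ) x = x := dil_one
  set W : D.subM → G := fun b => g⁻¹ * Ψ (D.act g b)
  have hW : ContDiff ℝ ∞ W :=
    ContDiff.carnotMul contDiff_const (hΨ.comp (D.contDiff_act g))
  have hW0 : W 0 = 0 := by
    have : D.act g 0 = m := by
      rw [act, Submodule.coe_zero, mul_zero_coord]; exact hpr m
    simp only [W, this]
    rw [← one_eq_zero]; exact inv_mul_cancel _
  have hWd : DifferentiableAt ℝ W 0 := hW.differentiable (by simp) 0
  have hΨW : ∀ m', Ψ m' = g * dil (1 : ℝ) (W (D.dilM 1⁻¹ (D.act g⁻¹ m'))) := fun m' => by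
    rw [hone, inv_one, dilM_one]
    simp only [W, ContinuousLinearMap.id_apply]
    rw [← act_mul, mul_inv_cancel, act_one, mul_inv_cancel_left]
  have hdet : ∀ κ : G →L[ℝ] G, IsGradedHom κ → (fderiv ℝ (fun m => D.pr (κ (Ψ m))) m).det =
      ((fderiv ℝ D.pr 0).comp (κ.comp (fderiv ℝ W 0))).det := fun κ hκ => by
    have hfd := (hasFDerivAt_pr_gradedHom hκ (hpr m) one_pos hWd hΨW).fderiv
    have hch : fderiv ℝ (fun b => D.pr (κ (W b))) 0 =
        (fderiv ℝ D.pr 0).comp (κ.comp (fderiv ℝ W 0)) := by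
      have k1 : HasFDerivAt D.pr (fderiv ℝ D.pr 0) (κ (W 0)) := by
        rw [hW0, map_zero]; exact (D.contDiff_pr.differentiable (by simp) 0).hasFDerivAt
      exact (k1.comp 0 (κ.hasFDerivAt.comp 0 hWd.hasFDerivAt)).fderiv
    rw [hfd, det_comp_clm, det_comp_clm, det_comp_clm, det_comp_clm, det_fderiv_act,
      det_fderiv_act, inv_one, dilM_one, hch]
    simp [ContinuousLinearMap.det]
  have hid : IsGradedHom (ContinuousLinearMap.id ℝ G) := ⟨fun _ _ => rfl, fun _ _ _ => rfl⟩
  have h2 := hdet _ hid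
  simp only [ContinuousLinearMap.id_apply, hpr, ContinuousLinearMap.id_comp] at h2
  rw [Finset.sum_congr rfl fun i _ => by rw [hdet _ (hκ i)], hc, ← h2]
  simp [ContinuousLinearMap.det]

/-- Two consecutive approximations are joined by a homotopy with small Jacobian against `dχ`. -/
theorem exists_homotopy_bound {K : Set D.subM} {Φ : D.subM → G}
    (hK : IsCompact K) (hΦ : ContinuousOn Φ K) (h1 : ∀ m ∈ K, D.pr (Φ m) = m) {κ : G →L[ℝ] G}
    (hκ : IsGradedHom κ) (C : ℝ) {χ : D.subM → ℝ} (hχ : ContDiff ℝ 1 χ) :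
    ∃ C' : ℝ, 0 ≤ C' ∧ ∀ (ε : ℝ) (Ψ Ψ' : D.subM → G), 0 < ε → ε ≤ 1 →
      D.IsApproximation K Φ C ε Ψ → D.IsApproximation K Φ C (ε / 2) Ψ' →
      ∀ s ∈ Icc (0 : ℝ) 1, ∀ m ∈ K,
        |(((fderiv ℝ χ m).comp (ContinuousLinearMap.snd ℝ ℝ D.subM)).prod (fderiv ℝ
          (fun q : ℝ × D.subM => D.pr (κ (pull (Ψ q.2) (Ψ' q.2) (Real.smoothTransition q.1))))
          (s, m))).det| ≤ C' * ε := by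
  set Q : G × G × ℝ → D.subM := fun q => D.pr (κ (pull q.1 q.2.1 q.2.2))
  have hQs : ContDiff ℝ ∞ Q := (contDiff_pr_gradedHom κ).comp contDiff_pull
  set C2 : ℝ := ‖dil (G := G) (1 / 2)‖ * C
  obtain ⟨C1, hC1, hQ⟩ := exists_bound_comp (E := ℝ × D.subM) (hQs.of_le (by simp))
    ((isCompact_closedBall (0 : G) C).prod ((isCompact_closedBall (0 : G) C2).prod
      (isCompact_Icc (a := (0 : ℝ)) (b := 1))))
  have hσ : ContDiff ℝ 1 Real.smoothTransition := Real.smoothTransition.contDiff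
  obtain ⟨C3, hC3⟩ := (isCompact_Icc (a := (0 : ℝ)) (b := 1)).exists_bound_of_continuousOn
    (hσ.continuous_deriv le_rfl).continuousOn
  set C4 : ℝ := max C (max (‖dil (G := G) (1 / 2)‖ * (C * ‖D.dilM 2‖)) C3)
  obtain ⟨C5, hC5, hdil⟩ := D.exists_norm_dilM_le
  have hΦK : IsCompact (Φ '' K) := hK.image_of_continuousOn hΦ
  obtain ⟨C6, hC6, hA⟩ := D.exists_norm_fderiv_act_le hΦK (isCompact_singleton (x := (0 : D.subM)))
  obtain ⟨C7, hC7⟩ := hK.exists_bound_of_continuousOn (hχ.continuous_fderiv (by simp)).continuousOn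
  obtain ⟨C8, hdet⟩ := exists_abs_det_le (E := ℝ × D.subM) (max (|C7| * (C6 * C5)) (C1 * C4))
  refine ⟨max C8 0, le_max_right _ _, fun ε Ψ Ψ' hε hε1 h h' s hs m hm => ?_⟩
  obtain ⟨F, hF, hF0, hF1, hΨ⟩ := h.exists_eq hε hm
  obtain ⟨F', hF', hF0', hF1', hΨ'⟩ := h'.exists_eq (half_pos hε) hm
  set g := Φ m
  have hgm : D.pr g = m := h1 m hm
  have hFd : HasFDerivAt F (fderiv ℝ F 0) 0 := (hF.differentiable (by simp) 0).hasFDerivAt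
  have hFd' : HasFDerivAt F' (fderiv ℝ F' 0) 0 := (hF'.differentiable (by simp) 0).hasFDerivAt
  -- In the chart of scale `ε`, the approximation of scale `ε / 2` reads `dil (1 / 2) ∘ F' ∘ dilM
  -- 2`. So both approximations and their derivatives at the origin are bounded independently of
  -- `ε`.
  set z : ℝ × D.subM → G × G × ℝ := fun q =>
    (F q.2, dil (1 / 2) (F' (D.dilM 2 q.2)), Real.smoothTransition q.1)
  have hz : HasFDerivAt z (((fderiv ℝ F 0).comp (ContinuousLinearMap.snd ℝ ℝ D.subM)).prod
      (((dil (1 / 2)).comp ((fderiv ℝ F' 0).comp ((D.dilM 2).comp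
        (ContinuousLinearMap.snd ℝ ℝ D.subM)))).prod
        (deriv Real.smoothTransition s • ContinuousLinearMap.fst ℝ ℝ D.subM))) (s, 0) := by
    have k1 : HasFDerivAt (fun q : ℝ × D.subM => F q.2)
        ((fderiv ℝ F 0).comp (ContinuousLinearMap.snd ℝ ℝ D.subM)) (s, 0) :=
      HasFDerivAt.comp (g := F) (s, (0 : D.subM)) hFd hasFDerivAt_snd
    have k2 : HasFDerivAt (fun q : ℝ × D.subM => D.dilM 2 q.2)
        ((D.dilM 2).comp (ContinuousLinearMap.snd ℝ ℝ D.subM)) (s, 0) :=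
      (D.dilM 2).hasFDerivAt.comp (s, (0 : D.subM)) hasFDerivAt_snd
    have k3 : HasFDerivAt (fun q : ℝ × D.subM => F' (D.dilM 2 q.2)) ((fderiv ℝ F' 0).comp
        ((D.dilM 2).comp (ContinuousLinearMap.snd ℝ ℝ D.subM))) (s, 0) :=
      HasFDerivAt.comp (g := F') (s, (0 : D.subM)) (by simpa using hFd') k2
    have k4 : HasFDerivAt (fun q : ℝ × D.subM => Real.smoothTransition q.1)
        (deriv Real.smoothTransition s • ContinuousLinearMap.fst ℝ ℝ D.subM) (s, 0) :=
      HasDerivAt.comp_hasFDerivAt (f := fun q : ℝ × D.subM => q.1) (s, (0 : D.subM))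
        (hσ.differentiable (by simp) s).hasDerivAt hasFDerivAt_fst
    exact k1.prodMk (((dil (1 / 2)).hasFDerivAt.comp (s, (0 : D.subM)) k3).prodMk k4)
  have hC0 : 0 ≤ C := (norm_nonneg _).trans hF0
  have hsnd : ‖ContinuousLinearMap.snd ℝ ℝ D.subM‖ ≤ 1 := ContinuousLinearMap.norm_snd_le ℝ ℝ D.subM
  have hfst : ‖ContinuousLinearMap.fst ℝ ℝ D.subM‖ ≤ 1 := ContinuousLinearMap.norm_fst_le ℝ ℝ D.subM
  have hzn : ‖fderiv ℝ z (s, 0)‖ ≤ C4 := by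
    rw [hz.fderiv, ContinuousLinearMap.opNorm_prod, norm_prod_le_iff,
      ContinuousLinearMap.opNorm_prod, norm_prod_le_iff]
    refine ⟨?_, ?_, ?_⟩
    · refine le_trans ?_ (le_max_left _ _)
      refine (ContinuousLinearMap.opNorm_comp_le _ _).trans ?_
      exact (mul_le_of_le_one_right (norm_nonneg _) hsnd).trans hF1
    · refine le_trans ?_ ((le_max_left _ _).trans (le_max_right _ _))
      refine (ContinuousLinearMap.opNorm_comp_le _ _).trans (mul_le_mul_of_nonneg_left ?_ (norm_nonneg _))
      refine (ContinuousLinearMap.opNorm_comp_le _ _).trans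
        (mul_le_mul hF1' ?_ (norm_nonneg _) hC0)
      exact (ContinuousLinearMap.opNorm_comp_le _ _).trans
        (mul_le_of_le_one_right (norm_nonneg _) hsnd)
    · refine le_trans ?_ ((le_max_right _ _).trans (le_max_right _ _))
      rw [norm_smul]
      exact (mul_le_of_le_one_right (norm_nonneg _) hfst).trans (hC3 s hs)
  have hzmem : z (s, 0) ∈ Metric.closedBall (0 : G) C ×ˢ Metric.closedBall (0 : G) C2 ×ˢ
      Icc (0 : ℝ) 1 := by
    refine ⟨by simpa [z] using hF0, ?_, Real.smoothTransition.nonneg _,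
      Real.smoothTransition.le_one _⟩
    simp only [z, map_zero, mem_closedBall_zero_iff]
    exact ((dil (1 / 2)).le_opNorm _).trans (mul_le_mul_of_nonneg_left hF0' (norm_nonneg _))
  obtain ⟨-, hR⟩ := hQ z (s, 0) hz.differentiableAt hzmem
  set R : ℝ × D.subM → D.subM := fun q => Q (z q)
  have hRd : HasFDerivAt R (fderiv ℝ R (s, 0)) (s, 0) :=
    DifferentiableAt.hasFDerivAt ((hQs.differentiable (by simp) _).comp _ hz.differentiableAt)
  have hRn : ‖fderiv ℝ R (s, 0)‖ ≤ C1 * C4 := hR.trans (by gcongr)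
  -- `B` is the differential of the rescaled chart at `m`, and `B'` is its inverse.
  set B : D.subM →L[ℝ] D.subM := (D.dilM ε⁻¹).comp (fderiv ℝ (D.act g⁻¹) m)
  set B' : D.subM →L[ℝ] D.subM := (fderiv ℝ (D.act g) 0).comp (D.dilM ε)
  have hact0 : D.act g⁻¹ m = 0 := act_inv_eq_zero hgm
  have hBB : ∀ v, B' (B v) = v := fun v => by
    have k1 := differentiableAt_act g⁻¹ m
    have k2 : HasFDerivAt (D.act g) (fderiv ℝ (D.act g) 0) (D.act g⁻¹ m) := by
      rw [hact0]; exact differentiableAt_act g 0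
    have k3 := k2.comp m k1
    have k4 : D.act g ∘ D.act g⁻¹ = id := by
      funext x
      simp only [Function.comp_apply, id_eq]
      rw [← act_mul, mul_inv_cancel, act_one]
    rw [k4] at k3
    have k5 := k3.unique (hasFDerivAt_id m)
    simp only [B, B', ContinuousLinearMap.comp_apply, dilM_dilM_inv _ hε]
    exact congrArg (fun A : D.subM →L[ℝ] D.subM => A v) k5
  have hH : (fun q : ℝ × D.subM => D.pr (κ (pull (Ψ q.2) (Ψ' q.2) (Real.smoothTransition q.1)))) =
      fun q => D.act (κ g) (D.dilM ε (R (q.1, D.dilM ε⁻¹ (D.act g⁻¹ q.2)))) := by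
    funext q
    have k1 : D.dilM (ε / 2)⁻¹ (D.act g⁻¹ q.2) = D.dilM 2 (D.dilM ε⁻¹ (D.act g⁻¹ q.2)) := by
      rw [dilM_dilM _ two_pos (inv_pos.mpr hε)]
      congr 2
      field_simp
    have k2 : ∀ y : G, dil (ε / 2) y = dil ε (dil (1 / 2) y) := fun y => by
      rw [dil_dil]; congr 2; ring
    rw [hΨ, hΨ', k1, k2, pull_mul, pull_dil hε, pr_gradedHom_mul_dil hκ _ hε]
  have k1 : HasFDerivAt (fun m' => D.dilM ε⁻¹ (D.act g⁻¹ m')) B m :=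
    (D.dilM ε⁻¹).hasFDerivAt.comp m (differentiableAt_act g⁻¹ m)
  have k2 : HasFDerivAt (fun q : ℝ × D.subM => (q.1, D.dilM ε⁻¹ (D.act g⁻¹ q.2)))
      ((ContinuousLinearMap.id ℝ ℝ).prodMap B) (s, m) :=
    (hasFDerivAt_id s).prodMap (p := (s, m)) k1
  have k3 : HasFDerivAt (fun q : ℝ × D.subM => R (q.1, D.dilM ε⁻¹ (D.act g⁻¹ q.2)))
      ((fderiv ℝ R (s, 0)).comp ((ContinuousLinearMap.id ℝ ℝ).prodMap B)) (s, m) := by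
    refine HasFDerivAt.comp (g := R) (s, m) ?_ k2
    simp only [hact0, map_zero]
    exact hRd
  have k4 := (differentiableAt_act (κ g) _).comp (s, m) ((D.dilM ε).hasFDerivAt.comp (s, m) k3)
  have hHd := k4.fderiv
  simp only [Function.comp_def] at hHd
  rw [hH, hHd, det_prod_comp, det_prod_comp, det_fderiv_act, one_mul]
  -- Writing `dχ = (dχ ∘ B') ∘ B` pulls `B` out of both components, and its determinant cancels that
  -- of `dilM ε`. What remains of `dχ` is `dχ ∘ B'`, of size `ε` because `B'` contains `dilM ε`;
  -- this is the whole gain.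
  have hfac : ((fderiv ℝ χ m).comp (ContinuousLinearMap.snd ℝ ℝ D.subM)).prod
      ((fderiv ℝ R (s, 0)).comp ((ContinuousLinearMap.id ℝ ℝ).prodMap B)) =
      ((((fderiv ℝ χ m).comp B').comp (ContinuousLinearMap.snd ℝ ℝ D.subM)).prod
        (fderiv ℝ R (s, 0))).comp ((ContinuousLinearMap.id ℝ ℝ).prodMap B) := by
    refine ContinuousLinearMap.ext fun v => ?_
    simp [hBB]
  set α : D.subM →L[ℝ] ℝ := (fderiv ℝ χ m).comp B'
  have hα : α.comp (ContinuousLinearMap.snd ℝ ℝ D.subM) =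
      ε • ((ε⁻¹ • α).comp (ContinuousLinearMap.snd ℝ ℝ D.subM)) := by
    rw [ContinuousLinearMap.smul_comp, smul_smul, mul_inv_cancel₀ hε.ne', one_smul]
  have hαn : ‖ε⁻¹ • α‖ ≤ |C7| * (C6 * C5) := by
    refine (ContinuousLinearMap.opNorm_smul_le _ _).trans ?_
    rw [norm_inv, Real.norm_of_nonneg hε.le, inv_mul_le_iff₀ hε]
    calc ‖α‖ ≤ |C7| * (C6 * (C5 * ε)) := by
          refine (ContinuousLinearMap.opNorm_comp_le _ _).trans
            (mul_le_mul ((hC7 m hm).trans (le_abs_self _)) ?_ (norm_nonneg _) (abs_nonneg _))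
          exact (ContinuousLinearMap.opNorm_comp_le _ _).trans
            (mul_le_mul (hA g (mem_image_of_mem _ hm) 0 rfl) (hdil ε hε.le hε1)
              (norm_nonneg _) hC6.le)
      _ = ε * (|C7| * (C6 * C5)) := by ring
  have hBdet : (D.dilM ε).det * B.det = 1 := by
    simp only [B]
    rw [det_comp_clm, det_fderiv_act, mul_one, det_dilM_inv hε]
  have hfin : |((((ε⁻¹ • α).comp (ContinuousLinearMap.snd ℝ ℝ D.subM)).prod
      (fderiv ℝ R (s, 0))) : ℝ × D.subM →L[ℝ] ℝ × D.subM).det| ≤ C8 := by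
    refine hdet _ ?_
    rw [ContinuousLinearMap.opNorm_prod]
    refine max_le_max ?_ hRn
    exact (ContinuousLinearMap.opNorm_comp_le _ _).trans
      ((mul_le_of_le_one_right (norm_nonneg _) hsnd).trans hαn)
  rw [hfac, det_comp_clm, det_prodMap_clm, hα, det_prod_smul]
  have hid : (ContinuousLinearMap.id ℝ ℝ).det = 1 := by simp [ContinuousLinearMap.det]
  rw [hid, one_mul]
  set d := ((((ε⁻¹ • α).comp (ContinuousLinearMap.snd ℝ ℝ D.subM)).prod
      (fderiv ℝ R (s, 0))) : ℝ × D.subM →L[ℝ] ℝ × D.subM).det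
  have : (D.dilM ε).det * (ε * d * B.det) = d * ε := by linear_combination ε * d * hBdet
  rw [this, abs_mul, abs_of_pos hε]
  gcongr
  exact hfin.trans (le_max_left _ _)

end Decomposition

end CarnotGroup

/-! ### How often a limit of smooth maps meets an evenly distributed set -/

section LowerBound

variable {E : Type*} [NormedAddCommGroup E] [NormedSpace ℝ E] [FiniteDimensional ℝ E]
  [MeasurableSpace E] [BorelSpace E] (μ : Measure E) [μ.IsAddHaarMeasure]

omit [FiniteDimensional ℝ E] [MeasurableSpace E] [BorelSpace E] in
theorem fderiv_eq_zero_of_notMem_tsupport {χ : E → ℝ} {x : E} (hx : x ∉ tsupport χ) :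
    fderiv ℝ χ x = 0 := by
  by_contra h
  exact hx (support_fderiv_subset ℝ h)

/-- Integration by parts leaves no derivative of `b`: the primitive enters only through its
supremum, at the cost of a power of the bound on `DT`. -/
theorem exists_abs_integral_deriv_mul_det_le {χ : E → ℝ} (hχ : ContDiff ℝ 1 χ)
    (hχs : HasCompactSupport χ) {ξ : E →L[ℝ] ℝ} {e : E} (he : ξ e = 1) :
    ∃ (C : ℝ) (n : ℕ), 0 ≤ C ∧ ∀ (T : E → E) (b : ℝ → ℝ) (B t : ℝ), ContDiff ℝ 1 T →
      ContDiff ℝ 1 b → 0 ≤ B → 1 ≤ t → (∀ x ∈ tsupport χ, ‖fderiv ℝ T x‖ ≤ t) →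
      (∀ x ∈ tsupport χ, |b (ξ (T x))| ≤ B) →
      |∫ x, χ x * deriv b (ξ (T x)) * (fderiv ℝ T x).det ∂μ| ≤ C * t ^ n * B := by
  obtain ⟨C1, n, hC1, hdet⟩ := exists_abs_det_le_pow E
  obtain ⟨C2, hC2⟩ := hχs.exists_bound_of_continuousOn
    (hχ.continuous_fderiv (by simp)).continuousOn
  set c : ℝ := (1 + ‖ξ‖ * ‖e‖) + |C2| * ‖e‖
  have hc : 0 < c := by positivity
  refine ⟨C1 * c ^ n * μ.real (tsupport χ), n, by positivity, fun T b B t hT hb hB ht hTt hbB => ?_⟩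
  rw [integral_mul_det_fderiv_eq μ hT hχ hχs he hb, abs_neg,
    ← setIntegral_eq_integral_of_forall_compl_eq_zero (s := tsupport χ), ← Real.norm_eq_abs]
  · have : C1 * c ^ n * μ.real (tsupport χ) * t ^ n * B =
        (B * (C1 * (c * t) ^ n)) * μ.real (tsupport χ) := by rw [mul_pow]; ring
    rw [this]
    refine norm_setIntegral_le_of_norm_le_const hχs.measure_lt_top fun x hx => ?_
    rw [norm_mul]
    refine mul_le_mul (hbB x hx) (hdet _ _ (by positivity) ?_) (norm_nonneg _) hB
    refine (norm_rowReplace_le _ _ _ _).trans ?_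
    have h2 : ‖fderiv ℝ χ x‖ ≤ |C2| * t :=
      ((hC2 x hx).trans (le_abs_self _)).trans (le_mul_of_one_le_right (abs_nonneg _) ht)
    calc _ ≤ (1 + ‖ξ‖ * ‖e‖) * t + |C2| * t * ‖e‖ := by
          gcongr
          exact hTt x hx
      _ = c * t := by simp only [c]; ring
  · intro x hx
    rw [fderiv_eq_zero_of_notMem_tsupport hx]
    have := det_rowReplace_smul he (fderiv ℝ T x) (0 : ℝ) 0
    rw [zero_smul, zero_mul] at this
    rw [this, mul_zero]

theorem abs_sub_le_of_halving {u : ℕ → ℝ} {C : ℝ} (hC : 0 ≤ C)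
    (h : ∀ j, |u j - u (j + 1)| ≤ C * (1 / 2) ^ j) (j l : ℕ) (hjl : j ≤ l) :
    |u j - u l| ≤ 2 * C * (1 / 2) ^ j := by
  have key : ∀ d, |u j - u (j + d)| ≤ 2 * C * (1 / 2) ^ j - 2 * C * (1 / 2) ^ (j + d) := by
    intro d
    induction d with
    | zero => simp
    | succ d ih =>
      have h1 := abs_sub_le (u j) (u (j + d)) (u (j + (d + 1)))
      have h2 := h (j + d)
      have h3 : (1 / 2 : ℝ) ^ (j + (d + 1)) = (1 / 2) ^ (j + d) * (1 / 2) := pow_succ _ _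
      rw [h3]
      rw [← add_assoc] at h1 ⊢
      linarith
  obtain ⟨d, rfl⟩ := Nat.exists_eq_add_of_le hjl
  have : 0 ≤ 2 * C * (1 / 2) ^ (j + d) := by positivity
  linarith [key d]

/-- If the closed set `A ⊆ ℝ` is evenly distributed with density `a`, the maps `T j` converge to
`T`, and the Jacobians of the `T j` behave well, then `ξ ∘ T` hits `A` often. -/
theorem exists_lower_bound_of_approximation {χ : E → ℝ} (hχ : ContDiff ℝ 1 χ)
    (hχs : HasCompactSupport χ) (hχ01 : ∀ x, χ x ∈ Icc (0 : ℝ) 1) {ξ : E →L[ℝ] ℝ} {e : E}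
    (he : ξ e = 1) {T : ℕ → E → E} {T' : E → E} {C : ℝ} {s : ℕ} (hC : 0 < C)
    (hT : ∀ j, ContDiff ℝ 1 (T j)) (hT' : ContinuousOn T' (tsupport χ))
    (hdet : ∀ j, ∀ x ∈ tsupport χ, |(fderiv ℝ (T j) x).det| ≤ C)
    (hDT : ∀ j, ∀ x ∈ tsupport χ, ‖fderiv ℝ (T j) x‖ ≤ C * (2 ^ j) ^ s)
    (hTb : ∀ j, ∀ x ∈ tsupport χ, ‖T j x‖ ≤ C)
    (hhom : ∀ (j : ℕ) (ψ : ℝ → ℝ), Continuous ψ → (∀ t, |ψ t| ≤ 1) →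
      |∫ x, χ x * ψ (ξ (T j x)) * (fderiv ℝ (T j) x).det ∂μ -
        ∫ x, χ x * ψ (ξ (T (j + 1) x)) * (fderiv ℝ (T (j + 1)) x).det ∂μ| ≤ C * (1 / 2) ^ j)
    (hlim : ∀ x ∈ tsupport χ, Tendsto (fun j => T j x) atTop (𝓝 (T' x))) :
    ∃ (C' R : ℝ) (N : ℕ), 0 < C' ∧ ∀ (j : ℕ) (A : Set ℝ) (a e : ℝ), IsClosed A → 0 ≤ a → 0 ≤ e →
      (∀ x, |x| ≤ R → |∫ t in (0 : ℝ)..x, (A.indicator 1 t - a)| ≤ e) →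
      a * |∫ x, χ x * (fderiv ℝ (T j) x).det ∂μ| ≤
        C' * (μ.real {x ∈ tsupport χ | ξ (T' x) ∈ A} + (1 / 2) ^ j + (2 ^ j) ^ N * e) := by
  obtain ⟨C1, n, hC1, hosc⟩ := exists_abs_integral_deriv_mul_det_le μ hχ hχs he
  set R : ℝ := ‖ξ‖ * C
  have hR0 : 0 ≤ R := by positivity
  set c : ℝ := max C 1
  have hc1 : 1 ≤ c := le_max_right _ _
  refine ⟨max (2 * C) (C1 * c ^ n), R, s * n, by positivity,
    fun j A a e' hA ha he' hdist => ?_⟩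
  -- The homotopy estimate needs continuous weights, so the indicator of `A` is replaced by
  -- continuous functions decreasing to it on shrinking neighbourhoods.
  set δ : ℕ → ℝ := fun k => 1 / ((k : ℝ) + 1)
  have hδ : ∀ k, 0 < δ k := fun k => by positivity
  set f : ℕ → ℝ → ℝ := fun k t => (thickenedIndicator (hδ k) A t : ℝ)
  have hfc : ∀ k, Continuous (f k) := fun k =>
    NNReal.continuous_coe.comp (thickenedIndicator (hδ k) A).continuous
  have hf0 : ∀ k t, 0 ≤ f k t := fun k t => NNReal.coe_nonneg _
  have hf1 : ∀ k t, f k t ≤ 1 := fun k t => by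
    exact_mod_cast thickenedIndicator_le_one (hδ k) A t
  have hflim : ∀ t, Tendsto (fun k => f k t) atTop (𝓝 (A.indicator 1 t)) := fun t => by
    have h1 := tendsto_pi_nhds.mp (thickenedIndicator_tendsto_indicator_closure hδ
      tendsto_one_div_add_atTop_nhds_zero_nat A) t
    have h2 := (NNReal.continuous_coe.tendsto _).comp h1
    rw [hA.closure_eq] at h2
    have h3 : (((A.indicator (fun _ => (1 : ℝ≥0)) t : ℝ≥0)) : ℝ) = A.indicator 1 t := by
      by_cases ht : t ∈ A <;> simp [ht]
    rw [h3] at h2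
    exact h2
  have hAm : MeasurableSet A := hA.measurableSet
  have hind : Measurable (A.indicator (1 : ℝ → ℝ)) := measurable_one.indicator hAm
  have hind1 : ∀ t, ‖A.indicator (1 : ℝ → ℝ) t‖ ≤ 1 := fun t => by
    by_cases ht : t ∈ A <;> simp [ht]
  set η : ℕ → ℝ := fun k => ∫ t in Icc (-R) R, |f k t - A.indicator 1 t|
  have hηm : ∀ k, AEStronglyMeasurable (fun t => |f k t - A.indicator 1 t|)
      (volume.restrict (Icc (-R) R)) := fun k =>
    (((hfc k).measurable.sub hind).norm).aestronglyMeasurable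
  have hηb : ∀ k t, ‖|f k t - A.indicator 1 t|‖ ≤ 2 := fun k t => by
    rw [Real.norm_eq_abs, abs_abs]
    refine (abs_sub _ _).trans ?_
    have h1 := hind1 t
    rw [Real.norm_eq_abs] at h1
    rw [abs_of_nonneg (hf0 k t)]
    linarith [hf1 k t]
  have hηi : ∀ k, IntegrableOn (fun t => |f k t - A.indicator 1 t|) (Icc (-R) R) := fun k =>
    Integrable.mono' (g := fun _ => (2 : ℝ)) (integrable_const _) (hηm k)
      (Eventually.of_forall (hηb k))
  have hη : Tendsto η atTop (𝓝 0) := by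
    have h0 : (0 : ℝ) = ∫ t in Icc (-R) R, (0 : ℝ) := by simp
    rw [h0]
    refine tendsto_integral_of_dominated_convergence (fun _ => 2) hηm (integrable_const _)
      (fun k => Eventually.of_forall (hηb k)) (Eventually.of_forall fun t => ?_)
    have := ((hflim t).sub_const (A.indicator 1 t)).abs
    rwa [sub_self, abs_zero] at this
  have hη0 : ∀ k, 0 ≤ η k := fun k => integral_nonneg fun t => abs_nonneg _
  have hprim : ∀ k, ∀ x, |x| ≤ R → |∫ t in (0 : ℝ)..x, (f k t - a)| ≤ e' + η k := fun k x hx => by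
    have i1 : IntervalIntegrable (fun t => f k t - A.indicator 1 t) volume 0 x := by
      rw [intervalIntegrable_iff]
      refine Integrable.mono' (g := fun _ => (2 : ℝ)) (integrableOn_const (by simp))
        ((hfc k).measurable.sub hind).aestronglyMeasurable (Eventually.of_forall fun t => ?_)
      have := hηb k t
      rwa [Real.norm_eq_abs, abs_abs] at this
    have i2 : IntervalIntegrable (fun t => A.indicator 1 t - a) volume 0 x := by
      rw [intervalIntegrable_iff]
      refine Integrable.mono' (g := fun _ => 1 + |a|) (integrableOn_const (by simp))
        (hind.sub_const _).aestronglyMeasurable (Eventually.of_forall fun t => ?_)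
      exact (norm_sub_le _ _).trans (add_le_add (hind1 t) le_rfl)
    have hsplit : ∫ t in (0 : ℝ)..x, (f k t - a) = (∫ t in (0 : ℝ)..x, (f k t - A.indicator 1 t)) +
        ∫ t in (0 : ℝ)..x, (A.indicator 1 t - a) := by
      rw [← intervalIntegral.integral_add i1 i2]
      congr 1
      funext t
      ring
    have h3 : |∫ t in (0 : ℝ)..x, (f k t - A.indicator 1 t)| ≤ η k := by
      rw [← Real.norm_eq_abs]
      refine (intervalIntegral.norm_integral_le_integral_norm_uIoc).trans ?_
      refine setIntegral_mono_set (hηi k) (Eventually.of_forall fun t => abs_nonneg _) ?_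
      refine LE.le.eventuallyLE ?_
      intro t ht
      have := uIoc_subset_uIcc ht
      rw [abs_le] at hx
      rw [mem_uIcc] at this
      constructor <;> rcases this with h | h <;> linarith [hx.1, hx.2, h.1, h.2]
    rw [hsplit]
    refine (abs_add_le _ _).trans ?_
    linarith [hdist x hx]
  have hint : ∀ (l : ℕ) (ψ : ℝ → ℝ), Continuous ψ →
      Integrable (fun x => χ x * ψ (ξ (T l x)) * (fderiv ℝ (T l) x).det) μ := fun l ψ hψ => by
    refine Continuous.integrable_of_hasCompactSupport ?_ ((hχs.mul_right).mul_right)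
    exact (hχ.continuous.mul (hψ.comp (ξ.continuous.comp (hT l).continuous))).mul
      (ContinuousLinearMap.continuous_det.comp ((hT l).continuous_fderiv (by simp)))
  have hξT : ∀ l, ∀ x ∈ tsupport χ, |ξ (T l x)| ≤ R := fun l x hx =>
    (ξ.le_opNorm _).trans (mul_le_mul_of_nonneg_left (hTb l x hx) (norm_nonneg _))
  -- Integration by parts replaces the weight `f k` by its mean `a` at level `j`; telescoping the
  -- homotopy estimate then passes to level `l`, where the Jacobian is bounded by `C`. The growing
  -- derivative bound is used at level `j` only, so `l` is free to tend to infinity.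
  have hle_approx : ∀ k l, j ≤ l → a * |∫ x, χ x * (fderiv ℝ (T j) x).det ∂μ| ≤
      C * (∫ x, χ x * f k (ξ (T l x)) ∂μ) + 2 * C * (1 / 2) ^ j +
        C1 * c ^ n * (2 ^ j) ^ (s * n) * (e' + η k) := fun k l hjl => by
    obtain ⟨hb, hbd⟩ := exists_primitive (ψ := fun t => f k t - a)
      ((hfc k).sub continuous_const)
    have h1 := hosc (T j) _ (e' + η k) (c * (2 ^ j) ^ s) (hT j) hb (add_nonneg he' (hη0 k))
      (one_le_mul_of_one_le_of_one_le hc1 (one_le_pow₀ (one_le_pow₀ one_le_two)))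
      (fun x hx => (hDT j x hx).trans (by gcongr; exact le_max_left _ _))
      (fun x hx => hprim k _ (hξT j x hx))
    simp only [hbd] at h1
    have h2 : ∫ x, χ x * (f k (ξ (T j x)) - a) * (fderiv ℝ (T j) x).det ∂μ =
        ∫ x, χ x * f k (ξ (T j x)) * (fderiv ℝ (T j) x).det ∂μ -
          a * ∫ x, χ x * (fderiv ℝ (T j) x).det ∂μ := by
      have i1 : Integrable (fun x => χ x * (fderiv ℝ (T j) x).det) μ := by
        have := hint j (fun _ => 1) continuous_const
        simpa using this
      rw [← integral_const_mul, ← integral_sub (hint j _ (hfc k)) (i1.const_mul a)]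
      congr 1
      funext x
      ring
    have h3 := abs_sub_le_of_halving hC.le (fun i => hhom i (f k) (hfc k) fun t => by
      rw [abs_of_nonneg (hf0 k t)]; exact hf1 k t) j l hjl
    have h4 : |∫ x, χ x * f k (ξ (T l x)) * (fderiv ℝ (T l) x).det ∂μ| ≤
        C * ∫ x, χ x * f k (ξ (T l x)) ∂μ := by
      rw [← integral_const_mul, ← Real.norm_eq_abs]
      refine norm_integral_le_of_norm_le ?_ (Eventually.of_forall fun x => ?_)
      · refine Integrable.const_mul (Continuous.integrable_of_hasCompactSupport ?_ hχs.mul_right) C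
        exact hχ.continuous.mul ((hfc k).comp (ξ.continuous.comp (hT l).continuous))
      · have hnn : 0 ≤ χ x * f k (ξ (T l x)) := mul_nonneg (hχ01 x).1 (hf0 _ _)
        rw [norm_mul, Real.norm_of_nonneg hnn, mul_comm]
        by_cases hx : x ∈ tsupport χ
        · exact mul_le_mul_of_nonneg_right (hdet l x hx) hnn
        · simp [image_eq_zero_of_notMem_tsupport hx]
    rw [h2] at h1
    have h5 : C1 * (c * (2 ^ j) ^ s) ^ n * (e' + η k) =
        C1 * c ^ n * (2 ^ j) ^ (s * n) * (e' + η k) := by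
      rw [mul_pow, ← pow_mul (2 ^ j : ℝ) s n]; simp only [mul_assoc]
    rw [h5] at h1
    have h6 : a * |∫ x, χ x * (fderiv ℝ (T j) x).det ∂μ| =
        |a * ∫ x, χ x * (fderiv ℝ (T j) x).det ∂μ| := by rw [abs_mul, abs_of_nonneg ha]
    rw [h6]
    rw [abs_le] at h1 h3 h4 ⊢
    constructor <;> linarith [h1.1, h1.2, h3.1, h3.2, h4.1, h4.2]
  have hχi : Integrable χ μ := hχ.continuous.integrable_of_hasCompactSupport hχs
  have hbound : ∀ k y x, ‖χ x * f k y‖ ≤ χ x := fun k y x => by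
    rw [norm_mul, Real.norm_of_nonneg (hχ01 x).1, Real.norm_of_nonneg (hf0 k y)]
    exact mul_le_of_le_one_right (hχ01 x).1 (hf1 k y)
  have hmeas : ∀ k l, AEStronglyMeasurable (fun x => χ x * f k (ξ (T l x))) μ := fun k l =>
    (hχ.continuous.mul ((hfc k).comp
      (ξ.continuous.comp (hT l).continuous))).aestronglyMeasurable
  have hptl : ∀ k x, Tendsto (fun l => χ x * f k (ξ (T l x))) atTop (𝓝 (χ x * f k (ξ (T' x)))) :=
    fun k x => by
      by_cases hx : x ∈ tsupport χ
      · exact (((hfc k).comp ξ.continuous).tendsto _ |>.comp (hlim x hx)).const_mul _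
      · simp [image_eq_zero_of_notMem_tsupport hx]
  -- The limit in `l` comes first, with `f k` fixed and continuous; the limit in `k` follows.
  have hle_limit : ∀ k, a * |∫ x, χ x * (fderiv ℝ (T j) x).det ∂μ| ≤
      C * (∫ x, χ x * f k (ξ (T' x)) ∂μ) + 2 * C * (1 / 2) ^ j +
        C1 * c ^ n * (2 ^ j) ^ (s * n) * (e' + η k) := fun k => by
    have hl := tendsto_integral_of_dominated_convergence χ (hmeas k) hχi
      (fun l => Eventually.of_forall fun x => hbound k _ x) (Eventually.of_forall (hptl k))
    refine ge_of_tendsto (((hl.const_mul C).add_const _).add_const _) ?_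
    filter_upwards [eventually_ge_atTop j] with l hl using hle_approx k l hl
  have hmeas' : ∀ k, AEStronglyMeasurable (fun x => χ x * f k (ξ (T' x))) μ := fun k =>
    aestronglyMeasurable_of_tendsto_ae atTop (hmeas k) (Eventually.of_forall (hptl k))
  have hlim2 := tendsto_integral_of_dominated_convergence χ hmeas' hχi
      (fun k => Eventually.of_forall fun x => hbound k _ x)
      (Eventually.of_forall fun x => (hflim (ξ (T' x))).const_mul (χ x))
  have hle_indicator : a * |∫ x, χ x * (fderiv ℝ (T j) x).det ∂μ| ≤
      C * (∫ x, χ x * A.indicator 1 (ξ (T' x)) ∂μ) + 2 * C * (1 / 2) ^ j +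
        C1 * c ^ n * (2 ^ j) ^ (s * n) * (e' + 0) :=
    ge_of_tendsto' (((hlim2.const_mul C).add_const _).add ((hη.const_add e').const_mul _)) hle_limit
  set S := {x ∈ tsupport χ | ξ (T' x) ∈ A}
  have hS : IsClosed S := (ξ.continuous.comp_continuousOn hT').preimage_isClosed_of_isClosed
    (isClosed_tsupport χ) hA
  have hSfin : μ S < ⊤ := (measure_mono (sep_subset _ _)).trans_lt hχs.measure_lt_top
  have hfinal : ∫ x, χ x * A.indicator 1 (ξ (T' x)) ∂μ ≤ μ.real S := by
    rw [← integral_indicator_one hS.measurableSet]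
    refine integral_mono_of_nonneg (Eventually.of_forall fun x => ?_)
      ((integrable_indicator_iff hS.measurableSet).mpr (integrableOn_const hSfin.ne))
      (Eventually.of_forall fun x => ?_)
    · exact mul_nonneg (hχ01 x).1 (indicator_nonneg (fun _ _ => zero_le_one) _)
    · by_cases hx : x ∈ tsupport χ
      · by_cases hxA : ξ (T' x) ∈ A
        · have : x ∈ S := ⟨hx, hxA⟩
          simp [hxA, this, (hχ01 x).2]
        · simp only [indicator_of_notMem hxA, mul_zero]
          exact indicator_nonneg (fun _ _ => zero_le_one) _
      · simp only [image_eq_zero_of_notMem_tsupport hx, zero_mul]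
        exact indicator_nonneg (fun _ _ => zero_le_one) _
  set M := max (2 * C) (C1 * c ^ n)
  have hM1 : 2 * C ≤ M := le_max_left _ _
  have hM2 : C1 * c ^ n ≤ M := le_max_right _ _
  calc _ ≤ C * μ.real S + 2 * C * (1 / 2) ^ j + C1 * c ^ n * (2 ^ j) ^ (s * n) * (e' + 0) :=
        hle_indicator.trans (by gcongr)
    _ ≤ M * μ.real S + M * (1 / 2) ^ j + M * (2 ^ j) ^ (s * n) * (e' + 0) := by
        gcongr
        linarith
    _ = _ := by ring

end LowerBound

/-! ### The lower bound for intrinsic Lipschitz graphs -/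

namespace CarnotGroup

variable {G : Type*} [NormedAddCommGroup G] [NormedSpace ℝ G] [FiniteDimensional ℝ G] [Group G]
  [CarnotGroup G]

namespace Decomposition

variable {D : Decomposition G}

/-- The right side of the Lipschitz inequality is continuous in `m'` and vanishes at `m' = m`,
because `(Φ m)⁻¹` moves `m` to the origin of `M`. -/
theorem continuousOn_of_intrinsicLipschitz (ν : HomogeneousNorm G) {K : Set D.subM}
    {Φ : D.subM → G} (h1 : ∀ m ∈ K, D.pr (Φ m) = m) {Λ : ℝ}
    (h2 : ∀ m ∈ K, ∀ m' ∈ K, ν ((Φ m)⁻¹ * Φ m') ≤ Λ * ν (D.pr ((Φ m)⁻¹ * m'))) :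
    ContinuousOn Φ K := by
  intro m hm
  rw [ContinuousWithinAt, ν.nhds_eq_comap, tendsto_comap_iff]
  have hc : Continuous fun m' : D.subM => Λ * ν (D.act (Φ m)⁻¹ m') :=
    continuous_const.mul (ν.continuous'.comp
      (continuous_subtype_val.comp (D.contDiff_act (Φ m)⁻¹).continuous))
  have hlim := (hc.tendsto m).mono_left (nhdsWithin_le_nhds (s := K))
  rw [act_inv_eq_zero (h1 m hm), Submodule.coe_zero, ν.map_zero', mul_zero] at hlim
  refine squeeze_zero' (Eventually.of_forall fun _ => ν.nonneg' _) ?_ hlim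
  filter_upwards [self_mem_nhdsWithin] with m' hm' using h2 m hm m' hm'

theorem tendsto_of_isApproximation {K : Set D.subM} {Φ : D.subM → G}
    (h1 : ∀ m ∈ K, D.pr (Φ m) = m) {C : ℝ} {ε : ℕ → ℝ} {Ψ : ℕ → D.subM → G} (hε : ∀ j, 0 < ε j)
    (hε1 : ∀ j, ε j ≤ 1) (hε0 : Tendsto ε atTop (𝓝 0))
    (h : ∀ j, D.IsApproximation K Φ C (ε j) (Ψ j)) {m : D.subM} (hm : m ∈ K) :
    Tendsto (fun j => Ψ j m) atTop (𝓝 (Φ m)) := by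
  have hex : ∀ j, ∃ y : G, ‖y‖ ≤ C ∧ Ψ j m = Φ m * dil (ε j) y := fun j => by
    obtain ⟨F, -, hF0, -, hF⟩ := (h j).exists_eq (hε j) hm
    refine ⟨F 0, hF0, ?_⟩
    rw [hF m, act_inv_eq_zero (h1 m hm), map_zero]
  choose y hy hΨ using hex
  obtain ⟨C1, hC1, hdil⟩ := exists_norm_dil_le (G := G)
  have hz : Tendsto (fun j => dil (ε j) (y j)) atTop (𝓝 0) := by
    have hb : Tendsto (fun j => C1 * ε j * C) atTop (𝓝 0) := by
      simpa using (hε0.const_mul C1).mul_const C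
    refine squeeze_zero_norm (fun j => ?_) hb
    refine ((dil (ε j)).le_opNorm _).trans ?_
    exact mul_le_mul (hdil _ (hε j).le (hε1 j)) (hy j) (norm_nonneg _)
      (mul_nonneg hC1.le (hε j).le)
  have := (tendsto_const_nhds (x := Φ m)).mul hz
  rw [mul_zero_coord] at this
  simp only [hΨ]
  exact this

variable [MeasurableSpace G] [BorelSpace G] (μ : Measure D.subM) [μ.IsAddHaarMeasure]

/-- The abstract criterion for `T j = P_M ∘ κ ∘ Ψ j`: the Jacobians are bounded, the derivatives
grow like a power of `2 ^ j`, and consecutive maps are joined by homotopies of cost `O(2 ^ (-j))`.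
-/
theorem exists_lower_bound_of_isApproximation {K : Set D.subM} {Φ : D.subM → G}
    (hK : IsCompact K) (hΦ : ContinuousOn Φ K) (h1 : ∀ m ∈ K, D.pr (Φ m) = m) {κ : G →L[ℝ] G}
    (hκ : IsGradedHom κ) {C₀ : ℝ} {Ψ : ℕ → D.subM → G}
    (hΨ : ∀ j, D.IsApproximation K Φ C₀ ((1 / 2) ^ j) (Ψ j)) {χ : D.subM → ℝ}
    (hχ : ContDiff ℝ 1 χ) (hχs : HasCompactSupport χ) (hχ01 : ∀ x, χ x ∈ Icc (0 : ℝ) 1)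
    (hχK : tsupport χ ⊆ K) {ξ : D.subM →L[ℝ] ℝ} {e : D.subM} (he : ξ e = 1) :
    ∃ (C' R : ℝ) (N : ℕ), 0 < C' ∧ ∀ (j : ℕ) (A : Set ℝ) (a e : ℝ), IsClosed A → 0 ≤ a → 0 ≤ e →
      (∀ x, |x| ≤ R → |∫ t in (0 : ℝ)..x, (A.indicator 1 t - a)| ≤ e) →
      a * |∫ x, χ x * (fderiv ℝ (fun m => D.pr (κ (Ψ j m))) x).det ∂μ| ≤
        C' * (μ.real {x ∈ tsupport χ | ξ (D.pr (κ (Φ x))) ∈ A} + (1 / 2) ^ j +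
          (2 ^ j) ^ N * e) := by
  have hε : ∀ j : ℕ, (0 : ℝ) < (1 / 2) ^ j := fun j => by positivity
  have hε1 : ∀ j : ℕ, (1 / 2 : ℝ) ^ j ≤ 1 := fun j => pow_le_one₀ (by norm_num) (by norm_num)
  obtain ⟨C1, s, hC1, hb⟩ := exists_bounds_of_isApproximation hK hΦ h1 hκ C₀
  obtain ⟨C2, hC2, hh⟩ := exists_homotopy_bound hK hΦ h1 hκ C₀ hχ
  have hT : ∀ j, ContDiff ℝ ∞ fun m => D.pr (κ (Ψ j m)) := fun j =>
    (contDiff_pr_gradedHom κ).comp (hΨ j).contDiff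
  set C : ℝ := max C1 (C2 * μ.real (tsupport χ))
  have hCC : C1 ≤ C := le_max_left _ _
  refine exists_lower_bound_of_approximation μ hχ hχs hχ01 he (s := s) (C := C)
    (lt_of_lt_of_le hC1 hCC) (fun j => (hT j).of_le (by simp))
    (T' := fun m => D.pr (κ (Φ m))) ?_ (fun j x hx => ?_) (fun j x hx => ?_) (fun j x hx => ?_)
    (fun j ψ hψ hψ1 => ?_) (fun x hx => ?_)
  · exact ((contDiff_pr_gradedHom κ).continuous.comp_continuousOn hΦ).mono hχK
  · exact (hb _ _ (hε j) (hε1 j) (hΨ j) x (hχK hx)).1.trans hCC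
  · refine (hb _ _ (hε j) (hε1 j) (hΨ j) x (hχK hx)).2.1.trans ?_
    have h2j : ((1 / 2 : ℝ) ^ j)⁻¹ = 2 ^ j := by rw [← inv_pow]; norm_num
    rw [h2j]
    gcongr
  · exact (hb _ _ (hε j) (hε1 j) (hΨ j) x (hχK hx)).2.2.trans hCC
  · have hpull : ContDiff ℝ ∞ (fun q : ℝ × D.subM =>
        D.pr (κ (pull (Ψ j q.2) (Ψ (j + 1) q.2) (Real.smoothTransition q.1)))) :=
      (contDiff_pr_gradedHom κ).comp (contDiff_pull.comp
        (((hΨ j).contDiff.comp contDiff_snd).prodMk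
          (((hΨ (j + 1)).contDiff.comp contDiff_snd).prodMk
            (Real.smoothTransition.contDiff.comp contDiff_fst))))
    have h2 : D.IsApproximation K Φ C₀ ((1 / 2) ^ j / 2) (Ψ (j + 1)) := by
      have := hΨ (j + 1)
      rwa [pow_succ, mul_one_div] at this
    have h3 := abs_integral_mul_det_sub_le μ (hpull.of_le (by simp))
      (T₀ := fun m => D.pr (κ (Ψ j m))) (T₁ := fun m => D.pr (κ (Ψ (j + 1) m)))
      (fun s hs x => by rw [Real.smoothTransition.zero_of_nonpos hs, pull_zero])
      (fun s hs x => by rw [Real.smoothTransition.one_of_one_le hs, pull_one])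
      hχ hχs he hψ hψ1 (fun s hs x hx => hh _ _ _ (hε j) (hε1 j) (hΨ j) h2 s hs x (hχK hx))
    refine h3.trans ?_
    calc C2 * (1 / 2) ^ j * μ.real (tsupport χ) = C2 * μ.real (tsupport χ) * (1 / 2) ^ j := by ring
      _ ≤ C * (1 / 2) ^ j := by
          gcongr
          exact le_max_right _ _
  · exact ((contDiff_pr_gradedHom κ).continuous.tendsto _).comp
      (tendsto_of_isApproximation h1 hε hε1
        (tendsto_pow_atTop_nhds_zero_of_lt_one (by norm_num) (by norm_num)) hΨ (hχK hx))

/-- An intrinsic Lipschitz graph meets the preimages of an evenly distributed closed set under one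
of the functions `ξ ∘ P_M ∘ κ i`, if the maps `κ i` reproduce the volume form. -/
theorem exists_index_lower_bound (ν : HomogeneousNorm G) {K : Set D.subM} (hK : IsCompact K)
    {Φ : D.subM → G} (h1 : ∀ m ∈ K, D.pr (Φ m) = m) {Λ : ℝ} (hΛ : 0 ≤ Λ)
    (h2 : ∀ m ∈ K, ∀ m' ∈ K, ν ((Φ m)⁻¹ * Φ m') ≤ Λ * ν (D.pr ((Φ m)⁻¹ * m')))
    {ι : Type*} (s : Finset ι) {κ : ι → G →L[ℝ] G} (hκ : ∀ i, IsGradedHom (κ i)) (c : ι → ℝ)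
    (hc : ∀ A : D.subM →L[ℝ] G, ∑ i ∈ s, c i * ((fderiv ℝ D.pr 0).comp ((κ i).comp A)).det =
      ((fderiv ℝ D.pr 0).comp A).det)
    {χ : D.subM → ℝ} (hχ : ContDiff ℝ 1 χ) (hχs : HasCompactSupport χ)
    (hχ01 : ∀ x, χ x ∈ Icc (0 : ℝ) 1) (hχK : tsupport χ ⊆ K) (hχ0 : 0 < ∫ x, χ x ∂μ)
    {ξ : D.subM →L[ℝ] ℝ} {e : D.subM} (he : ξ e = 1) :
    ∃ (C R c₀ : ℝ) (N : ℕ), 0 < C ∧ 0 < c₀ ∧ ∀ j : ℕ, ∃ i ∈ s, ∀ (A : Set ℝ) (a e : ℝ),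
      IsClosed A → 0 ≤ a → 0 ≤ e →
      (∀ x, |x| ≤ R → |∫ t in (0 : ℝ)..x, (A.indicator 1 t - a)| ≤ e) →
      c₀ * a ≤ C * (μ.real {x ∈ tsupport χ | ξ (D.pr (κ i (Φ x))) ∈ A} + (1 / 2) ^ j +
          (2 ^ j) ^ N * e) := by
  have hΦ := continuousOn_of_intrinsicLipschitz ν h1 h2
  obtain ⟨C₀, hC₀⟩ := D.exists_smooth_approximation ν hK h1 hΛ h2
  choose Ψ hΨ1 hΨ2 hΨ3 using fun j : ℕ => hC₀ ((1 / 2) ^ j) (by positivity)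
  have hΨ : ∀ j, D.IsApproximation K Φ C₀ ((1 / 2) ^ j) (Ψ j) := fun j => ⟨hΨ1 j, hΨ3 j⟩
  choose C R N hC hlow using fun i => exists_lower_bound_of_isApproximation μ hK hΦ h1 (hκ i) hΨ
    hχ hχs hχ01 hχK he
  set c₀ : ℝ := (∫ x, χ x ∂μ) / (1 + ∑ i ∈ s, |c i|)
  have hden : 0 < 1 + ∑ i ∈ s, |c i| := by positivity
  have hc₀ : 0 < c₀ := div_pos hχ0 hden
  have hCs : ∀ i ∈ s, C i ≤ 1 + ∑ i ∈ s, C i := fun i hi => by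
    have := Finset.single_le_sum (f := C) (fun i _ => (hC i).le) hi
    linarith
  have hCpos : 0 < 1 + ∑ i ∈ s, C i :=
    add_pos_of_pos_of_nonneg one_pos (Finset.sum_nonneg fun i _ => (hC i).le)
  refine ⟨1 + ∑ i ∈ s, C i, ∑ i ∈ s, |R i|, c₀, ∑ i ∈ s, N i, hCpos, hc₀, fun j => ?_⟩
  set J : ι → ℝ := fun i => ∫ x, χ x * (fderiv ℝ (fun m => D.pr (κ i (Ψ j m))) x).det ∂μ
  have hsum : ∑ i ∈ s, c i * J i = ∫ x, χ x ∂μ := by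
    have hint : ∀ i, Integrable
        (fun x => χ x * (fderiv ℝ (fun m => D.pr (κ i (Ψ j m))) x).det) μ := fun i => by
      refine Continuous.integrable_of_hasCompactSupport ?_ hχs.mul_right
      exact hχ.continuous.mul (ContinuousLinearMap.continuous_det.comp
        (((contDiff_pr_gradedHom (κ i)).comp (hΨ1 j)).continuous_fderiv (by simp)))
    simp only [J, ← integral_const_mul]
    rw [← integral_finsetSum _ fun i _ => (hint i).const_mul (c i)]
    congr 1
    funext x
    have := sum_det_fderiv_eq_one s hκ c hc (hΨ1 j) (hΨ2 j) x
    calc _ = χ x * ∑ i ∈ s, c i * (fderiv ℝ (fun m => D.pr (κ i (Ψ j m))) x).det := by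
          rw [Finset.mul_sum]
          exact Finset.sum_congr rfl fun i _ => by ring
      _ = χ x := by rw [this, mul_one]
  -- A fixed linear combination of the `J i` equals `∫ χ > 0`, so they cannot all be small. The
  -- index may depend on `j`.
  obtain ⟨i, hi, hJ⟩ : ∃ i ∈ s, c₀ ≤ |J i| := by
    by_contra! hcon
    have h3 : ∫ x, χ x ∂μ ≤ (∑ i ∈ s, |c i|) * c₀ := by
      rw [← hsum, Finset.sum_mul]
      refine Finset.sum_le_sum fun i hi => (le_abs_self _).trans ?_
      rw [abs_mul]
      exact mul_le_mul_of_nonneg_left (hcon i hi).le (abs_nonneg _)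
    have h4 : (∫ x, χ x ∂μ) = c₀ * (1 + ∑ i ∈ s, |c i|) := (div_mul_cancel₀ _ hden.ne').symm
    nlinarith
  refine ⟨i, hi, fun A a e' hA ha he' hd => ?_⟩
  have h3 := hlow i j A a e' hA ha he' fun x hx => hd x (hx.trans ((le_abs_self _).trans
    (Finset.single_le_sum (f := fun i => |R i|) (fun i _ => abs_nonneg _) hi)))
  calc c₀ * a ≤ a * |J i| := by rw [mul_comm]; gcongr
    _ ≤ _ := h3
    _ ≤ _ := by
        have h5 : N i ≤ ∑ i ∈ s, N i := Finset.single_le_sum (fun i _ => Nat.zero_le _) hi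
        have h6 : (1 : ℝ) ≤ 2 ^ j := one_le_pow₀ one_le_two
        gcongr
        exact hCs i hi

end Decomposition

end CarnotGroup

/-! ### Sparse evenly distributed sets of real numbers -/

section SparseSets

/-- The closed `δ r`-neighbourhood of `r ℤ`. -/
def slab (r δ : ℝ) : Set ℝ := {t | ‖((t / r : ℝ) : UnitAddCircle)‖ ≤ δ}

/-- The open `δ r`-neighbourhood of `r ℤ`. -/
def openSlab (r δ : ℝ) : Set ℝ := {t | ‖((t / r : ℝ) : UnitAddCircle)‖ < δ}

theorem continuous_norm_circle (r : ℝ) :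
    Continuous fun t : ℝ => ‖((t / r : ℝ) : UnitAddCircle)‖ :=
  continuous_norm.comp ((AddCircle.continuous_mk' 1).comp (continuous_id.div_const r))

theorem isClosed_slab (r δ : ℝ) : IsClosed (slab r δ) :=
  isClosed_le (continuous_norm_circle r) continuous_const

theorem isOpen_openSlab (r δ : ℝ) : IsOpen (openSlab r δ) :=
  isOpen_lt (continuous_norm_circle r) continuous_const

theorem openSlab_subset_slab (r δ : ℝ) : openSlab r δ ⊆ slab r δ :=
  fun _ ht => (show ‖_‖ < δ from ht).le

theorem slab_subset_openSlab (r : ℝ) {δ δ' : ℝ} (h : δ < δ') : slab r δ ⊆ openSlab r δ' :=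
  fun _ ht => lt_of_le_of_lt ht h

theorem intervalIntegrable_indicator_sub {A : Set ℝ} (hA : MeasurableSet A) (a x y : ℝ) :
    IntervalIntegrable (fun t => A.indicator 1 t - a) volume x y := by
  rw [intervalIntegrable_iff]
  refine Integrable.mono' (g := fun _ => 1 + |a|) (integrableOn_const (by simp))
    ((measurable_one.indicator hA).sub_const _).aestronglyMeasurable
    (Eventually.of_forall fun t => (norm_sub_le _ _).trans (add_le_add ?_ le_rfl))
  by_cases ht : t ∈ A <;> simp [ht]

/-- The integrand has period one and mean zero, so whole periods drop out and a piece of length less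
than one remains. -/
theorem abs_integral_slab_one_le {δ : ℝ} (h0 : 0 ≤ δ) (h1 : 2 * δ ≤ 1) (y : ℝ) :
    |∫ t in (0 : ℝ)..y, ((slab 1 δ).indicator 1 t - 2 * δ)| ≤ 1 := by
  have hm := (isClosed_slab 1 δ).measurableSet
  set h : ℝ → ℝ := fun t => (slab 1 δ).indicator 1 t - 2 * δ
  have hh : h = fun t : ℝ => (fun b : UnitAddCircle =>
      (Metric.closedBall (0 : UnitAddCircle) δ).indicator (1 : UnitAddCircle → ℝ) b - 2 * δ)
        (t : UnitAddCircle) := by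
    funext t
    simp only [h, slab, div_one]
    congr 1
    by_cases ht : ‖(t : UnitAddCircle)‖ ≤ δ
    · rw [indicator_of_mem (show t ∈ {t : ℝ | ‖(t : UnitAddCircle)‖ ≤ δ} from ht),
        indicator_of_mem (by simpa using ht)]; rfl
    · rw [indicator_of_notMem (show t ∉ {t : ℝ | ‖(t : UnitAddCircle)‖ ≤ δ} from ht),
        indicator_of_notMem (by simpa using ht)]
  have hper : Function.Periodic h 1 := by
    rw [hh]
    intro t
    simp
  have hint : ∀ x y, IntervalIntegrable h volume x y := fun x y =>
    intervalIntegrable_indicator_sub hm _ x y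
  have hmean : ∀ t : ℝ, ∫ x in t..t + 1, h x = 0 := fun t => by
    have h2 := UnitAddCircle.intervalIntegral_preimage t (fun b : UnitAddCircle =>
      (Metric.closedBall (0 : UnitAddCircle) δ).indicator (1 : UnitAddCircle → ℝ) b - 2 * δ)
    rw [hh, h2, integral_sub, integral_indicator_one Metric.isClosed_closedBall.measurableSet,
      measureReal_def, AddCircle.volume_closedBall, min_eq_right h1,
      ENNReal.toReal_ofReal (by linarith)]
    · simp [measureReal_def]
    · exact (integrable_indicator_iff Metric.isClosed_closedBall.measurableSet).mpr
        (integrableOn_const (measure_ne_top _ _))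
    · exact integrable_const _
  have hy : y = Int.fract y + ⌊y⌋ • (1 : ℝ) := by
    simp [Int.fract_add_floor]
  have hsplit : ∫ t in (0 : ℝ)..y, h t = ∫ t in (0 : ℝ)..Int.fract y, h t := by
    conv_lhs => rw [hy]
    rw [← intervalIntegral.integral_add_adjacent_intervals (hint 0 (Int.fract y)) (hint _ _),
      hper.intervalIntegral_add_zsmul_eq ⌊y⌋ (Int.fract y) hint, hmean, smul_zero, add_zero]
  rw [hsplit, ← Real.norm_eq_abs]
  have hb : ∀ t, ‖h t‖ ≤ 1 := fun t => by
    simp only [h]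
    rw [Real.norm_eq_abs, abs_le]
    by_cases ht : t ∈ slab 1 δ
    · rw [indicator_of_mem ht]; constructor <;> simp <;> linarith
    · rw [indicator_of_notMem ht]; constructor <;> linarith
  refine (intervalIntegral.norm_integral_le_of_norm_le_const fun t _ => hb t).trans ?_
  rw [sub_zero, one_mul, abs_of_nonneg (Int.fract_nonneg y)]
  exact (Int.fract_lt_one y).le

theorem abs_integral_slab_le {r δ : ℝ} (hr : 0 < r) (h0 : 0 ≤ δ) (h1 : 2 * δ ≤ 1) (x : ℝ) :
    |∫ t in (0 : ℝ)..x, ((slab r δ).indicator 1 t - 2 * δ)| ≤ r := by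
  have h2 : ∀ t, ((slab r δ).indicator 1 t - 2 * δ : ℝ) =
      (fun u => (slab 1 δ).indicator 1 u - 2 * δ) (t / r) := fun t => by
    by_cases ht : t ∈ slab r δ
    · have : t / r ∈ slab 1 δ := by simpa [slab] using ht
      simp [ht, this]
    · have : t / r ∉ slab 1 δ := by simpa [slab] using ht
      simp [ht, this]
  simp only [h2]
  rw [intervalIntegral.integral_comp_div (fun u => (slab 1 δ).indicator 1 u - 2 * δ) hr.ne',
    zero_div, smul_eq_mul, abs_mul, abs_of_pos hr]
  exact mul_le_of_le_one_right hr.le (abs_integral_slab_one_le h0 h1 _)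

/-- The primitive of the indicator differs from `2 * δ * x` by at most `r` at each of the two
endpoints. -/
theorem volume_slab_inter_le {r δ R : ℝ} (hr : 0 < r) (h0 : 0 ≤ δ) (h1 : 2 * δ ≤ 1) (hR : 0 ≤ R) :
    volume (slab r δ ∩ Icc (-R) R) ≤ ENNReal.ofReal (4 * δ * R + 2 * r) := by
  have hm := (isClosed_slab r δ).measurableSet
  have hi : ∀ x y, IntervalIntegrable (fun t => (slab r δ).indicator (1 : ℝ → ℝ) t) volume x y :=
    fun x y => by simpa using intervalIntegrable_indicator_sub hm 0 x y
  have hx : ∀ x, ∫ t in (0 : ℝ)..x, ((slab r δ).indicator 1 t - 2 * δ) =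
      (∫ t in (0 : ℝ)..x, (slab r δ).indicator 1 t) - x * (2 * δ) := fun x => by
    rw [intervalIntegral.integral_sub (hi _ _) intervalIntegrable_const]
    simp only [intervalIntegral.integral_const, sub_zero, smul_eq_mul]
  have e1 := abs_integral_slab_le hr h0 h1 R
  have e2 := abs_integral_slab_le hr h0 h1 (-R)
  rw [hx, abs_le] at e1 e2
  have e3 := intervalIntegral.integral_add_adjacent_intervals (hi (-R) 0) (hi 0 R)
  rw [intervalIntegral.integral_symm] at e3
  have e4 : ∫ t in (-R)..R, (slab r δ).indicator (1 : ℝ → ℝ) t =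
      volume.real (slab r δ ∩ Icc (-R) R) := by
    rw [intervalIntegral.integral_of_le (by linarith), ← integral_Icc_eq_integral_Ioc,
      integral_indicator_one hm, measureReal_restrict_apply hm]
  have hfin : volume (slab r δ ∩ Icc (-R) R) ≠ ⊤ :=
    ((measure_mono inter_subset_right).trans_lt (by simp)).ne
  rw [← ENNReal.ofReal_toReal hfin]
  refine ENNReal.ofReal_le_ofReal ?_
  rw [measureReal_def] at e4
  rw [← e4]
  linarith [e1.1, e1.2, e2.1, e2.2]

/-- Disjoint closed sets `K n` of density `(1 / 2) ^ (n! + 1)`, distributed evenly up to a tiny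
error. -/
theorem exists_sparse_sets : ∃ K : ℕ → Set ℝ, (∀ n, IsClosed (K n)) ∧
    Pairwise (Function.onFun Disjoint K) ∧
    (∀ R : ℝ, 0 ≤ R → ∃ C : ℝ≥0, ∀ n,
      volume (K n ∩ Icc (-R) R) ≤ ENNReal.ofNNReal (C * (1 / 2) ^ n.factorial)) ∧
    ∀ R : ℝ, 0 ≤ R → ∃ C : ℝ, 0 ≤ C ∧ ∀ (n : ℕ) (x : ℝ), |x| ≤ R →
      |∫ t in (0 : ℝ)..x, ((K n).indicator 1 t - (1 / 2) ^ n.factorial / 2)| ≤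
        C * (1 / 2) ^ (n + 1).factorial := by
  set d : ℕ → ℝ := fun n => (1 / 2) ^ n.factorial
  have hd0 : ∀ n, 0 < d n := fun n => by positivity
  have hd1 : ∀ n, d n ≤ 1 := fun n => pow_le_one₀ (by norm_num) (by norm_num)
  have hdmono : ∀ n, d (n + 1) ≤ d n := fun n =>
    pow_le_pow_of_le_one (by norm_num) (by norm_num) (Nat.factorial_le (Nat.le_succ n))
  -- `B n` has period `d (n + 1)` and density `d n / 2`; the open set `A n` is twice as thick and
  -- contains it. Deleting all later `A l` from `B n` makes the sets disjoint and keeps them closed,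
  -- at a loss of volume of order `d (n + 1)` on bounded intervals.
  set B : ℕ → Set ℝ := fun n => slab (d (n + 1)) (d n / 4)
  set A : ℕ → Set ℝ := fun n => openSlab (d (n + 1)) (d n / 2)
  have hBA : ∀ n, B n ⊆ A n := fun n => slab_subset_openSlab _ (by linarith [hd0 n])
  have hvol : ∀ (δ R : ℝ) (n : ℕ), 0 ≤ δ → δ ≤ d n / 2 → 0 ≤ R →
      volume (slab (d (n + 1)) δ ∩ Icc (-R) R) ≤ ENNReal.ofReal ((2 * R + 2) * d n) :=
    fun δ R n h0 h1 hR => by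
      refine (volume_slab_inter_le (hd0 (n + 1)) h0 (by linarith [hd1 n]) hR).trans
        (ENNReal.ofReal_le_ofReal ?_)
      nlinarith [hdmono n, hd0 n]
  have htail : ∀ R : ℝ, 0 ≤ R → ∀ n, volume ((⋃ l > n, A l) ∩ Icc (-R) R) ≤
      ENNReal.ofReal ((2 * R + 2) * (2 * d (n + 1))) := fun R hR n => by
    have hsub : (⋃ l > n, A l) ∩ Icc (-R) R ⊆
        ⋃ k : ℕ, (slab (d (n + 1 + k + 1)) (d (n + 1 + k) / 2) ∩ Icc (-R) R) := by
      rintro t ⟨ht, htR⟩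
      rw [mem_iUnion₂] at ht
      obtain ⟨l, hl, ht⟩ := ht
      obtain ⟨k, rfl⟩ := Nat.exists_eq_add_of_le (Nat.succ_le_of_lt hl)
      exact mem_iUnion.mpr ⟨k, openSlab_subset_slab _ _ ht, htR⟩
    refine (measure_mono hsub).trans ((measure_iUnion_le _).trans ?_)
    -- Factorials of positive integers increase by at least one at each step, which already gives a
    -- geometric tail.
    have hgeo : ∀ k, d (n + 1 + k) ≤ d (n + 1) * (1 / 2) ^ k := fun k => by
      simp only [d]
      rw [← pow_add]
      refine pow_le_pow_of_le_one (by norm_num) (by norm_num) ?_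
      induction k with
      | zero => simp
      | succ k ih =>
        rw [show n + 1 + (k + 1) = n + 1 + k + 1 from rfl, Nat.factorial_succ (n + 1 + k)]
        have := Nat.factorial_pos (n + 1 + k)
        nlinarith
    have hterm : ∀ k, volume (slab (d (n + 1 + k + 1)) (d (n + 1 + k) / 2) ∩ Icc (-R) R) ≤
        ENNReal.ofReal ((2 * R + 2) * d (n + 1) * (1 / 2) ^ k) := fun k => by
      refine (hvol _ R (n + 1 + k) (by linarith [hd0 (n + 1 + k)]) le_rfl hR).trans
        (ENNReal.ofReal_le_ofReal ?_)
      rw [mul_assoc]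
      exact mul_le_mul_of_nonneg_left (hgeo k) (by linarith)
    refine (ENNReal.tsum_le_tsum hterm).trans ?_
    have hdn := hd0 (n + 1)
    rw [← ENNReal.ofReal_tsum_of_nonneg (fun k => by positivity)
      (summable_geometric_two.mul_left _), tsum_mul_left, tsum_geometric_two]
    exact ENNReal.ofReal_le_ofReal (by linarith)
  have hKc : ∀ n, IsClosed (B n \ ⋃ l > n, A l) := fun n =>
    (isClosed_slab _ _).sdiff (isOpen_biUnion fun l _ => isOpen_openSlab _ _)
  refine ⟨fun n => B n \ ⋃ l > n, A l, hKc, ?_, fun R hR => ?_, fun R hR => ?_⟩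
  · have key : ∀ m n, m < n → Disjoint (B m \ ⋃ l > m, A l) (B n \ ⋃ l > n, A l) := by
      intro m n hmn
      rw [Set.disjoint_left]
      intro t ht ht'
      exact ht.2 (mem_iUnion₂.mpr ⟨n, hmn, hBA n ht'.1⟩)
    intro m n hmn
    rcases lt_or_gt_of_ne hmn with h | h
    · exact key m n h
    · exact (key n m h).symm
  · refine ⟨(2 * R + 2).toNNReal, fun n => ?_⟩
    refine (measure_mono (inter_subset_inter_left _ sdiff_subset)).trans
      ((hvol _ R n (by linarith [hd0 n]) (by linarith [hd0 n]) hR).trans (le_of_eq ?_))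
    rw [ENNReal.ofReal, ENNReal.coe_inj]
    refine NNReal.eq ?_
    rw [Real.coe_toNNReal _ (by have := hd0 n; positivity)]
    rw [NNReal.coe_mul, Real.coe_toNNReal _ (by linarith)]
    simp [d]
  · refine ⟨1 + (2 * R + 2) * 2, by linarith, fun n x hx => ?_⟩
    have hBm : MeasurableSet (B n) := (isClosed_slab _ _).measurableSet
    have hKm := (hKc n).measurableSet
    set K := B n \ ⋃ l > n, A l
    have h1 := abs_integral_slab_le (hd0 (n + 1)) (δ := d n / 4) (by linarith [hd0 n])
      (by linarith [hd1 n]) x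
    -- The error is the discrepancy of the slab, at most one period `d (n + 1)`, plus the deleted
    -- volume.
    have h2 : (fun t => K.indicator (1 : ℝ → ℝ) t - d n / 2) = fun t =>
        ((B n).indicator 1 t - 2 * (d n / 4)) - ((B n \ K).indicator 1 t - 0) := by
      funext t
      by_cases ht : t ∈ B n
      · by_cases htK : t ∈ K
        · have : t ∉ B n \ K := fun h => h.2 htK
          simp only [indicator_of_mem ht, indicator_of_mem htK, indicator_of_notMem this]
          ring
        · have : t ∈ B n \ K := ⟨ht, htK⟩
          simp only [indicator_of_mem ht, indicator_of_notMem htK, indicator_of_mem this]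
          ring
      · have htK : t ∉ K := fun h => ht h.1
        have : t ∉ B n \ K := fun h => ht h.1
        simp only [indicator_of_notMem ht, indicator_of_notMem htK, indicator_of_notMem this]
        ring
    rw [h2, intervalIntegral.integral_sub (intervalIntegrable_indicator_sub hBm _ _ _)
      (intervalIntegrable_indicator_sub (hBm.diff hKm) _ _ _)]
    have h3 : |∫ t in (0 : ℝ)..x, ((B n \ K).indicator (1 : ℝ → ℝ) t - 0)| ≤
        (2 * R + 2) * (2 * d (n + 1)) := by
      simp only [sub_zero]
      rw [← Real.norm_eq_abs]
      refine (intervalIntegral.norm_integral_le_integral_norm_uIoc).trans ?_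
      have hsub : (B n \ K) ∩ uIoc 0 x ⊆ (⋃ l > n, A l) ∩ Icc (-R) R := by
        rintro t ⟨⟨ht1, ht2⟩, htx⟩
        refine ⟨by_contra fun h => ht2 ⟨ht1, h⟩, ?_⟩
        have := uIoc_subset_uIcc htx
        rw [abs_le] at hx
        rw [mem_uIcc] at this
        constructor <;> rcases this with h | h <;> linarith [hx.1, hx.2, h.1, h.2]
      have h4 : ∀ t, ‖(B n \ K).indicator (1 : ℝ → ℝ) t‖ = (B n \ K).indicator (1 : ℝ → ℝ) t :=
        fun t => Real.norm_of_nonneg (indicator_nonneg (fun _ _ => zero_le_one) _)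
      simp only [h4]
      rw [integral_indicator_one (hBm.diff hKm), measureReal_restrict_apply (hBm.diff hKm),
        measureReal_def]
      refine ENNReal.toReal_le_of_le_ofReal (by have := hd0 (n + 1); positivity) ?_
      exact (measure_mono hsub).trans (htail R hR n)
    refine (abs_sub _ _).trans ?_
    have h5 : (1 / 2 : ℝ) ^ (n + 1).factorial = d (n + 1) := rfl
    rw [h5]
    linarith

end SparseSets

/-! ### Vanishing of the module -/

section Module

variable {X : Type*} [MeasurableSpace X] {m : Measure X} {p : ℝ}

theorem pModule_mono {E F : Set (Measure X)} (h : E ⊆ F) : pModule m p E ≤ pModule m p F :=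
  le_iInf fun f => le_iInf fun hf => le_iInf fun hF =>
    iInf_le_of_le f (iInf_le_of_le hf (iInf_le_of_le (fun μ hμ => hF μ (h hμ)) le_rfl))

theorem pModule_empty (hp : 0 < p) : pModule m p ∅ = 0 := by
  refine le_antisymm ?_ zero_le
  refine iInf_le_of_le 0 (iInf_le_of_le measurable_zero (iInf_le_of_le (by simp) ?_))
  simp [ENNReal.zero_rpow_of_pos hp]

/-- The maximum of two admissible functions is admissible for the union, and its `p`-th power is
bounded by the sum of the `p`-th powers for every `p`. -/
theorem pModule_union_le (E F : Set (Measure X)) :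
    pModule m p (E ∪ F) ≤ pModule m p E + pModule m p F := by
  simp only [pModule, ENNReal.iInf_add, ENNReal.add_iInf]
  refine le_iInf fun g => le_iInf fun hg => le_iInf fun hF => le_iInf fun f => le_iInf fun hf =>
    le_iInf fun hE => ?_
  refine iInf_le_of_le (fun x => max (f x) (g x)) (iInf_le_of_le (hf.max hg)
    (iInf_le_of_le ?_ ?_))
  · rintro μ (hμ | hμ)
    · exact (hE μ hμ).trans (lintegral_mono fun x => ENNReal.coe_le_coe.mpr (le_max_left _ _))
    · exact (hF μ hμ).trans (lintegral_mono fun x => ENNReal.coe_le_coe.mpr (le_max_right _ _))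
  · rw [← lintegral_add_left (by fun_prop)]
    refine lintegral_mono fun x => ?_
    rcases le_total (f x) (g x) with h | h
    · simp only [max_eq_right h]; exact le_add_self
    · simp only [max_eq_left h]; exact le_self_add

theorem pModule_biUnion_eq_zero (hp : 0 < p) {ι : Type*} (s : Finset ι) (E : ι → Set (Measure X))
    (h : ∀ i ∈ s, pModule m p (E i) = 0) : pModule m p (⋃ i ∈ s, E i) = 0 := by
  classical
  induction s using Finset.induction_on with
  | empty => simpa using pModule_empty hp
  | insert i s hi ih =>
    rw [Finset.set_biUnion_insert]
    refine le_antisymm ((pModule_union_le _ _).trans ?_) zero_le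
    rw [h i (Finset.mem_insert_self _ _), ih fun j hj => h j (Finset.mem_insert_of_mem hj)]
    simp

/-- A function with locally finite `p`-integral and infinite integral for each measure of a family
shows that the module of the family vanishes. -/
theorem pModule_eq_zero_of_infinite (hp : 0 < p) {E : Set (Measure X)} {N : X → ℕ}
    (hN : Measurable N) {h : X → ℝ≥0} (hh : Measurable h)
    (hfin : ∀ k, ∫⁻ x in N ⁻¹' Iic k, (h x : ℝ≥0∞) ^ p ∂m ≠ ⊤)
    (hinf : ∀ σ ∈ E, ∃ k, ∫⁻ x in N ⁻¹' Iic k, (h x : ℝ≥0∞) ∂σ = ⊤) : pModule m p E = 0 := by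
  refine le_antisymm (le_of_forall_pos_le_add fun ε hε => ?_) zero_le
  rw [zero_add]
  obtain ⟨ε', hε', hsum⟩ := ENNReal.exists_pos_sum_of_countable hε.ne' ℕ
  set I : ℕ → ℝ≥0 := fun k => (∫⁻ x in N ⁻¹' Iic k, (h x : ℝ≥0∞) ^ p ∂m).toNNReal
  -- Chosen so that the damped function has `p`-integral at most `ε' k` on the shell `N = k`; the
  -- summand `1` avoids a zero denominator.
  set δ : ℕ → ℝ≥0 := fun k => (ε' k / (1 + I k)) ^ (1 / p)
  have hNk : ∀ k, MeasurableSet (N ⁻¹' Iic k) := fun k => hN measurableSet_Iic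
  have hδ : ∀ k, 0 < δ k := fun k => NNReal.rpow_pos (div_pos (hε' k) (by positivity))
  have hδp : ∀ k, δ k ^ p = ε' k / (1 + I k) := fun k => by
    simp only [δ]
    rw [← NNReal.rpow_mul, one_div_mul_cancel hp.ne', NNReal.rpow_one]
  have hf : Measurable fun x => δ (N x) * h x :=
    ((measurable_from_nat (f := δ)).comp hN).mul hh
  refine iInf_le_of_le (fun x => δ (N x) * h x) (iInf_le_of_le hf (iInf_le_of_le ?_ ?_))
  · intro σ hσ
    obtain ⟨k, hk⟩ := hinf σ hσ
    -- On `N ≤ k` only finitely many damping constants occur, so an infinite integral there stays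
    -- infinite.
    obtain ⟨δ', hδ'0, hδ'⟩ : ∃ δ' : ℝ≥0, 0 < δ' ∧ ∀ j ≤ k, δ' ≤ δ j :=
      ⟨(Finset.range (k + 1)).inf' (by simp) δ, (Finset.lt_inf'_iff _).mpr fun j _ => hδ j,
        fun j hj => Finset.inf'_le _ (Finset.mem_range.mpr (Nat.lt_succ_of_le hj))⟩
    have : ∫⁻ x in N ⁻¹' Iic k, ((δ (N x) * h x : ℝ≥0) : ℝ≥0∞) ∂σ = ⊤ := by
      refine top_unique ?_
      calc (⊤ : ℝ≥0∞) = (δ' : ℝ≥0∞) * ∫⁻ x in N ⁻¹' Iic k, (h x : ℝ≥0∞) ∂σ := by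
            rw [hk, ENNReal.mul_top (by simpa using hδ'0.ne')]
        _ = ∫⁻ x in N ⁻¹' Iic k, (δ' : ℝ≥0∞) * (h x : ℝ≥0∞) ∂σ :=
            (lintegral_const_mul _ hh.coe_nnreal_ennreal).symm
        _ ≤ _ := by
            refine setLIntegral_mono' (hNk k) fun x hx => ?_
            rw [ENNReal.coe_mul]
            exact mul_le_mul_left (ENNReal.coe_le_coe.mpr (hδ' _ hx)) _
    have h2 : ∫⁻ x, ((δ (N x) * h x : ℝ≥0) : ℝ≥0∞) ∂σ = ⊤ :=
      top_unique (this.symm.le.trans (setLIntegral_le_lintegral _ _))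
    rw [h2]
    exact le_top
  · have huniv : (univ : Set X) = ⋃ k, N ⁻¹' {k} := by
      ext x; simp
    rw [← setLIntegral_univ, huniv]
    refine (lintegral_iUnion_le _ _).trans ((ENNReal.tsum_le_tsum fun k => ?_).trans hsum.le)
    have h1 : ∫⁻ x in N ⁻¹' {k}, ((δ (N x) * h x : ℝ≥0) : ℝ≥0∞) ^ p ∂m =
        ∫⁻ x in N ⁻¹' {k}, ((δ k ^ p : ℝ≥0) : ℝ≥0∞) * (h x : ℝ≥0∞) ^ p ∂m := by
      refine setLIntegral_congr_fun (hN (measurableSet_singleton k)) fun x hx => ?_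
      have hx : N x = k := hx
      simp only [hx, ENNReal.coe_mul]
      rw [ENNReal.mul_rpow_of_nonneg _ _ hp.le, ENNReal.coe_rpow_of_nonneg _ hp.le]
    have h2 : ∫⁻ x in N ⁻¹' {k}, (h x : ℝ≥0∞) ^ p ∂m ≤ I k := by
      rw [ENNReal.coe_toNNReal (hfin k)]
      exact lintegral_mono_set (preimage_mono (singleton_subset_iff.mpr self_mem_Iic))
    rw [h1, lintegral_const_mul _ (hh.coe_nnreal_ennreal.pow_const p), hδp]
    refine (mul_le_mul_right h2 _).trans ?_
    rw [← ENNReal.coe_mul, ENNReal.coe_le_coe]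
    rw [div_mul_eq_mul_div, div_le_iff₀ (by positivity)]
    exact mul_le_mul_of_nonneg_left le_add_self zero_le

/-- If the measures of a family see the sets `u ⁻¹' K n` infinitely often much more than the basic
measure does, the module of the family vanishes for `p < 1`. -/
theorem pModule_eq_zero_of_frequently (hp : 0 < p) (hp1 : p < 1) {E : Set (Measure X)} {N : X → ℕ}
    (hN : Measurable N) {u : X → ℝ} (hu : Measurable u) {K : ℕ → Set ℝ}
    (hK : ∀ n, MeasurableSet (K n)) (hdisj : Pairwise (Function.onFun Disjoint K))
    (hm : ∀ k, ∃ C : ℝ≥0, ∀ n, m (N ⁻¹' Iic k ∩ u ⁻¹' K n) ≤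
      ENNReal.ofNNReal (C * (1 / 2) ^ n.factorial))
    (hσ : ∀ σ ∈ E, ∃ (k : ℕ) (c : ℝ≥0), 0 < c ∧ ∃ᶠ n in atTop,
      ENNReal.ofNNReal (c * (1 / 2) ^ n.factorial) ≤ σ (N ⁻¹' Iic k ∩ u ⁻¹' K n)) :
    pModule m p E = 0 := by
  set d : ℕ → ℝ≥0 := fun n => (1 / 2) ^ n.factorial
  have hd0 : ∀ n, 0 < d n := fun n => by positivity
  have hd0' : ∀ n, d n ≠ 0 := fun n => (hd0 n).ne'
  -- At most one term is nonzero, since the sets are disjoint, so powers of `g` can be taken term by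
  -- term.
  set g : ℝ → ℝ≥0 := fun t => ∑' n, (K n).indicator (fun _ => (d n)⁻¹) t
  have hne : ∀ {t n}, t ∈ K n → ∀ n', n' ≠ n → t ∉ K n' := fun ht n' hn' ht' =>
    (hdisj hn').le_bot ⟨ht', ht⟩
  have hgK : ∀ {t n}, t ∈ K n → g t = (d n)⁻¹ := fun {t n} ht => by
    simp only [g]
    rw [tsum_eq_single n fun n' hn' => indicator_of_notMem (hne ht n' hn') _,
      indicator_of_mem ht]
  have hg0 : ∀ {t}, (∀ n, t ∉ K n) → g t = 0 := fun {t} ht => by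
    simp only [g]
    exact (tsum_congr fun n => indicator_of_notMem (ht n) _).trans tsum_zero
  have hgm : Measurable g :=
    Measurable.tsum fun n => measurable_const.indicator (hK n)
  have hgq : ∀ q : ℝ, 0 < q → ∀ t, (g t : ℝ≥0∞) ^ q =
      ∑' n, (K n).indicator (fun _ => (((d n)⁻¹ : ℝ≥0) : ℝ≥0∞) ^ q) t := fun q hq t => by
    by_cases ht : ∃ n, t ∈ K n
    · obtain ⟨n, ht⟩ := ht
      rw [hgK ht, tsum_eq_single n fun n' hn' => indicator_of_notMem (hne ht n' hn') _,
        indicator_of_mem ht]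
    · push Not at ht
      rw [hg0 ht, ENNReal.coe_zero, ENNReal.zero_rpow_of_pos hq]
      exact ((tsum_congr fun n => indicator_of_notMem (ht n) _).trans tsum_zero).symm
  have hNk : ∀ k, MeasurableSet (N ⁻¹' Iic k) := fun k => hN measurableSet_Iic
  have hint : ∀ (q : ℝ), 0 < q → ∀ (σ : Measure X) k, ∫⁻ x in N ⁻¹' Iic k, (g (u x) : ℝ≥0∞) ^ q ∂σ =
      ∑' n, (((d n)⁻¹ : ℝ≥0) : ℝ≥0∞) ^ q * σ (N ⁻¹' Iic k ∩ u ⁻¹' K n) := fun q hq σ k => by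
    simp only [hgq q hq]
    rw [lintegral_tsum (f := fun n x => (K n).indicator (fun _ => (((d n)⁻¹ : ℝ≥0) : ℝ≥0∞) ^ q) (u x))
      fun n => ((measurable_const.indicator (hK n)).comp hu).aemeasurable]
    refine tsum_congr fun n => ?_
    have : (fun x => (K n).indicator (fun _ => (((d n)⁻¹ : ℝ≥0) : ℝ≥0∞) ^ q) (u x)) =
        (u ⁻¹' K n).indicator fun _ => (((d n)⁻¹ : ℝ≥0) : ℝ≥0∞) ^ q := rfl
    rw [this, lintegral_indicator (hu (hK n)), setLIntegral_const,
      Measure.restrict_apply (hu (hK n)), inter_comm]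
  refine pModule_eq_zero_of_infinite hp hN (h := fun x => g (u x)) (hgm.comp hu) (fun k => ?_)
    fun σ hσE => ?_
  · obtain ⟨C, hC⟩ := hm k
    rw [hint p hp]
    have hterm : ∀ n, (((d n)⁻¹ : ℝ≥0) : ℝ≥0∞) ^ p * m (N ⁻¹' Iic k ∩ u ⁻¹' K n) ≤
        ENNReal.ofNNReal (C * ((1 / 2 : ℝ≥0) ^ (1 - p)) ^ n) := fun n => by
      refine (mul_le_mul_right (hC n) _).trans ?_
      rw [← ENNReal.coe_rpow_of_nonneg _ hp.le, ← ENNReal.coe_mul, ENNReal.coe_le_coe]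
      -- Here `p < 1` enters: the exponent `1 - p` is positive, and the terms are dominated by a
      -- convergent geometric series.
      have h1 : (d n)⁻¹ ^ p * (C * d n) = C * d n ^ (1 - p) := by
        rw [NNReal.inv_rpow, NNReal.rpow_sub (hd0' n), NNReal.rpow_one, div_eq_mul_inv]
        ring
      have h2 : d n ≤ (1 / 2) ^ n :=
        pow_le_pow_of_le_one zero_le (by
          rw [div_le_iff₀ two_pos, one_mul]; exact one_le_two) (Nat.self_le_factorial n)
      calc (d n)⁻¹ ^ p * (C * d n) = C * d n ^ (1 - p) := h1
        _ ≤ C * ((1 / 2) ^ n) ^ (1 - p) := by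
            gcongr
        _ = _ := by
            rw [← NNReal.rpow_natCast, ← NNReal.rpow_natCast, ← NNReal.rpow_mul,
              ← NNReal.rpow_mul, mul_comm (n : ℝ)]
    refine ne_top_of_le_ne_top ?_ (ENNReal.tsum_le_tsum hterm)
    refine ENNReal.tsum_coe_ne_top_iff_summable.mpr (Summable.mul_left _ ?_)
    refine NNReal.summable_geometric ?_
    exact NNReal.rpow_lt_one (by
      rw [div_lt_iff₀ two_pos, one_mul]; exact one_lt_two) (by linarith)
  · obtain ⟨k, c, hc, hfr⟩ := hσ σ hσE
    refine ⟨k, ?_⟩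
    have h1 := hint 1 one_pos σ k
    simp only [ENNReal.rpow_one] at h1
    rw [h1]
    -- A convergent series has terms tending to zero, but infinitely many of these are at least `c`.
    by_contra hne
    have h2 := ENNReal.tendsto_cofinite_zero_of_tsum_ne_top hne
    rw [Nat.cofinite_eq_atTop] at h2
    have h3 := h2.eventually_lt_const (u := (c : ℝ≥0∞)) (by simpa using hc)
    obtain ⟨n, hn1, hn2⟩ := (hfr.and_eventually h3).exists
    refine absurd hn2 (not_lt.mpr ?_)
    calc (c : ℝ≥0∞) = (((d n)⁻¹ : ℝ≥0) : ℝ≥0∞) * ENNReal.ofNNReal (c * d n) := by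
          rw [← ENNReal.coe_mul, ENNReal.coe_inj, mul_comm c, inv_mul_cancel_left₀ (hd0' n)]
      _ ≤ _ := by gcongr

end Module

/-! ### Haar measure of preimages under the test functions -/

namespace CarnotGroup

variable {G : Type*} [NormedAddCommGroup G] [NormedSpace ℝ G] [FiniteDimensional ℝ G] [Group G]
  [CarnotGroup G]

/-- By left invariance the measure equals its average over translations by `t • X`, `0 ≤ t ≤ 1`. For
fixed `x` the function `u` moves with unit speed along them, so the time spent in `A` is at most the
length of a bounded part of `A`; only points `x` of a larger ball contribute. -/
theorem HomogeneousNorm.exists_measure_preimage_le [MeasurableSpace G] [BorelSpace G]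
    (ν : HomogeneousNorm G) (m : Measure G) [m.IsHaarMeasure] {u : G → ℝ} (hu : Continuous u)
    {X : G} (huX : ∀ (t : ℝ) x, u ((t • X) * x) = t + u x) (R : ℝ) :
    ∃ (C : ℝ≥0) (R' : ℝ), 0 ≤ R' ∧ ∀ A : Set ℝ, MeasurableSet A →
      m ({x | ν x ≤ R} ∩ u ⁻¹' A) ≤ C * volume (A ∩ Icc (-R') R') := by
  obtain ⟨R₁, hR₁⟩ := (ν.isCompact_le R).exists_bound_of_continuousOn hu.continuousOn
  have hcX : Continuous fun t : ℝ => ν (t • X) :=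
    ν.continuous'.comp (continuous_id.smul continuous_const)
  obtain ⟨R₂, hR₂⟩ := (isCompact_Icc (a := (0 : ℝ)) (b := 1)).exists_bound_of_continuousOn
    hcX.continuousOn
  set B : Set G := {x | ν x ≤ R}
  set B' : Set G := {x | ν x ≤ R₂ + R}
  have hBc : IsClosed B := isClosed_le ν.continuous' continuous_const
  have hB'c : IsClosed B' := isClosed_le ν.continuous' continuous_const
  have hB'fin : m B' ≠ ⊤ := (ν.isCompact_le _).measure_lt_top.ne
  refine ⟨(m B').toNNReal, |R₁|, abs_nonneg _, fun A hA => ?_⟩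
  rw [ENNReal.coe_toNNReal hB'fin]
  have hAB : MeasurableSet (B ∩ u ⁻¹' A) := hBc.measurableSet.inter (hu.measurable hA)
  set f : G → ℝ≥0∞ := (B ∩ u ⁻¹' A).indicator 1
  have hf : Measurable f := measurable_one.indicator hAB
  have hft : ∀ t : ℝ, ∫⁻ x, f ((t • X) * x) ∂m = m (B ∩ u ⁻¹' A) := fun t => by
    rw [lintegral_mul_left_eq_self, lintegral_indicator_one hAB]
  have hmul : Measurable fun q : ℝ × G => f ((q.1 • X) * q.2) :=
    hf.comp (Continuous.measurable ((continuous_fst.smul continuous_const).mul continuous_snd))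
  have h1 : m (B ∩ u ⁻¹' A) = ∫⁻ t in Icc (0 : ℝ) 1, ∫⁻ x, f ((t • X) * x) ∂m := by
    simp only [hft]
    simp
  rw [h1, lintegral_lintegral_swap hmul.aemeasurable, mul_comm, ← setLIntegral_const,
    ← lintegral_indicator hB'c.measurableSet]
  refine lintegral_mono fun x => ?_
  by_cases hx : x ∈ B'
  · rw [indicator_of_mem hx]
    have h2 : ∀ t ∈ Icc (0 : ℝ) 1, f ((t • X) * x) ≤
        ((fun t => t + u x) ⁻¹' (A ∩ Icc (-|R₁|) |R₁|)).indicator 1 t := fun t ht => by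
      by_cases hm : (t • X) * x ∈ B ∩ u ⁻¹' A
      · have hb : |u ((t • X) * x)| ≤ |R₁| := (hR₁ _ hm.1).trans (le_abs_self _)
        have ha : u ((t • X) * x) ∈ A := hm.2
        rw [huX] at hb ha
        have : t ∈ (fun t => t + u x) ⁻¹' (A ∩ Icc (-|R₁|) |R₁|) :=
          ⟨ha, abs_le.mp hb⟩
        rw [indicator_of_mem this]
        simp [f, hm]
      · simp [f, hm]
    have hmeas : MeasurableSet ((fun t => t + u x) ⁻¹' (A ∩ Icc (-|R₁|) |R₁|)) :=
      (measurable_id.add_const _) (hA.inter measurableSet_Icc)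
    calc ∫⁻ t in Icc (0 : ℝ) 1, f ((t • X) * x) ≤ ∫⁻ t in Icc (0 : ℝ) 1,
          ((fun t => t + u x) ⁻¹' (A ∩ Icc (-|R₁|) |R₁|)).indicator 1 t :=
        setLIntegral_mono' measurableSet_Icc h2
      _ ≤ ∫⁻ t, ((fun t => t + u x) ⁻¹' (A ∩ Icc (-|R₁|) |R₁|)).indicator 1 t :=
        setLIntegral_le_lintegral _ _
      _ = volume (A ∩ Icc (-|R₁|) |R₁|) := by
        rw [lintegral_indicator_one hmeas]
        exact measure_preimage_add_right _ _ _
  · rw [indicator_of_notMem hx]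
    refine le_of_eq (setLIntegral_eq_zero measurableSet_Icc fun t ht => ?_)
    have : (t • X) * x ∉ B ∩ u ⁻¹' A := fun h => hx (by
      have h3 := ν.mul_le' (t • X)⁻¹ ((t • X) * x)
      rw [inv_mul_cancel_left, ν.inv'] at h3
      have h4 : ν ((t • X) * x) ≤ R := h.1
      have h5 := (le_abs_self _).trans (hR₂ t ht)
      change ν x ≤ R₂ + R
      linarith)
    simp [f, this]

end CarnotGroup

/-- The functions `B ↦ det (p κ B)` come from multilinear forms evaluated on the images of a basis
of `E`. Such forms make up a finite-dimensional space, so finitely many `κ ∈ S` span all of them,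
however large `S` is. -/
theorem exists_finset_det_comp {V E : Type*} [NormedAddCommGroup V] [NormedSpace ℝ V]
    [FiniteDimensional ℝ V] [NormedAddCommGroup E] [NormedSpace ℝ E] [FiniteDimensional ℝ E]
    (p : V →L[ℝ] E) (S : Set (V →L[ℝ] V)) : ∃ F : Finset (V →L[ℝ] V), (F : Set (V →L[ℝ] V)) ⊆ S ∧
      ∀ κ ∈ S, ∃ c : F → ℝ, ∀ B : E →L[ℝ] V,
        ∑ κ' : F, c κ' * (p.comp ((κ' : V →L[ℝ] V).comp B)).det = (p.comp (κ.comp B)).det := by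
  classical
  let b := Module.finBasis ℝ E
  let θ : (V →L[ℝ] V) → MultilinearMap ℝ (fun _ : Fin (Module.finrank ℝ E) => V) ℝ := fun κ =>
    b.det.toMultilinearMap.compLinearMap fun _ => ((p.comp κ : V →L[ℝ] E) : V →ₗ[ℝ] E)
  have hθ : ∀ κ (B : E →L[ℝ] V), θ κ (fun i => B (b i)) = (p.comp (κ.comp B)).det := fun κ B => by
    have h1 : θ κ (fun i => B (b i)) =
        b.det (((p.comp (κ.comp B) : E →L[ℝ] E) : E →ₗ[ℝ] E) ∘ b) := rfl
    rw [h1, Module.Basis.det_comp, Module.Basis.det_self, mul_one]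
  have hfg : (Submodule.span ℝ (θ '' S)).FG := IsNoetherian.noetherian _
  obtain ⟨s', hs', hspan⟩ := (Submodule.fg_span_iff_fg_span_finset_subset _).mp hfg
  obtain ⟨F, hF, rfl⟩ := Finset.subset_set_image_iff.mp hs'
  refine ⟨F, hF, fun κ hκ => ?_⟩
  have hmem : θ κ ∈ Submodule.span ℝ (θ '' (F : Set (V →L[ℝ] V))) := by
    rw [← Finset.coe_image, ← hspan]
    exact Submodule.subset_span (mem_image_of_mem _ hκ)
  obtain ⟨c, hc⟩ := Submodule.mem_span_image_finset_iff_exists_fun ℝ |>.mp hmem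
  refine ⟨c, fun B => ?_⟩
  have := congrArg (fun η => η fun i => B (b i)) hc
  simpa [sum_apply, hθ] using this

theorem dimH_image_of_dist_eq {X : Type*} [MetricSpace X] {f : X → X}
    (h : ∀ x y, dist (f x) (f y) = dist x y) (A : Set X) : dimH (f '' A) = dimH A :=
  (Isometry.of_dist_eq h).dimH_image A

/-! ### Graphs over the decompositions of an orbit -/

namespace CarnotGroup

variable {G : Type*} [NormedAddCommGroup G] [NormedSpace ℝ G] [FiniteDimensional ℝ G] [Group G]
  [CarnotGroup G]

theorem isGradedHom_autLin {ν : HomogeneousNorm G} {k : MulAut G}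
    (hk : k ∈ gradedIsometryGroup ν) : IsGradedHom (autLin k (continuous_of_norm_preserving hk.2)) :=
  ⟨fun x y => map_mul k x y, fun t _ x => 
    map_dil_of_layer (continuous_of_norm_preserving hk.2) hk.1 t x⟩

theorem HomogeneousNorm.metricDim_image (ν : HomogeneousNorm G) {k : MulAut G}
    (hk : ∀ p, ν (k p) = ν p) (A : Set G) : ν.metricDim (k '' A) = ν.metricDim A :=
  @dimH_image_of_dist_eq G ν.metricSpace k
    (fun x y => by rw [ν.dist_eq, ν.dist_eq, ← map_inv, ← map_mul, hk]) A

namespace Decomposition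

theorem projM_map {D D' : Decomposition G} {k : MulAut G} (hM : D'.M = D.M.map k.toMonoidHom)
    (hH : D'.H = D.H.map k.toMonoidHom) (x : G) :
    D'.projM (k x) = k (D.projM x) ∧ D'.projH (k x) = k (D.projH x) := by
  have h1 : k (D.projM x) ∈ D'.subM := by
    change k (D.projM x) ∈ D'.M
    rw [hM]; exact ⟨_, D.projM_mem x, rfl⟩
  have h2 : k (D.projH x) ∈ D'.subH := by
    change k (D.projH x) ∈ D'.H
    rw [hH]; exact ⟨_, D.projH_mem x, rfl⟩
  have h3 := D'.proj_mul h1 h2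
  rwa [← map_mul, D.projM_mul_projH] at h3

/-- An intrinsic Lipschitz graph over a decomposition in an orbit, pulled back to the original
decomposition. -/
theorem exists_graph_map {D D' : Decomposition G} {ν : HomogeneousNorm G} {k : MulAut G}
    (hk : ∀ p, ν (k p) = ν p)
    (hM : D'.M = D.M.map k.toMonoidHom) (hH : D'.H = D.H.map k.toMonoidHom) {Ω : Set D'.M}
    {f : D'.M → D'.H} (hΩ : IsOpen Ω) (hf : D'.IsIntrinsicLipschitz ν Ω f) :
    ∃ (Ω' : Set D.subM) (Φ : D.subM → G) (Λ : ℝ), IsOpen Ω' ∧ 0 ≤ Λ ∧ (∀ m, D.pr (Φ m) = m) ∧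
      (∀ m ∈ Ω', ∀ m' ∈ Ω', ν ((Φ m)⁻¹ * Φ m') ≤ Λ * ν (D.pr ((Φ m)⁻¹ * m'))) ∧
      (fun m => k (Φ m)) '' Ω' = D'.graph Ω f := by
  have hkM : ∀ m : D.subM, k (m : G) ∈ D'.M := fun m => by rw [hM]; exact ⟨_, m.2, rfl⟩
  set ι : D.subM → D'.M := fun m => ⟨k (m : G), hkM m⟩
  have hι : Continuous ι :=
    ((continuous_of_norm_preserving hk).comp continuous_subtype_val).subtype_mk _
  have hfH : ∀ m, k⁻¹ (f m : G) ∈ D.subH := fun m => by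
    obtain ⟨h, hh, hkh⟩ := (SetLike.ext_iff.mp hH _).mp (f m).2
    have hkh : k h = f m := hkh
    rw [← hkh, MulAut.inv_apply_self]
    exact hh
  set Φ : D.subM → G := fun m => m * k⁻¹ (f (ι m) : G)
  have hΦk : ∀ m, k (Φ m) = (ι m : G) * (f (ι m) : G) := fun m => by
    simp only [Φ, map_mul, MulAut.apply_inv_self, ι]
  have hpr : ∀ m, D.pr (Φ m) = m := fun m => D.pr_mul m (hfH _)
  obtain ⟨L, hL, hcone⟩ := hf
  have hmem : ∀ m, ι m ∈ Ω → k (Φ m) ∈ D'.graph Ω f := fun m hm => ⟨ι m, hm, (hΦk m).symm⟩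
  refine ⟨ι ⁻¹' Ω, Φ, 1 + L, hΩ.preimage hι, by positivity, hpr, fun m hm m' hm' => ?_, ?_⟩
  · set y := (Φ m)⁻¹ * Φ m'
    have hy : D.pr ((Φ m)⁻¹ * m') = D.pr y := by
      conv_lhs => rw [← hpr m', D.pr_mul_pr]
    rw [hy]
    -- If this failed, `k (Φ m')` would lie in the cone at `k (Φ m)`, which meets the graph only at
    -- its vertex. Then `y = 1`, for which the inequality is trivial.
    have hle : ν (D.projH y) ≤ L * ν (D.projM y) := by
      by_contra! hcon
      have hc : k (Φ m') ∈ D'.cone ν (k (Φ m)) (1 / L) := by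
        refine ⟨k y, ?_, ?_⟩
        · rw [mem_ofPred_eq, (projM_map hM hH y).1, (projM_map hM hH y).2, hk, hk,
            one_div, le_inv_mul_iff₀ hL]
          exact hcon.le
        · simp only [y, map_mul, map_inv, mul_inv_cancel_left]
      have h1 : k (Φ m') ∈ D'.cone ν (k (Φ m)) (1 / L) ∩ D'.graph Ω f := ⟨hc, hmem m' hm'⟩
      rw [hcone _ (hmem m hm), mem_singleton_iff] at h1
      have h2 : y = 1 := by
        simp only [y, k.injective h1, inv_mul_cancel]
      have h3 := D.proj_mul D.subM.zero_mem D.subH.zero_mem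
      rw [mul_zero_coord] at h3
      rw [h2, one_eq_zero, h3.1, h3.2, ν.map_zero', mul_zero] at hcon
      exact lt_irrefl _ hcon
    have h4 := ν.mul_le' (D.projM y) (D.projH y)
    rw [D.projM_mul_projH] at h4
    rw [coe_pr]
    linarith
  · ext x
    constructor
    · rintro ⟨m, hm, rfl⟩
      exact hmem m hm
    · rintro ⟨m, hm, rfl⟩
      obtain ⟨m', hm', hkm⟩ := (SetLike.ext_iff.mp hM _).mp m.2
      have h2 : ι ⟨m', hm'⟩ = m := Subtype.ext hkm
      refine ⟨⟨m', hm'⟩, ?_, ?_⟩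
      · rw [mem_preimage, h2]; exact hm
      · simp only [hΦk, h2]

variable {D : Decomposition G} [MeasurableSpace G] [BorelSpace G] (μ : Measure D.subM)
  [μ.IsAddHaarMeasure]

/-- An intrinsic Lipschitz graph meets the preimages of sparse evenly distributed closed sets with
the right frequency. -/
theorem exists_frequently_measure_le (ν : HomogeneousNorm G) {K : Set D.subM} (hK : IsCompact K)
    {Φ : D.subM → G} (h1 : ∀ m ∈ K, D.pr (Φ m) = m) {Λ : ℝ} (hΛ : 0 ≤ Λ)
    (h2 : ∀ m ∈ K, ∀ m' ∈ K, ν ((Φ m)⁻¹ * Φ m') ≤ Λ * ν (D.pr ((Φ m)⁻¹ * m')))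
    {ι : Type*} (s : Finset ι) {κ : ι → G →L[ℝ] G} (hκ : ∀ i, IsGradedHom (κ i)) (c : ι → ℝ)
    (hc : ∀ A : D.subM →L[ℝ] G, ∑ i ∈ s, c i * ((fderiv ℝ D.pr 0).comp ((κ i).comp A)).det =
      ((fderiv ℝ D.pr 0).comp A).det)
    {χ : D.subM → ℝ} (hχ : ContDiff ℝ 1 χ) (hχs : HasCompactSupport χ)
    (hχ01 : ∀ x, χ x ∈ Icc (0 : ℝ) 1) (hχK : tsupport χ ⊆ K) (hχ0 : 0 < ∫ x, χ x ∂μ)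
    {ξ : D.subM →L[ℝ] ℝ} {e : D.subM} (he : ξ e = 1) {Ks : ℕ → Set ℝ}
    (hKs : ∀ n, IsClosed (Ks n))
    (hKd : ∀ R : ℝ, 0 ≤ R → ∃ C : ℝ, 0 ≤ C ∧ ∀ (n : ℕ) (x : ℝ), |x| ≤ R →
      |∫ t in (0 : ℝ)..x, ((Ks n).indicator 1 t - (1 / 2) ^ n.factorial / 2)| ≤
        C * (1 / 2) ^ (n + 1).factorial) :
    ∃ i ∈ s, ∃ c : ℝ≥0, 0 < c ∧ ∃ᶠ n in atTop, ENNReal.ofNNReal (c * (1 / 2) ^ n.factorial) ≤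
      μ {x ∈ tsupport χ | ξ (D.pr (κ i (Φ x))) ∈ Ks n} := by
  obtain ⟨C, R, c₀, N, hC, hc₀, hmain⟩ := exists_index_lower_bound μ ν hK h1 hΛ h2 s hκ c hc hχ
    hχs hχ01 hχK hχ0 he
  obtain ⟨C', hC', hdist⟩ := hKd |R| (abs_nonneg R)
  set d : ℕ → ℝ := fun n => (1 / 2) ^ n.factorial
  have hd0 : ∀ n, 0 < d n := fun n => by positivity
  have hdlim : Tendsto d atTop (𝓝 0) :=
    (tendsto_pow_atTop_nhds_zero_of_lt_one (by norm_num) (by norm_num)).comp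
      (tendsto_atTop_mono Nat.self_le_factorial tendsto_id)
  set c₁ : ℝ := c₀ / (4 * C)
  have hc₁ : 0 < c₁ := by positivity
  have hev : ∀ᶠ n in atTop, ∃ i ∈ s,
      c₁ * d n ≤ μ.real {x ∈ tsupport χ | ξ (D.pr (κ i (Φ x))) ∈ Ks n} := by
    have h3 : ∀ᶠ n in atTop, (1 + C') * d n < c₁ := by
      have := hdlim.const_mul (1 + C')
      rw [mul_zero] at this
      exact this.eventually_lt_const hc₁
    filter_upwards [h3, eventually_ge_atTop (2 * N + 1)] with n hn hnN
    -- At this level the approximation error is `d n ^ 2`, negligible against the density `d n / 2`.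
    obtain ⟨i, hi, h⟩ := hmain (2 * n.factorial)
    refine ⟨i, hi, ?_⟩
    have h4 := h (Ks n) (d n / 2) (C' * d (n + 1)) (hKs n) (by linarith [hd0 n])
      (mul_nonneg hC' (hd0 _).le) fun x hx => hdist n x (hx.trans (le_abs_self R))
    have h5 : (1 / 2 : ℝ) ^ (2 * n.factorial) = d n * d n := by
      simp only [d]; rw [two_mul, pow_add]
    -- The factor in front is `d n ^ (-2 * N)`, while `d (n + 1) = d n ^ (n + 1)`; this is why the
    -- densities involve factorials and why `n ≥ 2 * N + 1` is enough.
    have h6 : ((2 : ℝ) ^ (2 * n.factorial)) ^ N * d (n + 1) ≤ d n * d n := by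
      have h7 : d (n + 1) ≤ (1 / 2 : ℝ) ^ (2 * n.factorial * N + 2 * n.factorial) := by
        refine pow_le_pow_of_le_one (by norm_num) (by norm_num) ?_
        rw [Nat.factorial_succ]
        nlinarith [Nat.factorial_pos n]
      calc ((2 : ℝ) ^ (2 * n.factorial)) ^ N * d (n + 1) ≤ ((2 : ℝ) ^ (2 * n.factorial)) ^ N *
            (1 / 2 : ℝ) ^ (2 * n.factorial * N + 2 * n.factorial) := by gcongr
        _ = d n * d n := by
            rw [← pow_mul, pow_add, ← mul_assoc, ← mul_pow, h5]
            norm_num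
    rw [h5] at h4
    have h8 : (2 ^ (2 * n.factorial)) ^ N * (C' * d (n + 1)) ≤ C' * (d n * d n) := by
      calc _ = C' * ((2 ^ (2 * n.factorial)) ^ N * d (n + 1)) := by ring
        _ ≤ _ := by gcongr
    have h9 : (1 + C') * d n * d n ≤ c₁ * d n := mul_le_mul_of_nonneg_right hn.le (hd0 n).le
    have h10 : c₀ = 4 * c₁ * C := by simp only [c₁]; field_simp
    rw [h10] at h4
    have h11 : 2 * c₁ * d n ≤ μ.real {x ∈ tsupport χ | ξ (D.pr (κ i (Φ x))) ∈ Ks n} +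
        d n * d n + (2 ^ (2 * n.factorial)) ^ N * (C' * d (n + 1)) := by
      refine le_of_mul_le_mul_left ?_ hC
      refine le_trans (le_of_eq ?_) h4
      ring
    nlinarith
  -- The good index depends on `n`, but there are finitely many indices, so one of them works for
  -- infinitely many `n`.
  obtain ⟨i, hi, hfr⟩ : ∃ i ∈ s, ∃ᶠ n in atTop,
      c₁ * d n ≤ μ.real {x ∈ tsupport χ | ξ (D.pr (κ i (Φ x))) ∈ Ks n} := by
    by_contra! hcon
    have h3 : ∀ᶠ n in atTop, ∀ i ∈ s,
        ¬c₁ * d n ≤ μ.real {x ∈ tsupport χ | ξ (D.pr (κ i (Φ x))) ∈ Ks n} :=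
      (Filter.eventually_all_finset s).mpr fun i hi => (hcon i hi).mono fun n hn => not_le.mpr hn
    obtain ⟨n, ⟨i, hi, h4⟩, h5⟩ := (hev.and h3).exists
    exact h5 i hi h4
  refine ⟨i, hi, c₁.toNNReal, Real.toNNReal_pos.mpr hc₁, hfr.mono fun n hn => ?_⟩
  have hfin : μ {x ∈ tsupport χ | ξ (D.pr (κ i (Φ x))) ∈ Ks n} ≠ ⊤ :=
    ((measure_mono (sep_subset _ _)).trans_lt hχs.measure_lt_top).ne
  rw [← ENNReal.coe_toNNReal hfin, ENNReal.coe_le_coe]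
  refine NNReal.coe_le_coe.mp (le_trans (le_of_eq ?_) hn)
  rw [NNReal.coe_mul, Real.coe_toNNReal _ hc₁.le]
  simp [d]

end Decomposition

end CarnotGroup

/-! ### A finite family of test functions, and the theorem -/

namespace CarnotGroup

variable {G : Type*} [NormedAddCommGroup G] [NormedSpace ℝ G] [FiniteDimensional ℝ G] [Group G]
  [CarnotGroup G]

namespace Decomposition

/-- Excludes a trivial `M`, on which no functional `ξ` exists, by the condition `1 ≤ dt`. -/
theorem finrank_lieAlgebraOf_eq_zero {D D' : Decomposition G} {k : MulAut G}
    (hM : D'.M = D.M.map k.toMonoidHom) (hD : D.subM = ⊥) :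
    Module.finrank ℝ (lieAlgebraOf D'.M) = 0 := by
  have h : lieAlgebraOf D'.M = ⊥ := by
    rw [lieAlgebraOf, Submodule.span_eq_bot]
    intro x hx
    obtain ⟨m, hm, hkm⟩ := (SetLike.ext_iff.mp hM _).mp (hx 1)
    have hkm : k m = (1 : ℝ) • x := hkm
    have hm0 : m ∈ D.subM := hm
    rw [hD, Submodule.mem_bot, ← one_eq_zero] at hm0
    rw [hm0, map_one, one_smul] at hkm
    rw [← hkm, one_eq_zero]
  rw [h, finrank_bot]

variable [MeasurableSpace G] [BorelSpace G]

/-- Finitely many test functions detect all intrinsic Lipschitz graphs over the decompositions of an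
orbit. -/
theorem exists_test_functions (D : Decomposition G) (ν : HomogeneousNorm G)
    {K : Subgroup (MulAut G)} (hK : K ≤ gradedIsometryGroup ν) {Ks : ℕ → Set ℝ}
    (hKs : ∀ n, IsClosed (Ks n))
    (hKd : ∀ R : ℝ, 0 ≤ R → ∃ C : ℝ, 0 ≤ C ∧ ∀ (n : ℕ) (x : ℝ), |x| ≤ R →
      |∫ t in (0 : ℝ)..x, ((Ks n).indicator 1 t - (1 / 2) ^ n.factorial / 2)| ≤
        C * (1 / 2) ^ (n + 1).factorial) :
    ∃ F : Finset (G → ℝ),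
      (∀ u ∈ F, Continuous u ∧ ∃ X : G, ∀ (t : ℝ) x, u ((t • X) * x) = t + u x) ∧
      ∀ (dt : ℕ) (dm : ℝ≥0), 1 ≤ dt → dt + 1 ≤ Module.finrank ℝ G → ∀ D' ∈ D.orbit K,
        IsSubgroupOfDims ν dt dm D'.M → ∀ (Ω : Set D'.M) (f : D'.M → D'.H), IsOpen Ω →
        D'.IsIntrinsicLipschitz ν Ω f → ∀ W : Set G, IsOpen W → (D'.graph Ω f ∩ W).Nonempty →
        ∃ u ∈ F, ∃ (R : ℝ) (c : ℝ≥0), 0 < c ∧ ∃ᶠ n in atTop,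
          ENNReal.ofNNReal (c * (1 / 2) ^ n.factorial) ≤
            ν.sphericalMeasure dm ((D'.graph Ω f ∩ W) ∩ ({x | ν x ≤ R} ∩ u ⁻¹' Ks n)) := by
  classical
  by_cases hD : D.subM = ⊥
  · refine ⟨∅, by simp, fun dt dm hdt _ D' ⟨k, _, hM, _⟩ hdims => ?_⟩
    have := finrank_lieAlgebraOf_eq_zero hM hD
    rw [hdims.2.1] at this
    omega
  obtain ⟨ξ, X, hξX, hξ⟩ := D.exists_additive_functional hD
  set S : Set (G →L[ℝ] G) := {κ | ∃ k ∈ K, ∀ x, κ x = k x}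
  -- The finite set serves the whole orbit: it is fixed before the surface and its automorphism `k`
  -- are known.
  obtain ⟨F₀, hF₀, hdet⟩ := exists_finset_det_comp (fderiv ℝ D.pr 0) S
  have hkc : ∀ k ∈ K, Continuous k := fun k hk => continuous_of_norm_preserving (hK hk).2
  refine ⟨F₀.image fun κ x => ξ (D.pr (κ x)), fun u hu => ?_, ?_⟩
  · obtain ⟨κ, hκ, rfl⟩ := Finset.mem_image.mp hu
    obtain ⟨k, hk, hκk⟩ := hF₀ hκ
    refine ⟨ξ.continuous.comp (contDiff_pr_gradedHom κ).continuous, k⁻¹ (X : G), fun t x => ?_⟩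
    have h1 : κ ((t • k⁻¹ (X : G)) * x) = ((t • X : D.subM) : G) * κ x := by
      rw [hκk, hκk, map_mul, map_smul_of_continuous (hkc k hk), MulAut.apply_inv_self]
      rfl
    simp only [h1]
    rw [← D.act_pr, hξ, map_smul, hξX, smul_eq_mul, mul_one]
  intro dt dm hdt hdtG D' ⟨k, hkK, hM, hH⟩ hdims Ω f hΩ hf W hW ⟨x₀, hx₀, hx₀W⟩
  have hk := hK hkK
  have hkinv : k⁻¹ ∈ K := K.inv_mem hkK
  obtain ⟨Ω', Φ, Λ, hΩ', hΛ, hpr, hlip, himg⟩ := exists_graph_map hk.2 hM hH hΩ hf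
  rw [← himg] at hx₀
  obtain ⟨m₀, hm₀, rfl⟩ := hx₀
  have hΦ : ContinuousOn Φ Ω' := continuousOn_of_intrinsicLipschitz ν (fun m _ => hpr m) hlip
  have hkΦ : ContinuousOn (fun m => k (Φ m)) Ω' := (hkc k hkK).comp_continuousOn hΦ
  have hO : IsOpen (Ω' ∩ (fun m => k (Φ m)) ⁻¹' W) := hkΦ.isOpen_inter_preimage hΩ' hW
  obtain ⟨r, hr, hball⟩ := Metric.isOpen_iff.mp hO m₀ ⟨hm₀, hx₀W⟩
  -- The support of the bump is a ball over which the graph stays inside `W`.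
  let χ : ContDiffBump m₀ := ⟨r / 4, r / 2, by positivity, by linarith⟩
  set B : Set D.subM := Metric.closedBall m₀ (r / 2)
  have hBO : B ⊆ Ω' ∩ (fun m => k (Φ m)) ⁻¹' W :=
    (Metric.closedBall_subset_ball (by linarith)).trans hball
  have hBc : IsCompact B := isCompact_closedBall _ _
  have hχB : tsupport χ = B := χ.tsupport_eq
  let μ : Measure D.subM := Measure.addHaar
  set κ₀ : G →L[ℝ] G := autLin k (hkc k hkK)
  have hκ₀ : IsGradedHom κ₀ := isGradedHom_autLin hk
  -- The form of `k⁻¹`, evaluated on `κ₀ ∘ A`, is `det (DP_M ∘ A)`. So the maps `κ ∘ κ₀` with `κ ∈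
  -- F₀` reproduce the volume form; here `k⁻¹ ∈ K` is used.
  obtain ⟨c, hc⟩ := hdet (autLin k⁻¹ (hkc _ hkinv)) ⟨k⁻¹, hkinv, fun x => rfl⟩
  have hgr : ∀ κ : F₀, IsGradedHom ((κ : G →L[ℝ] G).comp κ₀) := fun κ => by
    obtain ⟨k', hk', hκ'⟩ := hF₀ κ.2
    have h1 := isGradedHom_autLin (hK hk')
    refine ⟨fun x y => ?_, fun t ht x => ?_⟩
    · simp only [ContinuousLinearMap.comp_apply, hκ₀.map_mul, hκ', map_mul]
    · simp only [ContinuousLinearMap.comp_apply, hκ₀.map_dil t ht, hκ']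
      exact h1.map_dil t ht _
  obtain ⟨κ, -, c', hc', hfr⟩ := exists_frequently_measure_le μ ν hBc (fun m _ => hpr m) hΛ
    (fun m hm m' hm' => hlip m (hBO hm).1 m' (hBO hm').1) Finset.univ hgr c
    (fun A => by
      have h1 := hc (κ₀.comp A)
      have h2 : (autLin k⁻¹ (hkc _ hkinv)).comp (κ₀.comp A) = A := by
        ext v
        exact MulAut.inv_apply_self _ _ _
      rw [h2] at h1
      rw [← h1]
      rfl)
    χ.contDiff χ.hasCompactSupport (fun x => ⟨χ.nonneg, χ.le_one⟩) hχB.subset χ.integral_pos hξX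
    hKs hKd
  have hnt : Nontrivial G := Module.nontrivial_of_finrank_pos (R := ℝ) (by omega)
  have hdm : ν.metricDim (D.M : Set G) = dm := by
    have h1 := hdims.2.2
    have h2 : (D'.M : Set G) = k '' (D.M : Set G) := by rw [hM]; rfl
    rwa [h2, ν.metricDim_image hk.2] at h1
  obtain ⟨C, hC⟩ := D.exists_measure_pr_image_le ν μ hdm hk.2
  obtain ⟨R, hR⟩ := hBc.exists_bound_of_continuousOn
    (ν.continuous'.comp_continuousOn (hkΦ.mono fun m hm => (hBO hm).1))
  refine ⟨_, Finset.mem_image_of_mem _ κ.2, R, c' / (C + 1), by positivity,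
    hfr.mono fun n hn => ?_⟩
  set P := {x ∈ tsupport χ | ξ (D.pr ((κ : G →L[ℝ] G).comp κ₀ (Φ x))) ∈ Ks n}
  have hPB : ∀ m ∈ P, m ∈ B := fun m hm => hχB ▸ hm.1
  set A := (D'.graph Ω f ∩ W) ∩
    ({x | ν x ≤ R} ∩ (fun x => ξ (D.pr ((κ : G →L[ℝ] G) x))) ⁻¹' Ks n)
  -- The map `P_M ∘ k⁻¹` undoes `m ↦ k (Φ m)`, so the lower bound on `M` passes to the spherical
  -- measure on the graph.
  have hsub : P ⊆ (fun x => D.pr (k⁻¹ x)) '' A := fun m hm => by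
    refine ⟨k (Φ m), ⟨⟨?_, (hBO (hPB m hm)).2⟩, ?_, hm.2⟩, ?_⟩
    · rw [← himg]
      exact mem_image_of_mem _ (hBO (hPB m hm)).1
    · exact (le_abs_self _).trans (hR m (hPB m hm))
    · simp only [MulAut.inv_apply_self, hpr]
  have h3 : ENNReal.ofNNReal (c' * (1 / 2) ^ n.factorial) ≤ (C + 1 : ℝ≥0) * ν.sphericalMeasure dm A :=
    (hn.trans (measure_mono hsub)).trans ((hC A).trans (by gcongr; exact le_self_add))
  have h4 : ENNReal.ofNNReal (c' / (C + 1) * (1 / 2) ^ n.factorial) =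
      ENNReal.ofNNReal (c' * (1 / 2) ^ n.factorial) / (C + 1 : ℝ≥0) := by
    rw [← ENNReal.coe_div (by positivity)]
    congr 1
    rw [div_mul_eq_mul_div]
  rw [h4]
  exact ENNReal.div_le_of_le_mul' h3

end Decomposition

end CarnotGroup

theorem mainTheorem1 {G : Type*} [NormedAddCommGroup G] [NormedSpace ℝ G]
    [FiniteDimensional ℝ G] [Group G] [CarnotGroup G] [MeasurableSpace G] [BorelSpace G]
    (ν : CarnotGroup.HomogeneousNorm G)
    (haar : Measure G) [haar.IsHaarMeasure]
    (dt : ℕ) (dm : ℝ≥0)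
    (l : ℕ) (D : Fin l → CarnotGroup.Decomposition G)
    (K : Fin l → Subgroup (MulAut G))
    (hK : ∀ α, K α ≤ CarnotGroup.gradedIsometryGroup ν)
    (surfaces : Set (Set G))
    (hsurfaces : ∀ S ∈ surfaces,
      CarnotGroup.IsIntrinsicLipschitzSurface ν (⋃ α, (D α).orbit (K α)) dt dm S)
    (U : Set G) (hU : IsOpen U)
    (p : ℝ) (hp0 : 0 < p) (hp1 : p < 1) :
    pModule haar p
      {σ | ∃ S ∈ surfaces, (S ∩ U).Nonempty ∧
        σ = (ν.sphericalMeasure dm).restrict (S ∩ U)} = 0 := by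
  classical
  obtain ⟨Ks, hKs, hdisj, hvol, hKd⟩ := exists_sparse_sets
  choose F hF hsurf using fun α =>
    CarnotGroup.Decomposition.exists_test_functions (D α) ν (hK α) hKs hKd
  -- Integer-valued radii index the shells on which the test function is damped.
  set N : G → ℕ := fun x => ⌈ν x⌉₊
  have hN : Measurable N := Nat.measurable_ceil.comp ν.continuous'.measurable
  have hNk : ∀ k : ℕ, N ⁻¹' Iic k = {x | ν x ≤ k} := fun k => by
    ext x
    simp [N, Nat.ceil_le]
  set E := {σ | ∃ S ∈ surfaces, (S ∩ U).Nonempty ∧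
    σ = (ν.sphericalMeasure dm).restrict (S ∩ U)}
  set Eu : (G → ℝ) → Set (Measure G) := fun u => {σ | ∃ (k : ℕ) (c : ℝ≥0), 0 < c ∧
    ∃ᶠ n in atTop, ENNReal.ofNNReal (c * (1 / 2) ^ n.factorial) ≤
      σ (N ⁻¹' Iic k ∩ u ⁻¹' Ks n)}
  -- Only a lower bound for the surface measure is needed, so each surface may be examined near a
  -- single point of `S ∩ U`, where it is one graph.
  have hcover : E ⊆ ⋃ u ∈ Finset.univ.biUnion F, Eu u := by
    rintro σ ⟨S, hS, ⟨x, hxS, hxU⟩, rfl⟩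
    obtain ⟨⟨hdt1, hdt2⟩, -, -, hloc⟩ := hsurfaces S hS
    obtain ⟨V, hV, hxV, D', hD', hdims, Ω, f, hΩ, hf, hSV⟩ := hloc x hxS
    obtain ⟨α, hα⟩ := mem_iUnion.mp hD'
    have hxg : x ∈ D'.graph Ω f := (hSV.subset ⟨hxS, hxV⟩).1
    obtain ⟨u, hu, R, c, hc, hfr⟩ := hsurf α dt dm hdt1 hdt2 D' hα hdims Ω f hΩ hf (V ∩ U)
      (hV.inter hU) ⟨x, hxg, hxV, hxU⟩
    refine mem_iUnion₂.mpr ⟨u, Finset.mem_biUnion.mpr ⟨α, Finset.mem_univ _, hu⟩, ⌈R⌉₊, c, hc,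
      hfr.mono fun n hn => hn.trans ?_⟩
    refine le_trans (measure_mono ?_) (Measure.le_restrict_apply _ _)
    rintro y ⟨⟨hyg, hyV, hyU⟩, hyR, hyu⟩
    refine ⟨⟨?_, hyu⟩, (hSV.symm.subset ⟨hyg, hyV⟩).1, hyU⟩
    rw [hNk]
    exact le_trans hyR (Nat.le_ceil R)
  refine le_antisymm ((pModule_mono hcover).trans (le_of_eq ?_)) zero_le
  refine pModule_biUnion_eq_zero hp0 _ _ fun u hu => ?_
  obtain ⟨α, -, hu⟩ := Finset.mem_biUnion.mp hu
  obtain ⟨huc, X, huX⟩ := hF α u hu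
  refine pModule_eq_zero_of_frequently hp0 hp1 hN huc.measurable (fun n => (hKs n).measurableSet)
    hdisj (fun k => ?_) fun σ hσ => hσ
  obtain ⟨C, R', hR', hC⟩ := ν.exists_measure_preimage_le haar huc huX k
  obtain ⟨C', hC'⟩ := hvol R' hR'
  refine ⟨C * C', fun n => ?_⟩
  rw [hNk, mul_assoc, ENNReal.coe_mul]
  exact (hC (Ks n) (hKs n).measurableSet).trans (mul_le_mul_right (hC' n) _)
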